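/- Let $(M,\langle\cdot,\cdot\rangle)$ be a connected complete smooth Riemannian manifold without boundary, of dimension $m$; "a.e.", $|\cdot|$ of sets and unspecified integrals refer to its Riemannian volume, and $B_R(x_0)$ is the geodesic ball. Let $p\in(1,+\infty)$, $p'=\frac{p}{p-1}$, and let $A$ assign to $x\in M$, $s\in\mathbb R$, $\xi\in T_xM$ a vector $A(x,s,\xi)\in T_xM$, so that in every smooth chart $\psi:U\to\mathbb R^m$ the local representation $\tilde A(y,s,v)$ of $A$ is continuous in $(s,v)$ for a.e. $y\in\psi(U)$ and measurable in $y$ for all $(s,v)$. Assume that $Lu=\operatorname{div}A(x,u,\nabla u)$ is weakly-$p$-coercive with constant $k>0$, that is, for all $x\in M$, $s\in\mathbb R$, $\xi\in T_xM$, $$\langle A(x,s,\xi),\xi\rangle\ge 0,\qquad |A(x,s,\xi)|\le k\,\langle A(x,s,\xi),\xi\rangle^{\frac{p-1}{p}}.$$ Let $\lambda>0$, $\mu\in[0,p]$ and let $V:M\to(0,+\infty)$ be continuous with $$V\ge\lambda\ \text{ on } M\ \text{ if }\mu=0,\qquad \liminf_{x\to\infty}\,\bigl[\operatorname{dist}(x,o)^\mu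 V(x)\bigr]\ge\lambda\ \text{ for some } o\in M\ \text{ if }\mu\in(0,p].$$ Let $u\in W^{1,p}_{\rm loc}(M)$ and $0\le s_0<\operatorname{ess\,sup}_M u$ be such that $Lu\ge Vu^{p-1}$ weakly on $\Omega_{s_0}:=\{x\in M: u(x)>s_0\}$, that is, $$-\int_M\langle A(x,u,\nabla u),\nabla\varphi\rangle\ \ge\ \int_M V u^{p-1}\varphi$$ for every compactly supported $\varphi\in W^{1,p}_{\rm loc}(M)$ with $\varphi\ge 0$ on $M$ and $\varphi=0$, $\nabla\varphi=0$ a.e. on $M\setminus\Omega_{s_0}$. Let $x_0\in M$, $q\in(p-1,+\infty)$ and $$C_0:=\frac{p\,(q-p+1)^{1/p'}\lambda^{1/p}}{(p-1)^{1/p'}k}>0 .$$ Then the following hold, where $(\cdot)_+$ is the positive part, integrals may be $+\infty$, and $\log(+\infty)=+\infty$. 1. If $\mu\in[0,p)$, then $$\liminf_{R\to+\infty}\frac{1-\frac{\mu}{p}}{R^{1-\frac{\mu}{p}}}\log\int_{B_R(x_0)}(u-s_0)_+^q\ \ge\ C_0 .$$ 2. If $\mu=p$, there is a unique $C_1>p$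 with $C_1^{1/p}(C_1-p)^{1/p'}=C_0$, and $$\liminf_{R\to+\infty}\frac{1}{\log R}\log\int_{B_R(x_0)}(u-s_0)_+^q\ \ge\ C_1 .$$ 3. If $\mu=p$ and the limit $\displaystyle\lim_{R\to+\infty}\frac{1}{\log R}\log\int_{B_R(x_0)}(u-s_0)_+^q$ exists in $[-\infty,+\infty]$, then it is at least $C_0+p$. -/

import Mathlib

open MeasureTheory Filter Set Bundle
open scoped Manifold ContDiff Topology ENNReal RealInnerProductSpace

noncomputable section

namespace RiemannianGrowth

variable {m : ℕ} {M : Type*} [MetricSpace M] [ChartedSpace (EuclideanSpace ℝ (Fin m)) M]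

/-- The smooth charts of `M` (the maximal smooth atlas). -/
def smoothCharts (m : ℕ) (M : Type*) [MetricSpace M]
    [ChartedSpace (EuclideanSpace ℝ (Fin m)) M] :
    Set (OpenPartialHomeomorph M (EuclideanSpace ℝ (Fin m))) :=
  IsManifold.maximalAtlas (𝓡 m) ∞ M

/-- The vector `∑ vⁱ ∂/∂yⁱ` at the point `ψ⁻¹ y`, for a chart `ψ` and `v ∈ ℝᵐ`. -/
def chartVector (ψ : OpenPartialHomeomorph M (EuclideanSpace ℝ (Fin m)))
    (y v : EuclideanSpace ℝ (Fin m)) : TangentSpace (𝓡 m) (ψ.symm y) :=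
  mfderiv (𝓡 m) (𝓡 m) ψ.symm y v

/-- The components in the chart `ψ` of a tangent vector at the point `ψ⁻¹ y`. -/
def chartComponents (ψ : OpenPartialHomeomorph M (EuclideanSpace ℝ (Fin m)))
    (y : EuclideanSpace ℝ (Fin m)) (ξ : TangentSpace (𝓡 m) (ψ.symm y)) :
    EuclideanSpace ℝ (Fin m) :=
  mfderiv (𝓡 m) (𝓡 m) ψ (ψ.symm y) ξ

/-- The coordinate field `∂/∂yⁱ` at the point `ψ⁻¹ y`. -/
def coordField (ψ : OpenPartialHomeomorph M (EuclideanSpace ℝ (Fin m)))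
    (y : EuclideanSpace ℝ (Fin m)) (i : Fin m) : TangentSpace (𝓡 m) (ψ.symm y) :=
  chartVector ψ y (EuclideanSpace.single i 1)

variable [RiemannianBundle (fun x : M ↦ TangentSpace (𝓡 m) x)]

/-- The Riemannian density `√(det gᵢⱼ)` in the chart `ψ`. -/
def chartDensity (ψ : OpenPartialHomeomorph M (EuclideanSpace ℝ (Fin m)))
    (y : EuclideanSpace ℝ (Fin m)) : ℝ :=
  Real.sqrt (Matrix.of fun i j : Fin m ↦ ⟪coordField ψ y i, coordField ψ y j⟫).det

/-- The Riemannian volume on the domain of the chart `ψ` (extended by zero to `M`). -/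
def chartVolume [MeasurableSpace M]
    (ψ : OpenPartialHomeomorph M (EuclideanSpace ℝ (Fin m))) : Measure M :=
  ((volume.restrict ψ.target).withDensity
    fun y ↦ ENNReal.ofReal (chartDensity ψ y)).map ψ.symm

/-- The Riemannian volume measure. The chart volumes agree on overlaps, so their least upper
bound is the measure whose restriction to each chart domain is the chart volume. -/
def vol (m : ℕ) (M : Type*) [MetricSpace M] [ChartedSpace (EuclideanSpace ℝ (Fin m)) M]
    [RiemannianBundle (fun x : M ↦ TangentSpace (𝓡 m) x)] [MeasurableSpace M] : Measure M :=
  ⨆ ψ ∈ smoothCharts m M, chartVolume ψ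

/-- On an open set `U ⊆ ℝᵐ`: `f ∈ W^{1,p}_loc(U)` with weak partial derivatives `g i`. -/
structure IsEuclideanSobolevLoc (p : ℝ) (U : Set (EuclideanSpace ℝ (Fin m)))
    (f : EuclideanSpace ℝ (Fin m) → ℝ) (g : Fin m → EuclideanSpace ℝ (Fin m) → ℝ) : Prop where
  memLp : ∀ K ⊆ U, IsCompact K → MemLp f (ENNReal.ofReal p) (volume.restrict K)
  memLp_deriv : ∀ i, ∀ K ⊆ U, IsCompact K → MemLp (g i) (ENNReal.ofReal p) (volume.restrict K)
  weakDeriv : ∀ i, ∀ φ : EuclideanSpace ℝ (Fin m) → ℝ, ContDiff ℝ ∞ φ → HasCompactSupport φ →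
    tsupport φ ⊆ U →
    ∫ y, f y * fderiv ℝ φ y (EuclideanSpace.single i 1) = - ∫ y, g i y * φ y

/-- `u ∈ W^{1,p}_loc(M)` with weak gradient `X`: in each smooth chart `ψ` the function `u ∘ ψ⁻¹`
is in `W^{1,p}_loc`, with weak partial derivatives `⟨X, ∂/∂yⁱ⟩`. -/
def IsSobolevLoc (p : ℝ) (u : M → ℝ) (X : (x : M) → TangentSpace (𝓡 m) x) : Prop :=
  ∀ ψ ∈ smoothCharts m M, IsEuclideanSobolevLoc p ψ.target (fun y ↦ u (ψ.symm y))
    (fun i y ↦ ⟪X (ψ.symm y), coordField ψ y i⟫)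

/-- The Carathéodory conditions on the local representations of `A` in all smooth charts. -/
def IsCaratheodory
    (A : (x : M) → ℝ → TangentSpace (𝓡 m) x → TangentSpace (𝓡 m) x) : Prop :=
  ∀ ψ ∈ smoothCharts m M,
    (∀ᵐ y ∂(volume.restrict ψ.target), Continuous fun sv : ℝ × EuclideanSpace ℝ (Fin m) ↦
      chartComponents ψ y (A (ψ.symm y) sv.1 (chartVector ψ y sv.2))) ∧
    ∀ (s : ℝ) (v : EuclideanSpace ℝ (Fin m)),
      AEMeasurable (fun y ↦ chartComponents ψ y (A (ψ.symm y) s (chartVector ψ y v)))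
        (volume.restrict ψ.target)

/-- `A`, and the operator `u ↦ div A(x, u, ∇u)`, are weakly-`p`-coercive with constant `k`. -/
structure IsWeaklyCoercive (p k : ℝ)
    (A : (x : M) → ℝ → TangentSpace (𝓡 m) x → TangentSpace (𝓡 m) x) : Prop where
  caratheodory : IsCaratheodory A
  nonneg : ∀ (x : M) (s : ℝ) (ξ : TangentSpace (𝓡 m) x), 0 ≤ ⟪A x s ξ, ξ⟫
  norm_le : ∀ (x : M) (s : ℝ) (ξ : TangentSpace (𝓡 m) x),
    ‖A x s ξ‖ ≤ k * ⟪A x s ξ, ξ⟫ ^ ((p - 1) / p)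

/-- `φ ∈ D⁺(Ω)`, with weak gradient `Y`: `φ ∈ W^{1,p}_c(M)`, `φ ≥ 0`, and `φ = 0`, `∇φ = 0`
a.e. on the complement of `Ω`. -/
structure IsTestFunction [MeasurableSpace M] (p : ℝ) (Ω : Set M) (φ : M → ℝ)
    (Y : (x : M) → TangentSpace (𝓡 m) x) : Prop where
  sobolev : IsSobolevLoc p φ Y
  compactSupport : HasCompactSupport φ
  nonneg : ∀ x, 0 ≤ φ x
  eq_zero : ∀ᵐ x ∂(vol m M), x ∉ Ω → φ x = 0 ∧ Y x = 0

/-- `div A(x, u, ∇u) ≥ f` weakly on `{u > s₀}`, where `X` is the weak gradient of `u` and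
`f : M → [0, ∞]`. -/
def WeakIneq [MeasurableSpace M] (p : ℝ)
    (A : (x : M) → ℝ → TangentSpace (𝓡 m) x → TangentSpace (𝓡 m) x)
    (u : M → ℝ) (X : (x : M) → TangentSpace (𝓡 m) x) (f : M → ℝ≥0∞) (s₀ : ℝ) : Prop :=
  ∀ (φ : M → ℝ) (Y : (x : M) → TangentSpace (𝓡 m) x),
    IsTestFunction p {x | s₀ < u x} φ Y →
    ((∫⁻ x, f x * ENNReal.ofReal (φ x) ∂(vol m M) : ℝ≥0∞) : EReal) ≤
      ((- ∫ x, ⟪A x (u x) (X x), Y x⟫ ∂(vol m M) : ℝ) : EReal)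

/-- The lower bound on the potential: `V ≥ lam` if `μ = 0`, and
`liminf_{x → ∞} dist(x, o) ^ μ * V x ≥ lam` for some `o` if `μ > 0`. -/
def PotentialBound {M : Type*} [MetricSpace M] (V : M → ℝ) (lam μ : ℝ) : Prop :=
  (μ = 0 → ∀ x, lam ≤ V x) ∧
  (0 < μ → ∃ o : M,
    (lam : EReal) ≤ liminf (fun x ↦ ((dist x o ^ μ * V x : ℝ) : EReal)) (cocompact M))

/-- `log ∫_{B_R(x₀)} (u - s₀)₊ ^ q`, as an extended real number. -/
def logBallIntegral (m : ℕ) {M : Type*} [MetricSpace M]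
    [ChartedSpace (EuclideanSpace ℝ (Fin m)) M]
    [RiemannianBundle (fun x : M ↦ TangentSpace (𝓡 m) x)] [MeasurableSpace M]
    (u : M → ℝ) (s₀ q : ℝ) (x₀ : M) (R : ℝ) : EReal :=
  ENNReal.log (∫⁻ x in Metric.ball x₀ R, ENNReal.ofReal (max (u x - s₀) 0 ^ q) ∂(vol m M))

/-- `C₀ = p (q - p + 1)^{1/p'} lam^{1/p} / ((p - 1)^{1/p'} k)`, with `p' = p / (p - 1)`. -/
def growthConst (p q lam k : ℝ) : ℝ :=
  p * (q - p + 1) ^ (1 / p.conjExponent) * lam ^ (1 / p) / ((p - 1) ^ (1 / p.conjExponent) * k)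

end RiemannianGrowth

end

open RiemannianGrowth

/-!
Test the inequality with `ψ (u - s₀) * h (dist x x₀) ^ p`, where `ψ` truncates the power
`(u - s₀)₊ ^ (q - p + 1)` and `h` is a compactly supported radial weight. Young's inequality and
weak coercivity absorb the gradient of `u`, and removing the truncation leaves a Hardy inequality
`∫ V h ^ p dν ≤ K ∫ |∇h| ^ p dν` for the measure `ν = (u - s₀)₊ ^ q dvol`.

Insert `h = exp (-Φ)` with `K Φ' ^ p < V` far out, cut off linearly on the annulus between the
radii `S` and `S + d`. The left side dominates the right side on the inner ball, with a positive
gap, so the annulus, on which `|∇h| ≤ exp (-Φ(S)) (Φ'(S) + 1 / d)`, must carry at least a fixed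
amount: `ν (B_{S + d}) ≥ D exp (p Φ(S)) (Φ'(S) + 1 / d) ^ (-p)`. The choice
`Φ' = c r ^ (-μ / p)`, with `d` constant for `μ < p` and proportional to `S` for `μ = p`, gives the
growth rates as `c` increases to `C₀ / p`. In the case `μ = p` the factor `d ^ p` yields the extra
summand `p`, and `C₁ ≤ C₀ + p`.
-/

noncomputable section

namespace RiemannianGrowth

open Manifold
open scoped NNReal Convolution

section Slope

variable {α β γ : Type*} [PseudoMetricSpace α] [PseudoMetricSpace β] [PseudoMetricSpace γ]

/-- The local Lipschitz constant `limsup_{z → x} dist (f z) (f x) / dist z x` of `f` at `x` is at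
most `L`. It plays the role of `|f' x|` for functions that are not differentiable, such as the
distance to a point. -/
def HasSlopeLE (f : α → β) (x : α) (L : ℝ) : Prop :=
  ∀ ε > 0, ∀ᶠ z in 𝓝 x, dist (f z) (f x) ≤ (L + ε) * dist z x

variable {f : α → β} {x : α} {L : ℝ}

theorem HasSlopeLE.continuousAt (hf : HasSlopeLE f x L) : ContinuousAt f x := by
  rw [ContinuousAt, tendsto_iff_dist_tendsto_zero]
  have hlim : Tendsto (fun z ↦ (L + 1) * dist z x) (𝓝 x) (𝓝 ((L + 1) * dist x x)) :=
    Continuous.tendsto (by fun_prop) x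
  rw [dist_self, mul_zero] at hlim
  exact squeeze_zero' (Eventually.of_forall fun _ ↦ dist_nonneg) (hf 1 one_pos) hlim

theorem HasSlopeLE.mono {L' : ℝ} (hf : HasSlopeLE f x L) (hL : L ≤ L') : HasSlopeLE f x L' := by
  intro ε hε
  filter_upwards [hf ε hε] with z hz
  exact hz.trans (by gcongr)

theorem hasSlopeLE_zero_of_eventuallyEq_const {c : β} (hf : ∀ᶠ z in 𝓝 x, f z = c) :
    HasSlopeLE f x 0 := by
  intro ε hε
  filter_upwards [hf] with z hz
  rw [hz, hf.self_of_nhds, dist_self]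
  positivity

theorem hasSlopeLE_of_lipschitzWith {K : ℝ≥0} (hf : LipschitzWith K f) (x : α) :
    HasSlopeLE f x K := by
  intro ε hε
  filter_upwards with z
  exact (hf.dist_le_mul z x).trans (by gcongr; linarith)

theorem hasSlopeLE_of_hasDerivAt {φ : ℝ → ℝ} {d t : ℝ} (h : HasDerivAt φ d t) :
    HasSlopeLE φ t |d| := by
  intro ε hε
  filter_upwards [(hasDerivAt_iff_isLittleO.1 h).def hε] with z hz
  simp only [Real.norm_eq_abs, smul_eq_mul] at hz
  rw [Real.dist_eq, Real.dist_eq]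
  calc |φ z - φ t| = |(φ z - φ t - (z - t) * d) + (z - t) * d| := by ring_nf
    _ ≤ |φ z - φ t - (z - t) * d| + |(z - t) * d| := abs_add_le _ _
    _ ≤ ε * |z - t| + |z - t| * |d| := by rw [abs_mul]; gcongr
    _ = (|d| + ε) * |z - t| := by ring

theorem exists_pos_lt_of_continuous {G : ℝ → ℝ} (hG : Continuous G) {c : ℝ} (hc : G 0 < c) :
    ∃ δ > 0, G δ < c := by
  have hev : ∀ᶠ δ in 𝓝[>] (0 : ℝ), G δ < c :=
    ((hG.tendsto 0).mono_left nhdsWithin_le_nhds).eventually (gt_mem_nhds hc)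
  obtain ⟨δ, hδc, hδ⟩ := (hev.and self_mem_nhdsWithin).exists
  exact ⟨δ, hδ, hδc⟩

theorem HasSlopeLE.comp {g : β → γ} {D : ℝ} (hg : HasSlopeLE g (f x) D) (hD : 0 ≤ D)
    (hf : HasSlopeLE f x L) : HasSlopeLE (fun z ↦ g (f z)) x (D * L) := by
  intro ε hε
  obtain ⟨δ, hδ, hδε⟩ := exists_pos_lt_of_continuous (G := fun δ ↦ (D + δ) * (L + δ))
    (c := D * L + ε) (by fun_prop) (by simpa only [add_zero, lt_add_iff_pos_right] using hε)
  filter_upwards [hf δ hδ, hf.continuousAt.eventually (hg δ hδ)] with z hfz hgz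
  calc dist (g (f z)) (g (f x)) ≤ (D + δ) * dist (f z) (f x) := hgz
    _ ≤ (D + δ) * ((L + δ) * dist z x) := by gcongr
    _ = ((D + δ) * (L + δ)) * dist z x := by ring
    _ ≤ (D * L + ε) * dist z x := by gcongr

theorem HasSlopeLE.mul {f₁ f₂ : α → ℝ} {L₁ L₂ : ℝ} (h₁ : HasSlopeLE f₁ x L₁)
    (h₂ : HasSlopeLE f₂ x L₂) :
    HasSlopeLE (fun z ↦ f₁ z * f₂ z) x (|f₁ x| * L₂ + |f₂ x| * L₁) := by
  intro ε hε
  obtain ⟨δ, hδ, hδε⟩ := exists_pos_lt_of_continuous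
    (G := fun δ ↦ (|f₁ x| + δ) * (L₂ + δ) + |f₂ x| * (L₁ + δ))
    (c := |f₁ x| * L₂ + |f₂ x| * L₁ + ε) (by fun_prop)
    (by simpa only [add_zero, lt_add_iff_pos_right] using hε)
  have hbdd : ∀ᶠ z in 𝓝 x, |f₁ z| ≤ |f₁ x| + δ :=
    h₁.continuousAt.abs.eventually (eventually_le_nhds (by linarith))
  filter_upwards [h₁ δ hδ, h₂ δ hδ, hbdd] with z hz₁ hz₂ hz
  rw [Real.dist_eq (f₁ z)] at hz₁
  rw [Real.dist_eq (f₂ z)] at hz₂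
  rw [Real.dist_eq (f₁ z * f₂ z)]
  calc |f₁ z * f₂ z - f₁ x * f₂ x| = |f₁ z * (f₂ z - f₂ x) + f₂ x * (f₁ z - f₁ x)| := by ring_nf
    _ ≤ |f₁ z| * |f₂ z - f₂ x| + |f₂ x| * |f₁ z - f₁ x| := by
        rw [← abs_mul, ← abs_mul]; exact abs_add_le _ _
    _ ≤ (|f₁ x| + δ) * ((L₂ + δ) * dist z x) + |f₂ x| * ((L₁ + δ) * dist z x) := by gcongr
    _ = ((|f₁ x| + δ) * (L₂ + δ) + |f₂ x| * (L₁ + δ)) * dist z x := by ring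
    _ ≤ (|f₁ x| * L₂ + |f₂ x| * L₁ + ε) * dist z x := by gcongr

theorem sub_le_of_forall_hasSlopeLE {f : ℝ → ℝ} {K : ℝ} (hf : ∀ t, HasSlopeLE f t K) {a b : ℝ}
    (hab : a ≤ b) : f b - f a ≤ K * (b - a) := by
  have hbound := image_le_of_liminf_slope_right_le_deriv_boundary (f := f) (a := a) (b := b)
    (B := fun t ↦ f a + K * (t - a)) (B' := fun _ ↦ K)
    (fun t _ ↦ (hf t).continuousAt.continuousWithinAt) (by simp) (by fun_prop)
    (fun t _ ↦ by
      simpa using ((((hasDerivAt_id t).sub_const a).const_mul K).const_add (f a)).hasDerivWithinAt)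
    (fun t _ r hr ↦ ?_) (right_mem_Icc.2 hab)
  · linarith
  · obtain ⟨ε, hε, hεr⟩ : ∃ ε > 0, K + ε < r := ⟨(r - K) / 2, by linarith, by linarith⟩
    refine Eventually.frequently ?_
    filter_upwards [nhdsWithin_le_nhds (hf t ε hε), self_mem_nhdsWithin] with z hz htz
    have htz' : 0 < z - t := sub_pos.2 htz
    rw [Real.dist_eq, Real.dist_eq, abs_of_pos htz'] at hz
    rw [slope_def_field, div_lt_iff₀ htz']
    calc f z - f t ≤ (K + ε) * (z - t) := (le_abs_self _).trans hz
      _ < r * (z - t) := by gcongr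

theorem lipschitzWith_of_forall_hasSlopeLE {E : Type*} [NormedAddCommGroup E] [NormedSpace ℝ E]
    {f : E → ℝ} {K : ℝ≥0} (hf : ∀ x, HasSlopeLE f x K) : LipschitzWith K f := by
  refine LipschitzWith.of_le_add_mul _ fun x y ↦ ?_
  have hline (t : ℝ) : HasSlopeLE (fun s : ℝ ↦ f (AffineMap.lineMap y x s)) t
      (K * nndist y x) :=
    (hf _).comp K.2 (hasSlopeLE_of_lipschitzWith (lipschitzWith_lineMap y x) t)
  have := sub_le_of_forall_hasSlopeLE hline zero_le_one
  simp only [AffineMap.lineMap_apply_zero, AffineMap.lineMap_apply_one, coe_nndist, sub_zero,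
    mul_one] at this
  rw [dist_comm x y]
  linarith

theorem HasSlopeLE.abs_hasDerivAt_le {φ : ℝ → ℝ} {d t L : ℝ} (hφ : HasSlopeLE φ t L)
    (hd : HasDerivAt φ d t) (hL : 0 ≤ L) : |d| ≤ L :=
  le_of_forall_pos_le_add fun ε hε ↦ hd.le_of_lip' (by positivity) (by
    simpa only [dist_eq_norm] using hφ ε hε)

end Slope

section RadialWeight

/-- `h ∘ dist · x₀` is an admissible radial weight supported in the closed ball of radius `R`, and
`g ∘ dist · x₀` dominates the norm of its gradient. -/
structure IsRadialWeight (h g : ℝ → ℝ) (R : ℝ) : Prop where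
  nonneg : ∀ r, 0 ≤ h r
  slope_nonneg : ∀ r, 0 ≤ g r
  measurable_slope : Measurable g
  bddAbove_slope : BddAbove (range g)
  hasSlopeLE : ∀ r, HasSlopeLE h r (g r)
  eq_zero : ∀ r, R < r → h r = 0
  slope_eq_zero : ∀ r, R < r → g r = 0

theorem IsRadialWeight.exists_lipschitzWith {h g : ℝ → ℝ} {R : ℝ} (hhg : IsRadialWeight h g R) :
    ∃ K, LipschitzWith K h := by
  obtain ⟨G, hG⟩ := hhg.bddAbove_slope
  have hgG : ∀ r, g r ≤ G := fun r ↦ hG (mem_range_self r)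
  exact ⟨⟨G, (hhg.slope_nonneg 0).trans (hgG 0)⟩,
    lipschitzWith_of_forall_hasSlopeLE fun r ↦ (hhg.hasSlopeLE r).mono (hgG r)⟩

/-- On `[R₀, ∞)` the function `Φ` has derivative `ρ`, which is nonnegative and nonincreasing.
The weight `exp (-Φ)` then decays at the logarithmic rate `ρ`. -/
structure IsDecayExponent (Φ ρ : ℝ → ℝ) (R₀ : ℝ) : Prop where
  hasDerivAt : ∀ t, R₀ ≤ t → HasDerivAt Φ (ρ t) t
  rate_nonneg : ∀ t, R₀ ≤ t → 0 ≤ ρ t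
  antitoneOn_rate : AntitoneOn ρ (Ici R₀)

/-- The decaying weight `exp (-Φ)`, constant below `R₀`. -/
def decay (Φ : ℝ → ℝ) (R₀ r : ℝ) : ℝ := Real.exp (-Φ (max r R₀))

/-- The logarithmic rate of `decay Φ R₀` when `Φ' = ρ`. -/
def decayRate (ρ : ℝ → ℝ) (R₀ : ℝ) : ℝ → ℝ := (Ici R₀).indicator ρ

/-- The cutoff equal to `1` on `r ≤ S` and to `0` on `r ≥ S + d`, linear in between. -/
def cutoff (S d r : ℝ) : ℝ := max 0 (min 1 ((S + d - r) / d))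

/-- The bound `exp (-Φ S) (ρ S + 1 / d)` for the slope of `decay * cutoff` on `[S, S + d]`. -/
def cutoffSlope (Φ ρ : ℝ → ℝ) (S d : ℝ) : ℝ := Real.exp (-Φ S) * (ρ S + 1 / d)

/-- A bound for the slope of `decay * cutoff`. -/
def profileSlope (Φ ρ : ℝ → ℝ) (R₀ S d r : ℝ) : ℝ :=
  if r < S then decayRate ρ R₀ r * decay Φ R₀ r
  else if r ≤ S + d then cutoffSlope Φ ρ S d else 0

variable {Φ ρ : ℝ → ℝ} {R₀ S d r : ℝ}

theorem decay_pos (Φ : ℝ → ℝ) (R₀ r : ℝ) : 0 < decay Φ R₀ r := Real.exp_pos _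

theorem decay_of_le (hr : R₀ ≤ r) : decay Φ R₀ r = Real.exp (-Φ r) := by
  rw [decay, max_eq_left hr]

theorem cutoff_nonneg (S d r : ℝ) : 0 ≤ cutoff S d r := le_max_left _ _

theorem cutoff_le_one (S d r : ℝ) : cutoff S d r ≤ 1 := max_le zero_le_one (min_le_left _ _)

theorem cutoff_eq_one (hd : 0 < d) (hr : r ≤ S) : cutoff S d r = 1 := by
  have hge : 1 ≤ (S + d - r) / d := by rw [one_le_div hd]; linarith
  rw [cutoff, min_eq_left hge, max_eq_right zero_le_one]

theorem cutoff_eq_zero (hd : 0 < d) (hr : S + d ≤ r) : cutoff S d r = 0 :=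
  max_eq_left ((min_le_right _ _).trans (div_nonpos_of_nonpos_of_nonneg (by linarith) hd.le))

theorem lipschitzWith_cutoff (S : ℝ) (hd : 0 < d) :
    LipschitzWith (1 / d).toNNReal (cutoff S d) := by
  refine LipschitzWith.const_max (LipschitzWith.const_min
    (LipschitzWith.of_dist_le' fun x y ↦ le_of_eq ?_) 1) 0
  rw [Real.dist_eq, Real.dist_eq, ← sub_div, sub_sub_sub_cancel_left, abs_div, abs_of_pos hd,
    abs_sub_comm, div_eq_inv_mul, one_div]

namespace IsDecayExponent

variable (hΦ : IsDecayExponent Φ ρ R₀)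
include hΦ

theorem decayRate_nonneg (r : ℝ) : 0 ≤ decayRate ρ R₀ r := indicator_nonneg hΦ.rate_nonneg r

theorem decayRate_le (r : ℝ) : decayRate ρ R₀ r ≤ ρ R₀ :=
  indicator_apply_le' (fun hr ↦ hΦ.antitoneOn_rate self_mem_Ici hr hr)
    fun _ ↦ hΦ.rate_nonneg R₀ le_rfl

theorem measurable_decayRate : Measurable (decayRate ρ R₀) := by
  have hanti : Antitone fun r ↦ ρ (max r R₀) := fun r s hrs ↦
    hΦ.antitoneOn_rate (mem_Ici.2 (le_max_right _ _)) (mem_Ici.2 (le_max_right _ _))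
      (max_le_max_right R₀ hrs)
  have heq : decayRate ρ R₀ = (Ici R₀).indicator fun r ↦ ρ (max r R₀) :=
    indicator_congr fun r hr ↦ by rw [max_eq_left (mem_Ici.1 hr)]
  rw [heq]
  exact hanti.measurable.indicator measurableSet_Ici

theorem antitone_decay : Antitone (decay Φ R₀) := by
  have hmono : MonotoneOn Φ (Ici R₀) := by
    refine monotoneOn_of_hasDerivWithinAt_nonneg (f' := ρ) (convex_Ici R₀)
      (fun t ht ↦ (hΦ.hasDerivAt t ht).continuousAt.continuousWithinAt)
      (fun t ht ↦ (hΦ.hasDerivAt t (interior_subset ht)).hasDerivWithinAt)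
      (fun t ht ↦ hΦ.rate_nonneg t (interior_subset ht))
  intro r s hrs
  exact Real.exp_le_exp.2 (neg_le_neg
    (hmono (le_max_right r R₀) (le_max_right s R₀) (max_le_max_right R₀ hrs)))

theorem hasSlopeLE_decay (r : ℝ) :
    HasSlopeLE (decay Φ R₀) r (decayRate ρ R₀ r * decay Φ R₀ r) := by
  rcases lt_or_ge r R₀ with hr | hr
  · rw [decayRate, indicator_of_notMem (notMem_Ici.2 hr), zero_mul]
    refine hasSlopeLE_zero_of_eventuallyEq_const (c := Real.exp (-Φ R₀)) ?_
    filter_upwards [Iio_mem_nhds hr] with s hs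
    rw [decay, max_eq_right (le_of_lt hs)]
  · have hexp : HasSlopeLE (fun t ↦ Real.exp (-Φ t)) (max r R₀)
        (decayRate ρ R₀ r * decay Φ R₀ r) := by
      rw [decayRate, indicator_of_mem (mem_Ici.2 hr), decay_of_le hr, max_eq_left hr]
      convert hasSlopeLE_of_hasDerivAt (hΦ.hasDerivAt r hr).fun_neg.exp using 1
      rw [abs_mul, abs_neg, abs_of_pos (Real.exp_pos _), abs_of_nonneg (hΦ.rate_nonneg r hr),
        mul_comm]
    have hmax : HasSlopeLE (fun s ↦ max s R₀) r (1 : ℝ≥0) :=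
      hasSlopeLE_of_lipschitzWith (LipschitzWith.id.max_const R₀) r
    have hcomp := HasSlopeLE.comp (f := fun s ↦ max s R₀) hexp
      (mul_nonneg (hΦ.decayRate_nonneg r) (decay_pos _ _ _).le) hmax
    rwa [NNReal.coe_one, mul_one] at hcomp

theorem cutoffSlope_pos (hS : R₀ ≤ S) (hd : 0 < d) : 0 < cutoffSlope Φ ρ S d := by
  have := hΦ.rate_nonneg S hS
  unfold cutoffSlope
  positivity

theorem profileSlope_nonneg (hS : R₀ ≤ S) (hd : 0 < d) (r : ℝ) :
    0 ≤ profileSlope Φ ρ R₀ S d r := by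
  unfold profileSlope
  split_ifs
  · exact mul_nonneg (hΦ.decayRate_nonneg r) (decay_pos _ _ _).le
  · exact (hΦ.cutoffSlope_pos hS hd).le
  · exact le_rfl

theorem bddAbove_profileSlope (hS : R₀ ≤ S) (hd : 0 < d) :
    BddAbove (range (profileSlope Φ ρ R₀ S d)) := by
  have hρ₀ : 0 ≤ ρ R₀ := hΦ.rate_nonneg R₀ le_rfl
  refine ⟨max (ρ R₀ * Real.exp (-Φ R₀)) (cutoffSlope Φ ρ S d), ?_⟩
  rintro _ ⟨r, rfl⟩
  unfold profileSlope
  split_ifs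
  · have hdecay : decay Φ R₀ r ≤ Real.exp (-Φ R₀) := by
      rw [← decay_of_le le_rfl]
      rcases le_total R₀ r with hr | hr
      · exact hΦ.antitone_decay hr
      · rw [decay, decay, max_eq_right hr, max_self]
    exact le_max_of_le_left
      (mul_le_mul (hΦ.decayRate_le r) hdecay (decay_pos _ _ _).le hρ₀)
  · exact le_max_right _ _
  · exact le_max_of_le_right (hΦ.cutoffSlope_pos hS hd).le

theorem hasSlopeLE_decay_mul_cutoff (hS : R₀ ≤ S) (hd : 0 < d) (r : ℝ) :
    HasSlopeLE (fun r ↦ decay Φ R₀ r * cutoff S d r) r (profileSlope Φ ρ R₀ S d r) := by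
  unfold profileSlope
  split_ifs with hrS hrSd
  · have hcutoff : HasSlopeLE (cutoff S d) r 0 := by
      refine hasSlopeLE_zero_of_eventuallyEq_const (c := 1) ?_
      filter_upwards [Iio_mem_nhds hrS] with s hs using cutoff_eq_one hd (le_of_lt hs)
    simpa only [cutoff_eq_one hd hrS.le, abs_one, mul_zero, zero_add, one_mul] using
      (hΦ.hasSlopeLE_decay r).mul hcutoff
  · rw [not_lt] at hrS
    refine ((hΦ.hasSlopeLE_decay r).mul
      (hasSlopeLE_of_lipschitzWith (lipschitzWith_cutoff S hd) r)).mono ?_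
    have hdecay : decay Φ R₀ r ≤ Real.exp (-Φ S) := by
      rw [← decay_of_le hS]; exact hΦ.antitone_decay hrS
    have hrate : decayRate ρ R₀ r ≤ ρ S := by
      rw [decayRate, indicator_of_mem (mem_Ici.2 (hS.trans hrS))]
      exact hΦ.antitoneOn_rate hS (hS.trans hrS) hrS
    have hρS := hΦ.rate_nonneg S hS
    have hrate₀ := hΦ.decayRate_nonneg r
    rw [abs_of_pos (decay_pos _ _ _), abs_of_nonneg (cutoff_nonneg _ _ _),
      Real.coe_toNNReal _ (one_div_pos.2 hd).le]
    calc decay Φ R₀ r * (1 / d) + cutoff S d r * (decayRate ρ R₀ r * decay Φ R₀ r)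
        ≤ Real.exp (-Φ S) * (1 / d) + 1 * (ρ S * Real.exp (-Φ S)) := by
          have := decay_pos Φ R₀ r
          gcongr
          exact cutoff_le_one _ _ _
      _ = cutoffSlope Φ ρ S d := by rw [cutoffSlope]; ring
  · refine hasSlopeLE_zero_of_eventuallyEq_const (c := 0) ?_
    filter_upwards [Ioi_mem_nhds (not_le.1 hrSd)] with s hs
    rw [cutoff_eq_zero hd (le_of_lt hs), mul_zero]

theorem isRadialWeight_decay_mul_cutoff (hS : R₀ ≤ S) (hd : 0 < d) :
    IsRadialWeight (fun r ↦ decay Φ R₀ r * cutoff S d r) (profileSlope Φ ρ R₀ S d) (S + d) where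
  nonneg r := mul_nonneg (decay_pos _ _ _).le (cutoff_nonneg _ _ _)
  slope_nonneg := hΦ.profileSlope_nonneg hS hd
  measurable_slope := Measurable.ite measurableSet_Iio
    (hΦ.measurable_decayRate.mul hΦ.antitone_decay.measurable)
    (Measurable.ite measurableSet_Iic measurable_const measurable_const)
  bddAbove_slope := hΦ.bddAbove_profileSlope hS hd
  hasSlopeLE := hΦ.hasSlopeLE_decay_mul_cutoff hS hd
  eq_zero r hr := by rw [cutoff_eq_zero hd hr.le, mul_zero]
  slope_eq_zero r hr := by
    rw [profileSlope, if_neg (by linarith), if_neg (not_le.2 hr)]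

end IsDecayExponent

end RadialWeight

theorem log_sub_log_le_log_of_ofReal_le {D B : ℝ} (hD : 0 < D) (hB : 0 < B) {I : ℝ≥0∞}
    (h : ENNReal.ofReal D ≤ ENNReal.ofReal B * I) :
    ((Real.log D - Real.log B : ℝ) : EReal) ≤ ENNReal.log I := by
  rw [← Real.log_div hD.ne' hB.ne', ← ENNReal.log_ofReal_of_pos (by positivity)]
  refine ENNReal.log_le_log ?_
  rw [ENNReal.ofReal_div_of_pos hB]
  exact ENNReal.div_le_of_le_mul' h

section HardyGap

variable {M : Type*} [PseudoMetricSpace M] {p K : ℝ} {V : M → ℝ} {x₀ : M}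
  {Φ ρ : ℝ → ℝ} {R₀ S d : ℝ}

/-- The difference of the two sides of `RadialHardy` for the weight `decay Φ R₀`. -/
def hardyGap (p K : ℝ) (V : M → ℝ) (Φ ρ : ℝ → ℝ) (R₀ : ℝ) (x₀ x : M) : ℝ :=
  (V x - K * decayRate ρ R₀ (dist x x₀) ^ p) * decay Φ R₀ (dist x x₀) ^ p

theorem hardyGap_pos (hp : p ≠ 0)
    (hVpos : ∀ x, 0 < V x) (hVρ : ∀ x, R₀ ≤ dist x x₀ → K * ρ (dist x x₀) ^ p < V x) (x : M) :
    0 < hardyGap p K V Φ ρ R₀ x₀ x := by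
  refine mul_pos (sub_pos.2 ?_) (Real.rpow_pos_of_pos (decay_pos _ _ _) _)
  by_cases hx : R₀ ≤ dist x x₀
  · rw [decayRate, indicator_of_mem (mem_Ici.2 hx)]
    exact hVρ x hx
  · rw [decayRate, indicator_of_notMem (notMem_Ici.2 (not_le.1 hx)), Real.zero_rpow hp, mul_zero]
    exact hVpos x

theorem IsDecayExponent.ofReal_eq_hardyGap_add (hΦ : IsDecayExponent Φ ρ R₀) (hK : 0 ≤ K)
    (hd : 0 < d) {x : M} (hx : dist x x₀ < S) (hgap : 0 ≤ hardyGap p K V Φ ρ R₀ x₀ x) :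
    ENNReal.ofReal (V x * (decay Φ R₀ (dist x x₀) * cutoff S d (dist x x₀)) ^ p) =
      ENNReal.ofReal (hardyGap p K V Φ ρ R₀ x₀ x) +
        ENNReal.ofReal (K * profileSlope Φ ρ R₀ S d (dist x x₀) ^ p) := by
  have hrate := hΦ.decayRate_nonneg (dist x x₀)
  have hdecay := decay_pos Φ R₀ (dist x x₀)
  rw [profileSlope, if_pos hx, cutoff_eq_one hd hx.le, mul_one,
    ← ENNReal.ofReal_add hgap (by positivity), hardyGap, Real.mul_rpow hrate hdecay.le]
  ring_nf

end HardyGap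

section Growth

variable {M : Type*} [MeasurableSpace M] {ν : Measure M}

theorem setLIntegral_le_setLIntegral_compl {s : Set M} (hs : MeasurableSet s) {F G Q : M → ℝ≥0∞}
    (hG : Measurable G) (hFG : ∫⁻ x, F x ∂ν ≤ ∫⁻ x, G x ∂ν) (hsplit : ∀ x ∈ s, F x = Q x + G x)
    (hfin : ∫⁻ x in s, G x ∂ν ≠ ⊤) : ∫⁻ x in s, Q x ∂ν ≤ ∫⁻ x in sᶜ, G x ∂ν := by
  refine (ENNReal.add_le_add_iff_right hfin).1 ?_
  calc ∫⁻ x in s, Q x ∂ν + ∫⁻ x in s, G x ∂ν = ∫⁻ x in s, F x ∂ν := by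
        rw [← lintegral_add_right _ hG, setLIntegral_congr_fun hs hsplit]
    _ ≤ ∫⁻ x, G x ∂ν := (setLIntegral_le_lintegral _ _).trans hFG
    _ = ∫⁻ x in sᶜ, G x ∂ν + ∫⁻ x in s, G x ∂ν := by rw [add_comm, lintegral_add_compl _ hs]

theorem setLIntegral_le_mul_measure {s t : Set M} (hs : MeasurableSet s) (ht : MeasurableSet t)
    {f : M → ℝ≥0∞} {c : ℝ≥0∞} (hf : ∀ x ∈ s, f x ≤ t.indicator (fun _ ↦ c) x) :
    ∫⁻ x in s, f x ∂ν ≤ c * ν t :=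
  calc ∫⁻ x in s, f x ∂ν ≤ ∫⁻ x in s, t.indicator (fun _ ↦ c) x ∂ν := setLIntegral_mono' hs hf
    _ ≤ ∫⁻ x, t.indicator (fun _ ↦ c) x ∂ν := setLIntegral_le_lintegral _ _
    _ = c * ν t := lintegral_indicator_const ht c

variable [PseudoMetricSpace M]

theorem exists_pos_le_setLIntegral_ball (hν : ν ≠ 0) {f : M → ℝ≥0∞} (hf : Measurable f)
    (hf₀ : ∀ x, f x ≠ 0) (x₀ : M) :
    ∃ D : ℝ, 0 < D ∧ ∃ R, ∀ S, R ≤ S → ENNReal.ofReal D ≤ ∫⁻ x in Metric.ball x₀ S, f x ∂ν := by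
  obtain ⟨n, hn⟩ : ∃ n : ℕ, ν (Metric.ball x₀ n) ≠ 0 := by
    by_contra! hzero
    refine hν (Measure.measure_univ_eq_zero.1 ?_)
    rw [← Metric.iUnion_ball_nat x₀]
    exact measure_iUnion_null hzero
  have hpos : 0 < ∫⁻ x in Metric.ball x₀ n, f x ∂ν := by
    have hsupp : Function.support f = univ := eq_univ_of_forall hf₀
    rw [setLIntegral_pos_iff hf, hsupp, univ_inter]
    exact pos_iff_ne_zero.2 hn
  obtain ⟨D, -, hD, hDf⟩ := ENNReal.lt_iff_exists_real_btwn.1 hpos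
  exact ⟨D, ENNReal.ofReal_pos.1 hD, n, fun S hS ↦
    hDf.le.trans (lintegral_mono_set (Metric.ball_subset_ball hS))⟩

/-- The Hardy inequality `∫ V h ^ p ≤ K ∫ |∇h| ^ p` for radial weights `h` about `x₀`, with respect
to the measure `ν`. -/
def RadialHardy (p K : ℝ) (V : M → ℝ) (ν : Measure M) (x₀ : M) : Prop :=
  ∀ (h g : ℝ → ℝ) (R : ℝ), IsRadialWeight h g R → ν (Metric.closedBall x₀ R) ≠ ⊤ →
    ∫⁻ x, ENNReal.ofReal (V x * h (dist x x₀) ^ p) ∂ν ≤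
      ∫⁻ x, ENNReal.ofReal (K * g (dist x x₀) ^ p) ∂ν

variable {p K : ℝ} {V : M → ℝ} {x₀ : M} {Φ ρ : ℝ → ℝ} {R₀ S d : ℝ}

variable [OpensMeasurableSpace M]

theorem IsDecayExponent.measurable_hardyGap (hΦ : IsDecayExponent Φ ρ R₀) (hV : Measurable V) :
    Measurable (hardyGap p K V Φ ρ R₀ x₀) := by
  have hdist : Measurable fun x ↦ dist x x₀ := by fun_prop
  exact (hV.sub (((hΦ.measurable_decayRate.comp hdist).pow_const p).const_mul K)).mul
    ((hΦ.antitone_decay.measurable.comp hdist).pow_const p)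

theorem IsRadialWeight.lintegral_slope_ne_top {h g : ℝ → ℝ} {R : ℝ} (hhg : IsRadialWeight h g R)
    (hp : 0 < p) (hK : 0 ≤ K) (hfin : ν (Metric.closedBall x₀ R) ≠ ⊤) :
    ∫⁻ x, ENNReal.ofReal (K * g (dist x x₀) ^ p) ∂ν ≠ ⊤ := by
  obtain ⟨G, hG⟩ := hhg.bddAbove_slope
  rw [← setLIntegral_univ]
  refine ne_top_of_le_ne_top (ENNReal.mul_ne_top (ENNReal.ofReal_ne_top (r := K * G ^ p)) hfin)
    (setLIntegral_le_mul_measure .univ measurableSet_closedBall fun x _ ↦ ?_)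
  by_cases hx : x ∈ Metric.closedBall x₀ R
  · rw [indicator_of_mem hx]
    have := hhg.slope_nonneg (dist x x₀)
    have := hG (mem_range_self (dist x x₀))
    gcongr
  · rw [hhg.slope_eq_zero _ (not_le.1 hx), Real.zero_rpow hp.ne', mul_zero, ENNReal.ofReal_zero]
    exact zero_le

/- On the ball of radius `S` the two sides of the Hardy inequality for `decay * cutoff` differ by
`hardyGap`, and what remains of the right-hand side lives in the annulus of width `d`. -/
theorem RadialHardy.setLIntegral_hardyGap_le (hH : RadialHardy p K V ν x₀)
    (hΦ : IsDecayExponent Φ ρ R₀) (hp : 0 < p) (hK : 0 ≤ K)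
    (hgap : ∀ x, 0 ≤ hardyGap p K V Φ ρ R₀ x₀ x) (hS : R₀ ≤ S) (hd : 0 < d)
    (hfin : ν (Metric.closedBall x₀ (S + d)) ≠ ⊤) :
    ∫⁻ x in Metric.ball x₀ S, ENNReal.ofReal (hardyGap p K V Φ ρ R₀ x₀ x) ∂ν ≤
      ENNReal.ofReal (K * cutoffSlope Φ ρ S d ^ p) * ν (Metric.closedBall x₀ (S + d)) := by
  have hw := hΦ.isRadialWeight_decay_mul_cutoff hS hd
  set g := profileSlope Φ ρ R₀ S d
  have hinner : ∫⁻ x in Metric.ball x₀ S, ENNReal.ofReal (K * g (dist x x₀) ^ p) ∂ν ≠ ⊤ :=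
    ne_top_of_le_ne_top (hw.lintegral_slope_ne_top hp hK hfin) (setLIntegral_le_lintegral _ _)
  have hmeas : Measurable fun x ↦ ENNReal.ofReal (K * g (dist x x₀) ^ p) :=
    (((hw.measurable_slope.comp (continuous_id.dist continuous_const).measurable).pow_const
      p).const_mul K).ennreal_ofReal
  refine (setLIntegral_le_setLIntegral_compl measurableSet_ball hmeas (hH _ _ _ hw hfin)
    (fun x hx ↦ hΦ.ofReal_eq_hardyGap_add hK hd hx (hgap x)) hinner).trans
    (setLIntegral_le_mul_measure measurableSet_ball.compl measurableSet_closedBall fun x hx ↦ ?_)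
  have hxS : ¬ dist x x₀ < S := hx
  by_cases hxd : dist x x₀ ≤ S + d
  · rw [indicator_of_mem (Metric.mem_closedBall.2 hxd)]
    have hgx : g (dist x x₀) = cutoffSlope Φ ρ S d := by
      simp only [g, profileSlope, if_neg hxS, if_pos hxd]
    rw [hgx]
  · rw [hw.slope_eq_zero _ (not_le.1 hxd), Real.zero_rpow hp.ne', mul_zero, ENNReal.ofReal_zero]
    exact zero_le

theorem RadialHardy.exists_le_mul_measure_closedBall (hH : RadialHardy p K V ν x₀)
    (hΦ : IsDecayExponent Φ ρ R₀) (hp : 0 < p) (hK : 0 < K) (hV : Measurable V)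
    (hVpos : ∀ x, 0 < V x) (hVρ : ∀ x, R₀ ≤ dist x x₀ → K * ρ (dist x x₀) ^ p < V x)
    (hν : ν ≠ 0) :
    ∃ D : ℝ, 0 < D ∧ ∃ R, ∀ S d, R ≤ S → 0 < d →
      ENNReal.ofReal D ≤
        ENNReal.ofReal (cutoffSlope Φ ρ S d ^ p) * ν (Metric.closedBall x₀ (S + d)) := by
  have hgap := hardyGap_pos (Φ := Φ) hp.ne' hVpos hVρ
  obtain ⟨D, hD, R, hR⟩ := exists_pos_le_setLIntegral_ball hν
    (hΦ.measurable_hardyGap (p := p) (K := K) (x₀ := x₀) hV).ennreal_ofReal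
    (fun x ↦ (ENNReal.ofReal_pos.2 (hgap x)).ne') x₀
  refine ⟨D / K, div_pos hD hK, max R₀ R, fun S d hS hd ↦ ?_⟩
  have hSR₀ : R₀ ≤ S := (le_max_left _ _).trans hS
  have hslope := Real.rpow_pos_of_pos (hΦ.cutoffSlope_pos hSR₀ hd) p
  by_cases hfin : ν (Metric.closedBall x₀ (S + d)) = ⊤
  · rw [hfin, ENNReal.mul_top (ENNReal.ofReal_pos.2 hslope).ne']
    exact le_top
  rw [ENNReal.ofReal_div_of_pos hK]
  refine ENNReal.div_le_of_le_mul' ?_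
  rw [← mul_assoc, ← ENNReal.ofReal_mul hK.le]
  exact (hR S ((le_max_right _ _).trans hS)).trans
    (hH.setLIntegral_hardyGap_le hΦ hp hK.le (fun x ↦ (hgap x).le) hSR₀ hd hfin)

theorem RadialHardy.exists_le_log_measure_closedBall (hH : RadialHardy p K V ν x₀)
    (hΦ : IsDecayExponent Φ ρ R₀) (hp : 0 < p) (hK : 0 < K) (hV : Measurable V)
    (hVpos : ∀ x, 0 < V x) (hVρ : ∀ x, R₀ ≤ dist x x₀ → K * ρ (dist x x₀) ^ p < V x)
    (hν : ν ≠ 0) :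
    ∃ E R : ℝ, ∀ S d, R ≤ S → 0 < d →
      ((E + p * (Φ S - Real.log (ρ S + 1 / d)) : ℝ) : EReal) ≤
        ENNReal.log (ν (Metric.closedBall x₀ (S + d))) := by
  obtain ⟨D, hD, R, hR⟩ := hH.exists_le_mul_measure_closedBall hΦ hp hK hV hVpos hVρ hν
  refine ⟨Real.log D, max R₀ R, fun S d hS hd ↦ ?_⟩
  have hSR₀ : R₀ ≤ S := (le_max_left _ _).trans hS
  have hslope := hΦ.cutoffSlope_pos hSR₀ hd
  have hsum : 0 < ρ S + 1 / d := pos_of_mul_pos_right hslope (Real.exp_pos _).le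
  have hlog := log_sub_log_le_log_of_ofReal_le hD (Real.rpow_pos_of_pos hslope p)
    (hR S d ((le_max_right _ _).trans hS) hd)
  rw [Real.log_rpow hslope, cutoffSlope, Real.log_mul (Real.exp_pos _).ne' hsum.ne',
    Real.log_exp] at hlog
  convert hlog using 2
  ring

end Growth

section Liminf

theorem coe_le_liminf_of_tendsto {f : ℝ → ℝ} {ℓ : ℝ} {F : ℝ → EReal}
    (hf : Tendsto f atTop (𝓝 ℓ)) (h : ∀ᶠ R in atTop, (f R : EReal) ≤ F R) :
    (ℓ : EReal) ≤ liminf F atTop := by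
  rw [← ((continuous_coe_real_ereal.tendsto ℓ).comp hf).liminf_eq]
  exact liminf_le_liminf h

theorem coe_le_of_forall_lt {p C e : ℝ} (hC : 0 < C) {L : EReal}
    (h : ∀ c, 0 < c → c < C → ((p * c + e : ℝ) : EReal) ≤ L) : ((p * C + e : ℝ) : EReal) ≤ L := by
  have hlim : Tendsto (fun c : ℝ ↦ ((p * c + e : ℝ) : EReal)) (𝓝[<] C)
      (𝓝 ((p * C + e : ℝ) : EReal)) :=
    ((continuous_coe_real_ereal.comp (g := Real.toEReal) (f := fun c ↦ p * c + e)
      (by fun_prop)).tendsto C).mono_left nhdsWithin_le_nhds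
  refine le_of_tendsto hlim ?_
  filter_upwards [Ioo_mem_nhdsLT hC] with c hc using h c hc.1 hc.2

theorem isDecayExponent_const_mul {Φ : ℝ → ℝ} {c σ R₀ : ℝ} (hc : 0 ≤ c) (hσ : 0 ≤ σ)
    (hR₀ : 0 < R₀) (hΦ : ∀ t, 0 < t → HasDerivAt Φ (t ^ (-σ)) t) :
    IsDecayExponent (fun t ↦ c * Φ t) (fun t ↦ c * t ^ (-σ)) R₀ where
  hasDerivAt _ ht := (hΦ _ (hR₀.trans_le ht)).const_mul c
  rate_nonneg _ ht := mul_nonneg hc (Real.rpow_nonneg (hR₀.le.trans ht) _)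
  antitoneOn_rate _ hs _ _ hst := mul_le_mul_of_nonneg_left
    (Real.rpow_le_rpow_of_nonpos (hR₀.trans_le hs) hst (neg_nonpos.2 hσ)) hc

theorem hasDerivAt_rpow_div {κ t : ℝ} (hκ : κ ≠ 0) (ht : 0 < t) :
    HasDerivAt (fun t : ℝ ↦ t ^ κ / κ) (t ^ (-(1 - κ))) t := by
  have hderiv := (Real.hasDerivAt_rpow_const (p := κ) (Or.inl ht.ne')).div_const κ
  rwa [mul_div_cancel_left₀ _ hκ, ← neg_sub 1 κ] at hderiv

theorem tendsto_one_sub_div_rpow_add (a b e : ℝ) {κ : ℝ} (hκ : 0 < κ) :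
    Tendsto (fun R : ℝ ↦ a * (1 - b / R) ^ κ + e / R ^ κ) atTop (𝓝 a) := by
  have hlim : Tendsto (fun R : ℝ ↦ a * (1 - b / R) ^ κ + e / R ^ κ) atTop
      (𝓝 (a * (1 - 0) ^ κ + 0)) := by
    refine ((Tendsto.rpow_const (tendsto_const_nhds.sub ?_) (Or.inr hκ.le)).const_mul a).add
      (tendsto_const_nhds.div_atTop (tendsto_rpow_atTop hκ))
    exact tendsto_const_nhds.div_atTop tendsto_id
  rwa [sub_zero, Real.one_rpow, mul_one, add_zero] at hlim

variable {M : Type*} [MeasurableSpace M] [PseudoMetricSpace M] [OpensMeasurableSpace M]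
  {ν : Measure M} {p K C lam : ℝ} {V : M → ℝ} {x₀ : M}

variable (hH : RadialHardy p K V ν x₀) (hp : 0 < p) (hK : 0 < K) (hV : Measurable V)
  (hVpos : ∀ x, 0 < V x) (hν : ν ≠ 0)
include hH hp hK hV hVpos hν

theorem RadialHardy.exists_le_log_measure_ball {c σ : ℝ} (hc : 0 < c) (hσ : 0 ≤ σ)
    {Φ : ℝ → ℝ} (hΦ : ∀ t, 0 < t → HasDerivAt Φ (t ^ (-σ)) t)
    (hVc : ∀ᶠ x in Bornology.cobounded M, K * c ^ p < dist x x₀ ^ (σ * p) * V x) :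
    ∃ E R : ℝ, ∀ S d T, R ≤ S → 0 < d → S + d < T →
      ((E + p * (c * Φ S - Real.log (c * S ^ (-σ) + 1 / d)) : ℝ) : EReal) ≤
        ENNReal.log (ν (Metric.ball x₀ T)) := by
  rw [← Metric.comap_dist_right_atTop x₀, eventually_comap] at hVc
  obtain ⟨R₁, hR₁⟩ := eventually_atTop.1 hVc
  have hR₀ : 0 < max R₁ 1 := lt_max_of_lt_right one_pos
  have hVρ : ∀ x, max R₁ 1 ≤ dist x x₀ → K * (c * dist x x₀ ^ (-σ)) ^ p < V x := fun x hx ↦ by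
    have hr : 0 < dist x x₀ := hR₀.trans_le hx
    rw [Real.mul_rpow hc.le (by positivity), ← Real.rpow_mul hr.le, neg_mul, Real.rpow_neg hr.le,
      ← mul_assoc, ← div_eq_mul_inv, div_lt_iff₀' (by positivity)]
    exact hR₁ _ ((le_max_left _ _).trans hx) x rfl
  obtain ⟨E, R, hER⟩ := hH.exists_le_log_measure_closedBall
    (isDecayExponent_const_mul hc.le hσ hR₀ hΦ) hp hK hV hVpos hVρ hν
  exact ⟨E, R, fun S d T hS hd hT ↦ (hER S d hS hd).trans
    (ENNReal.log_le_log (measure_mono (Metric.closedBall_subset_ball hT)))⟩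

theorem RadialHardy.le_liminf_log_measure_ball_of_lt {μ : ℝ} (hC : 0 < C) (hKC : K * C ^ p = lam)
    (hμ : 0 ≤ μ) (hμp : μ < p)
    (hVlam : ∀ a < lam, ∀ᶠ x in Bornology.cobounded M, a < dist x x₀ ^ μ * V x) :
    ((p * C : ℝ) : EReal) ≤ liminf (fun R : ℝ ↦
      (((1 - μ / p) / R ^ (1 - μ / p) : ℝ) : EReal) * ENNReal.log (ν (Metric.ball x₀ R)))
      atTop := by
  set κ := 1 - μ / p with hκ
  have hκ₀ : 0 < κ := sub_pos.2 ((div_lt_one hp).2 hμp)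
  have hσ : 0 ≤ 1 - κ := by rw [hκ, sub_sub_cancel]; positivity
  have hσp : (1 - κ) * p = μ := by rw [hκ, sub_sub_cancel, div_mul_cancel₀ _ hp.ne']
  rw [← add_zero (p * C)]
  refine coe_le_of_forall_lt hC fun c hc hcC ↦ ?_
  have hVc := hVlam (K * c ^ p) (by rw [← hKC]; gcongr)
  rw [← hσp] at hVc
  obtain ⟨E, R₁, hER⟩ := hH.exists_le_log_measure_ball hp hK hV hVpos hν hc hσ
    (fun t ht ↦ hasDerivAt_rpow_div hκ₀.ne' ht) hVc
  rw [add_zero]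
  refine coe_le_liminf_of_tendsto
    (tendsto_one_sub_div_rpow_add (p * c) 2 (κ * (E - p * Real.log (c + 1))) hκ₀) ?_
  filter_upwards [eventually_ge_atTop (R₁ + 2), eventually_ge_atTop 3] with R hR₁ hR₃
  have hR : 0 < R := by linarith
  have hS : 0 < R - 2 := by linarith
  have hfrac : (1 - 2 / R) ^ κ = (R - 2) ^ κ / R ^ κ := by
    rw [← Real.div_rpow hS.le hR.le, sub_div, div_self hR.ne']
  have hrate : (R - 2) ^ (-(1 - κ)) ≤ 1 :=
    Real.rpow_le_one_of_one_le_of_nonpos (by linarith) (neg_nonpos.2 hσ)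
  refine le_trans ?_ (mul_le_mul_of_nonneg_left
    (hER (R - 2) 1 R (by linarith) one_pos (by linarith)) (EReal.coe_nonneg.2 (by positivity)))
  rw [← EReal.coe_mul, EReal.coe_le_coe_iff, hfrac]
  calc p * c * ((R - 2) ^ κ / R ^ κ) + κ * (E - p * Real.log (c + 1)) / R ^ κ
      = κ / R ^ κ * (E + p * (c * ((R - 2) ^ κ / κ) - Real.log (c * 1 + 1 / 1))) := by
        rw [mul_one, div_one]; field_simp; ring
    _ ≤ κ / R ^ κ * (E + p * (c * ((R - 2) ^ κ / κ) -
          Real.log (c * (R - 2) ^ (-(1 - κ)) + 1 / 1))) := by gcongr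

theorem RadialHardy.add_le_liminf_log_measure_ball (hC : 0 < C) (hKC : K * C ^ p = lam)
    (hVlam : ∀ a < lam, ∀ᶠ x in Bornology.cobounded M, a < dist x x₀ ^ p * V x) :
    ((p * C + p : ℝ) : EReal) ≤ liminf (fun R : ℝ ↦
      ((1 / Real.log R : ℝ) : EReal) * ENNReal.log (ν (Metric.ball x₀ R))) atTop := by
  refine coe_le_of_forall_lt hC fun c hc hcC ↦ ?_
  have hVc := hVlam (K * c ^ p) (by rw [← hKC]; gcongr)
  obtain ⟨E, R₁, hER⟩ := hH.exists_le_log_measure_ball hp hK hV hVpos hν hc zero_le_one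
    (fun t ht ↦ by simpa only [Real.rpow_neg_one] using Real.hasDerivAt_log ht.ne')
    (by rwa [one_mul])
  set e := E - p * (c * Real.log 2 + Real.log (2 * c + 4)) with he
  have hlim : Tendsto (fun R : ℝ ↦ p * c + p + e / Real.log R) atTop (𝓝 (p * c + p + 0)) :=
    tendsto_const_nhds.add (tendsto_const_nhds.div_atTop Real.tendsto_log_atTop)
  rw [add_zero] at hlim
  refine coe_le_liminf_of_tendsto hlim ?_
  filter_upwards [eventually_ge_atTop (2 * R₁), eventually_gt_atTop 1] with R hR₁ hR₂
  have hR : 0 < R := by linarith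
  have hlog : 0 < Real.log R := Real.log_pos hR₂
  have hrate : c * (R / 2) ^ (-1 : ℝ) + 1 / (R / 4) = (2 * c + 4) / R := by
    rw [Real.rpow_neg_one]; field_simp
  refine le_trans ?_ (mul_le_mul_of_nonneg_left
    (hER (R / 2) (R / 4) R (by linarith) (by positivity) (by linarith))
    (EReal.coe_nonneg.2 (by positivity)))
  rw [← EReal.coe_mul, EReal.coe_le_coe_iff, hrate, Real.log_div (by positivity) hR.ne',
    Real.log_div hR.ne' two_ne_zero]
  refine le_of_eq ?_
  rw [he]
  field_simp
  ring

end Liminf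

section PotentialBound

variable {M : Type*} [MetricSpace M]

theorem tendsto_dist_div_dist_cobounded (x₀ o : M) :
    Tendsto (fun x ↦ dist x x₀ / dist x o) (Bornology.cobounded M) (𝓝 1) := by
  have hdist : Tendsto (fun x ↦ dist x o) (Bornology.cobounded M) atTop :=
    Metric.tendsto_dist_right_cobounded_atTop o
  rw [tendsto_iff_dist_tendsto_zero]
  refine squeeze_zero' (Eventually.of_forall fun _ ↦ dist_nonneg) ?_
    (tendsto_const_nhds (x := dist x₀ o).div_atTop hdist)
  filter_upwards [hdist.eventually_gt_atTop 0] with x hx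
  rw [Real.dist_eq, div_sub_one hx.ne', abs_div, abs_of_pos hx]
  gcongr
  rw [dist_comm x x₀, dist_comm x o]
  exact abs_dist_sub_le x₀ o x

theorem PotentialBound.eventually_lt [ProperSpace M] {V : M → ℝ} {lam μ a : ℝ}
    (hV : PotentialBound V lam μ) (hμ : 0 ≤ μ) (ha : a < lam) (x₀ : M) :
    ∀ᶠ x in Bornology.cobounded M, a < dist x x₀ ^ μ * V x := by
  rcases hμ.eq_or_lt with rfl | hμ
  · exact Eventually.of_forall fun x ↦ by
      rw [Real.rpow_zero, one_mul]
      exact ha.trans_le (hV.1 rfl x)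
  obtain ⟨o, ho⟩ := hV.2 hμ
  rw [← Metric.cobounded_eq_cocompact] at ho
  obtain ⟨b, hab, hb⟩ := exists_between ha
  have hbV := eventually_lt_of_lt_liminf ((EReal.coe_lt_coe_iff.2 hb).trans_le ho)
  have hratio : Tendsto (fun x ↦ (dist x x₀ / dist x o) ^ μ * b) (Bornology.cobounded M)
      (𝓝 (1 ^ μ * b)) :=
    ((tendsto_dist_div_dist_cobounded x₀ o).rpow_const (Or.inl one_ne_zero)).mul_const b
  rw [Real.one_rpow, one_mul] at hratio
  filter_upwards [hbV, hratio.eventually_const_lt hab,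
    (Metric.tendsto_dist_right_cobounded_atTop o).eventually_gt_atTop 0] with x hbx hax hx
  calc a < (dist x x₀ / dist x o) ^ μ * b := hax
    _ ≤ (dist x x₀ / dist x o) ^ μ * (dist x o ^ μ * V x) := by
      gcongr
      exact (EReal.coe_lt_coe_iff.1 hbx).le
    _ = dist x x₀ ^ μ * V x := by
      rw [Real.div_rpow dist_nonneg hx.le, ← mul_assoc,
        div_mul_cancel₀ _ (Real.rpow_pos_of_pos hx μ).ne']

end PotentialBound

section Constants

variable {p q lam k C : ℝ}

theorem one_div_conjExponent (p : ℝ) : 1 / p.conjExponent = (p - 1) / p := by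
  rw [Real.conjExponent, one_div_div]

theorem one_div_conjExponent_pos (hp : 1 < p) : 0 < 1 / p.conjExponent := by
  rw [one_div_conjExponent]
  exact div_pos (sub_pos.2 hp) (one_pos.trans hp)

theorem growthConst_pos (hp : 1 < p) (hk : 0 < k) (hlam : 0 < lam) (hq : p - 1 < q) :
    0 < growthConst p q lam k := by
  have : 0 < p - 1 := sub_pos.2 hp
  have hβ : 0 < q - p + 1 := by linarith
  unfold growthConst
  positivity

theorem hardyConst_pos (hp : 1 < p) (hk : 0 < k) (hq : p - 1 < q) :
    0 < (p - 1) ^ (p - 1) * k ^ p * (q - p + 1) ^ (1 - p) := by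
  have : 0 < p - 1 := sub_pos.2 hp
  have hβ : 0 < q - p + 1 := by linarith
  positivity

theorem mul_growthConst_div_rpow (hp : 1 < p) (hk : 0 < k) (hlam : 0 < lam) (hq : p - 1 < q) :
    (p - 1) ^ (p - 1) * k ^ p * (q - p + 1) ^ (1 - p) * (growthConst p q lam k / p) ^ p =
      lam := by
  have hp₀ : 0 < p := one_pos.trans hp
  have hp₁ : 0 < p - 1 := sub_pos.2 hp
  have hβ : 0 < q - p + 1 := by linarith
  have hconst : growthConst p q lam k / p =
      (q - p + 1) ^ ((p - 1) / p) * lam ^ (1 / p) / ((p - 1) ^ ((p - 1) / p) * k) := by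
    rw [growthConst, one_div_conjExponent]
    field_simp
  have hpow : ∀ {x : ℝ} (s : ℝ), 0 < x → (x ^ (s / p)) ^ p = x ^ s := fun s hx ↦ by
    rw [← Real.rpow_mul hx.le, div_mul_cancel₀ _ hp₀.ne']
  rw [hconst, Real.div_rpow (by positivity) (by positivity), Real.mul_rpow (by positivity)
    (by positivity), Real.mul_rpow (by positivity) hk.le, hpow _ hβ, hpow _ hlam, hpow _ hp₁,
    Real.rpow_one, ← neg_sub p 1, Real.rpow_neg hβ.le]
  field_simp

theorem strictMonoOn_rpow_mul_rpow (hp : 1 < p) :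
    StrictMonoOn (fun x : ℝ ↦ x ^ (1 / p) * (x - p) ^ (1 / p.conjExponent)) (Ici p) := by
  intro x (hx : p ≤ x) y _ hxy
  have hp₀ : 0 < p := one_pos.trans hp
  exact mul_lt_mul'' (Real.rpow_lt_rpow (hp₀.le.trans hx) hxy (by positivity))
    (Real.rpow_lt_rpow (by linarith) (by linarith) (one_div_conjExponent_pos hp))
    (Real.rpow_nonneg (hp₀.le.trans hx) _) (Real.rpow_nonneg (by linarith) _)

theorem le_rpow_mul_rpow (hp : 1 < p) (hC : 0 < C) :
    C ≤ (C + p) ^ (1 / p) * (C + p - p) ^ (1 / p.conjExponent) := by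
  have hp₀ : 0 < p := one_pos.trans hp
  rw [add_sub_cancel_right, one_div_conjExponent]
  calc C = C ^ (1 / p) * C ^ ((p - 1) / p) := by
        rw [← Real.rpow_add hC, ← add_div, add_sub_cancel, div_self hp₀.ne', Real.rpow_one]
    _ ≤ (C + p) ^ (1 / p) * C ^ ((p - 1) / p) := by gcongr; linarith

theorem existsUnique_rpow_mul_rpow_eq (hp : 1 < p) (hC : 0 < C) :
    ∃! x : ℝ, p < x ∧ x ^ (1 / p) * (x - p) ^ (1 / p.conjExponent) = C := by
  have hp' := one_div_conjExponent_pos hp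
  set f : ℝ → ℝ := fun x ↦ x ^ (1 / p) * (x - p) ^ (1 / p.conjExponent) with hf
  have hcont : Continuous f :=
    (Real.continuous_rpow_const (by positivity)).mul
      ((Real.continuous_rpow_const hp'.le).comp (continuous_sub_right p))
  have hzero : f p = 0 := by simp only [hf, sub_self, Real.zero_rpow hp'.ne', mul_zero]
  obtain ⟨x, hx, hxC⟩ := intermediate_value_Icc (by linarith) hcont.continuousOn
    ⟨hzero.le.trans hC.le, le_rpow_mul_rpow hp hC⟩
  refine ⟨x, ⟨hx.1.lt_of_ne ?_, hxC⟩, fun y hy ↦ ?_⟩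
  · rintro rfl
    exact hC.ne (hzero.symm.trans hxC)
  · exact (strictMonoOn_rpow_mul_rpow hp).injOn hy.1.le hx.1 (hy.2.trans hxC.symm)

theorem le_add_of_rpow_mul_rpow_eq {x : ℝ} (hp : 1 < p) (hC : 0 < C) (hx : p < x)
    (hxC : x ^ (1 / p) * (x - p) ^ (1 / p.conjExponent) = C) : x ≤ C + p := by
  refine ((strictMonoOn_rpow_mul_rpow hp).le_iff_le hx.le ?_).1
    (hxC.le.trans (le_rpow_mul_rpow hp hC))
  exact mem_Ici.2 (by linarith)

end Constants

section Truncation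

/-- A continuous cutoff, equal to `0` on `t ≤ 1 / N` and to `1` on `t ≥ 2 / N`. -/
def lowCutoff (N t : ℝ) : ℝ := max 0 (min 1 (N * t - 1))

/-- The derivative of `truncPow`. -/
def truncPowDeriv (β N t : ℝ) : ℝ :=
  β * lowCutoff N t * min ((max t N⁻¹) ^ (β - 1)) N

/-- A `C¹` approximation of `t ↦ (max t 0) ^ β` with bounded derivative. -/
def truncPow (β N t : ℝ) : ℝ := ∫ s in (0 : ℝ)..t, truncPowDeriv β N s

variable {β N : ℝ}

theorem lowCutoff_nonneg (N t : ℝ) : 0 ≤ lowCutoff N t := le_max_left _ _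

theorem lowCutoff_le_one (N t : ℝ) : lowCutoff N t ≤ 1 :=
  max_le zero_le_one (min_le_left _ _)

theorem lowCutoff_eq_zero (hN : 0 < N) {t : ℝ} (ht : t ≤ N⁻¹) : lowCutoff N t = 0 := by
  refine max_eq_left ((min_le_right _ _).trans ?_)
  have := mul_le_mul_of_nonneg_left ht hN.le
  rw [mul_inv_cancel₀ hN.ne'] at this
  linarith

theorem lowCutoff_mono (hN : 0 < N) : Monotone (lowCutoff N) := fun s t hst ↦ by
  unfold lowCutoff; gcongr

theorem continuous_truncPowDeriv (hN : 0 < N) : Continuous (truncPowDeriv β N) := by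
  unfold truncPowDeriv lowCutoff
  have hpow : Continuous fun t : ℝ ↦ (max t N⁻¹) ^ (β - 1) :=
    (continuous_id.max continuous_const).rpow_const
      fun t ↦ Or.inl (lt_of_lt_of_le (inv_pos.2 hN) (le_max_right _ _)).ne'
  fun_prop

theorem truncPowDeriv_nonneg (hβ : 0 < β) (hN : 0 < N) (t : ℝ) : 0 ≤ truncPowDeriv β N t := by
  have : 0 < max t N⁻¹ := lt_of_lt_of_le (inv_pos.2 hN) (le_max_right _ _)
  exact mul_nonneg (mul_nonneg hβ.le (lowCutoff_nonneg _ _)) (le_min (by positivity) hN.le)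

theorem truncPowDeriv_le (hβ : 0 < β) (hN : 0 < N) (t : ℝ) : truncPowDeriv β N t ≤ β * N := by
  have := lowCutoff_nonneg N t
  have := lowCutoff_le_one N t
  calc truncPowDeriv β N t ≤ β * lowCutoff N t * N := by
        unfold truncPowDeriv; gcongr; exact min_le_right _ _
    _ ≤ β * 1 * N := by gcongr
    _ = β * N := by ring

theorem truncPowDeriv_eq_zero (hN : 0 < N) {t : ℝ} (ht : t ≤ 0) : truncPowDeriv β N t = 0 := by
  rw [truncPowDeriv, lowCutoff_eq_zero hN (ht.trans (inv_pos.2 hN).le)]; ring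

theorem hasDerivAt_truncPow (hN : 0 < N) (t : ℝ) :
    HasDerivAt (truncPow β N) (truncPowDeriv β N t) t :=
  ((continuous_truncPowDeriv hN).integral_hasStrictDerivAt 0 t).hasDerivAt

theorem truncPow_eq_zero (hN : 0 < N) {t : ℝ} (ht : t ≤ 0) : truncPow β N t = 0 := by
  unfold truncPow
  rw [intervalIntegral.integral_congr (g := fun _ ↦ 0), intervalIntegral.integral_zero]
  intro s hs
  rw [uIcc_of_ge ht] at hs
  exact truncPowDeriv_eq_zero hN hs.2

theorem truncPow_nonneg (hβ : 0 < β) (hN : 0 < N) (t : ℝ) : 0 ≤ truncPow β N t := by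
  rcases le_total t 0 with ht | ht
  · rw [truncPow_eq_zero hN ht]
  · exact intervalIntegral.integral_nonneg ht fun s _ ↦ truncPowDeriv_nonneg hβ hN s

theorem truncPowDeriv_le_of_le (hβ : 0 < β) (hN : 0 < N) {s t : ℝ} (hs : 0 < s) (hst : s ≤ t) :
    truncPowDeriv β N s ≤ lowCutoff N t * (β * s ^ (β - 1)) := by
  have := lowCutoff_nonneg N t
  have := lowCutoff_nonneg N s
  rcases le_total s N⁻¹ with hsN | hsN
  · rw [truncPowDeriv, lowCutoff_eq_zero hN hsN]
    have : 0 ≤ s ^ (β - 1) := by positivity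
    simp only [mul_zero, zero_mul]; positivity
  · unfold truncPowDeriv
    rw [max_eq_left hsN]
    calc β * lowCutoff N s * min (s ^ (β - 1)) N ≤ β * lowCutoff N t * s ^ (β - 1) := by
          gcongr
          · exact lowCutoff_mono hN hst
          · exact min_le_left _ _
      _ = _ := by ring

theorem integral_mul_rpow_sub_one (hβ : 0 < β) (t : ℝ) :
    ∫ s in (0 : ℝ)..t, β * s ^ (β - 1) = t ^ β := by
  rw [intervalIntegral.integral_const_mul, integral_rpow (Or.inl (by linarith))]
  rw [sub_add_cancel, Real.zero_rpow hβ.ne']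
  field_simp
  ring

theorem truncPow_le_rpow (hβ : 0 < β) (hN : 0 < N) {t : ℝ} (ht : 0 ≤ t) :
    truncPow β N t ≤ lowCutoff N t * t ^ β := by
  rw [← integral_mul_rpow_sub_one hβ, ← intervalIntegral.integral_const_mul]
  refine intervalIntegral.integral_mono_on_of_le_Ioo ht
    ((continuous_truncPowDeriv hN).intervalIntegrable _ _)
    (((intervalIntegral.intervalIntegrable_rpow' (by linarith)).const_mul _).const_mul _) ?_
  exact fun s hs ↦ truncPowDeriv_le_of_le hβ hN hs.1 hs.2.le

theorem truncPow_le_mul (hβ : 0 < β) (hN : 0 < N) {t : ℝ} (ht : 0 ≤ t) :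
    truncPow β N t ≤ lowCutoff N t * (β * N) * t := by
  have : ∫ _ in (0 : ℝ)..t, lowCutoff N t * (β * N) = lowCutoff N t * (β * N) * t := by
    rw [intervalIntegral.integral_const, smul_eq_mul]; ring
  rw [← this]
  refine intervalIntegral.integral_mono_on ht
    ((continuous_truncPowDeriv hN).intervalIntegrable _ _) (by simp) fun s hs ↦ ?_
  have := lowCutoff_nonneg N t
  have := lowCutoff_nonneg N s
  calc truncPowDeriv β N s ≤ β * lowCutoff N t * N := by
        unfold truncPowDeriv
        gcongr
        · exact lowCutoff_mono hN hs.2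
        · exact min_le_right _ _
    _ = _ := by ring

/-- The function controlling `truncPow ^ p / truncPowDeriv ^ (p - 1)`. It is `β ^ (1 - p)` times
`t ^ (β + p - 1)`, as for the untruncated power, wherever the slope `β t ^ (β - 1)` is not
truncated, and an `N`-independent multiple of it elsewhere. -/
def truncBound (p β N t : ℝ) : ℝ :=
  if t ^ (β - 1) ≤ N then β ^ (1 - p) * t ^ (β + p - 1) else β * t ^ (β + p - 1)

theorem truncBound_nonneg {p : ℝ} (hβ : 0 < β) {t : ℝ} (ht : 0 ≤ t) :
    0 ≤ truncBound p β N t := by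
  unfold truncBound; split_ifs <;> positivity

theorem truncPow_rpow_le_of_rpow_le {p : ℝ} (hp : 1 < p) (hβ : 0 < β) (hN : 0 < N) {t : ℝ}
    (ht : N⁻¹ ≤ t) (htN : t ^ (β - 1) ≤ N) :
    truncPow β N t ^ p ≤ β ^ (1 - p) * t ^ (β + p - 1) * truncPowDeriv β N t ^ (p - 1) := by
  have ht0 : 0 < t := (inv_pos.2 hN).trans_le ht
  have hχ0 := lowCutoff_nonneg N t
  have hψ0 := truncPow_nonneg hβ hN t
  rw [truncPowDeriv, max_eq_left ht, min_eq_left htN]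
  calc truncPow β N t ^ p ≤ (lowCutoff N t * t ^ β) ^ p := by
        gcongr; exact truncPow_le_rpow hβ hN ht0.le
    _ = lowCutoff N t ^ p * t ^ (β * p) := by
        rw [Real.mul_rpow hχ0 (by positivity), ← Real.rpow_mul ht0.le]
    _ ≤ lowCutoff N t ^ (p - 1) * t ^ (β * p) := by
        gcongr ?_ * _
        exact Real.rpow_le_rpow_of_exponent_ge' hχ0 (lowCutoff_le_one N t) (by linarith)
          (by linarith)
    _ = (β ^ (1 - p) * β ^ (p - 1)) * (lowCutoff N t ^ (p - 1) *
          (t ^ (β + p - 1) * t ^ ((β - 1) * (p - 1)))) := by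
        rw [← Real.rpow_add hβ, ← Real.rpow_add ht0,
          show (1 - p) + (p - 1) = 0 by ring, Real.rpow_zero, one_mul,
          show β + p - 1 + (β - 1) * (p - 1) = β * p by ring]
    _ = _ := by
        rw [Real.mul_rpow (by positivity) (by positivity), Real.mul_rpow hβ.le hχ0,
          ← Real.rpow_mul ht0.le]
        ring

theorem truncPow_rpow_le_of_le_rpow {p : ℝ} (hp : 1 < p) (hβ : 0 < β) (hN : 0 < N) {t : ℝ}
    (ht : N⁻¹ ≤ t) (htN : N ≤ t ^ (β - 1)) :
    truncPow β N t ^ p ≤ β * t ^ (β + p - 1) * truncPowDeriv β N t ^ (p - 1) := by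
  have ht0 : 0 < t := (inv_pos.2 hN).trans_le ht
  have hψ0 := truncPow_nonneg hβ hN t
  have hD0 := truncPowDeriv_nonneg hβ hN t
  have hD : truncPowDeriv β N t = lowCutoff N t * (β * N) := by
    rw [truncPowDeriv, max_eq_left ht, min_eq_right htN]; ring
  calc truncPow β N t ^ p ≤ (truncPowDeriv β N t * t) ^ p := by
        gcongr
        exact (truncPow_le_mul hβ hN ht0.le).trans_eq (by rw [hD])
    _ = truncPowDeriv β N t * t ^ p * truncPowDeriv β N t ^ (p - 1) := by
        rw [Real.mul_rpow hD0 ht0.le, mul_right_comm, ← Real.rpow_one_add' hD0 (by linarith),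
          add_sub_cancel]
    _ ≤ β * N * t ^ p * truncPowDeriv β N t ^ (p - 1) := by
        gcongr; exact truncPowDeriv_le hβ hN t
    _ ≤ β * t ^ (β - 1) * t ^ p * truncPowDeriv β N t ^ (p - 1) := by gcongr
    _ = β * t ^ (β + p - 1) * truncPowDeriv β N t ^ (p - 1) := by
        rw [mul_assoc β, ← Real.rpow_add ht0, show β - 1 + p = β + p - 1 by ring]

theorem truncPow_rpow_le {p : ℝ} (hp : 1 < p) (hβ : 0 < β) (hN : 0 < N) {t : ℝ} (ht : 0 ≤ t) :
    truncPow β N t ^ p ≤ truncBound p β N t * truncPowDeriv β N t ^ (p - 1) := by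
  rcases le_total t N⁻¹ with htN | htN
  · have hψ : truncPow β N t ≤ 0 := by
      simpa only [lowCutoff_eq_zero hN htN, zero_mul] using truncPow_le_rpow hβ hN ht
    rw [hψ.antisymm (truncPow_nonneg hβ hN t), Real.zero_rpow (by linarith)]
    exact mul_nonneg (truncBound_nonneg hβ ht)
      (Real.rpow_nonneg (truncPowDeriv_nonneg hβ hN t) _)
  · unfold truncBound
    split_ifs with hslope
    · exact truncPow_rpow_le_of_rpow_le hp hβ hN htN hslope
    · exact truncPow_rpow_le_of_le_rpow hp hβ hN htN (not_le.1 hslope).le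

theorem truncBound_le {p : ℝ} (hβ : 0 < β) {t : ℝ} (ht : 0 ≤ t) :
    truncBound p β N t ≤ (β ^ (1 - p) + β) * t ^ (β + p - 1) := by
  have : 0 ≤ β ^ (1 - p) * t ^ (β + p - 1) := by positivity
  have : 0 ≤ β * t ^ (β + p - 1) := by positivity
  unfold truncBound; split_ifs <;> linarith

theorem measurable_truncBound (p β N : ℝ) : Measurable (truncBound p β N) := by
  unfold truncBound
  exact Measurable.ite (measurableSet_le (by fun_prop) measurable_const) (by fun_prop)
    (by fun_prop)

theorem eventually_truncPowDeriv_eq (β : ℝ) {t : ℝ} (ht : 0 < t) :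
    ∀ᶠ n : ℕ in atTop, truncPowDeriv β (n + 1) t = β * t ^ (β - 1) := by
  have hlarge : ∀ᶠ n : ℕ in atTop, max (2 / t) (t ^ (β - 1)) ≤ (n : ℝ) :=
    tendsto_natCast_atTop_atTop.eventually (eventually_ge_atTop _)
  filter_upwards [hlarge] with n hn
  have hslope : t ^ (β - 1) ≤ (n : ℝ) + 1 := by linarith [le_max_right (2 / t) (t ^ (β - 1))]
  have hnt : 2 ≤ ((n : ℝ) + 1) * t := by
    rw [← div_le_iff₀ ht]; linarith [le_max_left (2 / t) (t ^ (β - 1))]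
  have hinv : ((n : ℝ) + 1)⁻¹ ≤ t := by
    rw [inv_le_iff_one_le_mul₀ (by positivity)]; linarith
  rw [truncPowDeriv, max_eq_left hinv, min_eq_left hslope, lowCutoff,
    min_eq_left (by linarith), max_eq_right zero_le_one, mul_one]

theorem tendsto_truncPow (hβ : 0 < β) {t : ℝ} (ht : 0 ≤ t) :
    Tendsto (fun n : ℕ ↦ truncPow β (n + 1) t) atTop (𝓝 (t ^ β)) := by
  rw [← integral_mul_rpow_sub_one hβ]
  refine intervalIntegral.tendsto_integral_filter_of_dominated_convergence
    (fun s ↦ β * s ^ (β - 1)) ?_ ?_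
    ((intervalIntegral.intervalIntegrable_rpow' (by linarith)).const_mul _) ?_
  · exact Eventually.of_forall fun n ↦
      (continuous_truncPowDeriv (by positivity)).aestronglyMeasurable
  · refine Eventually.of_forall fun n ↦ Eventually.of_forall fun s hs ↦ ?_
    rw [uIoc_of_le ht] at hs
    rw [Real.norm_of_nonneg (truncPowDeriv_nonneg hβ (by positivity) s)]
    have hslope : 0 ≤ β * s ^ (β - 1) := by have := hs.1; positivity
    exact (truncPowDeriv_le_of_le hβ (by positivity) hs.1 hs.2).trans
      (mul_le_of_le_one_left hslope (lowCutoff_le_one _ _))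
  · refine Eventually.of_forall fun s hs ↦ ?_
    rw [uIoc_of_le ht] at hs
    exact tendsto_const_nhds.congr' ((eventually_truncPowDeriv_eq β hs.1).mono fun _ ↦ Eq.symm)

theorem tendsto_truncBound (p β t : ℝ) :
    Tendsto (fun n : ℕ ↦ truncBound p β (n + 1) t) atTop
      (𝓝 (β ^ (1 - p) * t ^ (β + p - 1))) := by
  have hlarge : ∀ᶠ n : ℕ in atTop, t ^ (β - 1) ≤ (n : ℝ) :=
    tendsto_natCast_atTop_atTop.eventually (eventually_ge_atTop _)
  refine tendsto_const_nhds.congr' ?_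
  filter_upwards [hlarge] with n hn
  rw [truncBound, if_pos (by linarith)]

theorem truncPow_max_zero (hN : 0 < N) (t : ℝ) :
    truncPow β N (max t 0) = truncPow β N t := by
  rcases le_total t 0 with ht | ht
  · rw [max_eq_right ht, truncPow_eq_zero hN ht, truncPow_eq_zero hN le_rfl]
  · rw [max_eq_left ht]

theorem truncPowDeriv_max_zero (hN : 0 < N) (t : ℝ) :
    truncPowDeriv β N (max t 0) = truncPowDeriv β N t := by
  rcases le_total t 0 with ht | ht
  · rw [max_eq_right ht, truncPowDeriv_eq_zero hN ht, truncPowDeriv_eq_zero hN le_rfl]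
  · rw [max_eq_left ht]

end Truncation

section Young

variable {p : ℝ}

theorem mul_mul_rpow_le_add {z c : ℝ} (hp : 1 < p) (hz : 0 ≤ z) (hc : 0 ≤ c) :
    p * (c * z ^ ((p - 1) / p)) ≤ z + (p - 1) ^ (p - 1) * c ^ p := by
  have hp0 : 0 < p := by linarith
  have hp1 : 0 < p - 1 := by linarith
  have hgeom : (z / (p - 1)) ^ ((p - 1) / p) * ((p - 1) ^ (p - 1) * c ^ p) ^ (1 / p)
      = c * z ^ ((p - 1) / p) := by
    rw [Real.div_rpow hz hp1.le, Real.mul_rpow (by positivity) (by positivity),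
      ← Real.rpow_mul hp1.le, ← Real.rpow_mul hc, mul_one_div_cancel hp0.ne', Real.rpow_one,
      mul_one_div]
    have : (p - 1) ^ ((p - 1) / p) ≠ 0 := (Real.rpow_pos_of_pos hp1 _).ne'
    field_simp
  rw [← hgeom]
  calc _ ≤ p * ((p - 1) / p * (z / (p - 1)) + 1 / p * ((p - 1) ^ (p - 1) * c ^ p)) := by
        gcongr
        exact Real.geom_mean_le_arith_mean2_weighted (by positivity) (by positivity)
          (by positivity) (by positivity) (by field_simp; ring)
    _ = z + (p - 1) ^ (p - 1) * c ^ p := by field_simp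

/- Here `ψ'` is the derivative of `ψ`, `η` a cutoff with slope `g`, `E` the energy density
`⟪A, ∇u⟫`, so that `k * E ^ ((p - 1) / p)` bounds `|A|`. -/
theorem mul_mul_rpow_le_of_rpow_le {k E ψ ψ' η g H : ℝ} (hp : 1 < p) (hk : 0 ≤ k) (hE : 0 ≤ E)
    (hψ : 0 ≤ ψ) (hψ' : 0 ≤ ψ') (hη : 0 ≤ η) (hg : 0 ≤ g) (hH : 0 ≤ H)
    (hψH : ψ ^ p ≤ H * ψ' ^ (p - 1)) :
    ψ * (k * E ^ ((p - 1) / p)) * (p * η ^ (p - 1) * g) ≤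
      ψ' * η ^ p * E + (p - 1) ^ (p - 1) * k ^ p * (H * g ^ p) := by
  have hp0 : 0 < p := by linarith
  have hψ_le : ψ ≤ H ^ (1 / p) * ψ' ^ ((p - 1) / p) := by
    have := Real.rpow_le_rpow (by positivity) hψH (by positivity : 0 ≤ 1 / p)
    rwa [← Real.rpow_mul hψ, mul_one_div_cancel hp0.ne', Real.rpow_one,
      Real.mul_rpow hH (by positivity), ← Real.rpow_mul hψ', mul_one_div] at this
  have hz : (ψ' * η ^ p * E) ^ ((p - 1) / p) =
      ψ' ^ ((p - 1) / p) * η ^ (p - 1) * E ^ ((p - 1) / p) := by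
    rw [Real.mul_rpow (by positivity) hE, Real.mul_rpow hψ' (by positivity),
      ← Real.rpow_mul hη, mul_div_cancel₀ _ hp0.ne']
  have hc : (k * g * H ^ (1 / p)) ^ p = k ^ p * (H * g ^ p) := by
    rw [Real.mul_rpow (by positivity) (by positivity), Real.mul_rpow hk hg,
      ← Real.rpow_mul hH, one_div_mul_cancel hp0.ne', Real.rpow_one]
    ring
  calc _ ≤ (H ^ (1 / p) * ψ' ^ ((p - 1) / p)) * (k * E ^ ((p - 1) / p)) *
        (p * η ^ (p - 1) * g) := by gcongr
    _ = p * (k * g * H ^ (1 / p) * (ψ' * η ^ p * E) ^ ((p - 1) / p)) := by rw [hz]; ring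
    _ ≤ ψ' * η ^ p * E + (p - 1) ^ (p - 1) * (k * g * H ^ (1 / p)) ^ p :=
        mul_mul_rpow_le_add hp (by positivity) (by positivity)
    _ = _ := by rw [hc]; ring

end Young

theorem tendsto_integral_norm_sub_of_tendsto_integral_norm {α G : Type*} [MeasurableSpace α]
    [NormedAddCommGroup G] {μ : Measure α} {F : ℕ → α → G} {f : α → G}
    (hF : ∀ n, Integrable (F n) μ) (hf : Integrable f μ)
    (hlim : ∀ᵐ x ∂μ, Tendsto (fun n ↦ F n x) atTop (𝓝 (f x)))
    (hnorm : Tendsto (fun n ↦ ∫ x, ‖F n x‖ ∂μ) atTop (𝓝 (∫ x, ‖f x‖ ∂μ))) :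
    Tendsto (fun n ↦ ∫ x, ‖F n x - f x‖ ∂μ) atTop (𝓝 0) := by
  have hdefect : Tendsto (fun n ↦ ∫ x, (‖F n x‖ + ‖f x‖ - ‖F n x - f x‖) ∂μ) atTop
      (𝓝 (∫ x, (‖f x‖ + ‖f x‖ - ‖f x - f x‖) ∂μ)) := by
    refine tendsto_integral_of_dominated_convergence (fun x ↦ 2 * ‖f x‖)
      (fun n ↦ (((hF n).norm.add hf.norm).sub ((hF n).sub hf).norm).aestronglyMeasurable)
      (hf.norm.const_mul 2) (fun n ↦ Eventually.of_forall fun x ↦ ?_) ?_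
    · rw [Real.norm_of_nonneg (by linarith [norm_sub_le (F n x) (f x)])]
      linarith [norm_sub_norm_le (F n x) (f x)]
    · filter_upwards [hlim] with x hx
      exact (hx.norm.add_const _).sub (hx.sub_const _).norm
  have hsplit (n : ℕ) : ∫ x, ‖F n x - f x‖ ∂μ =
      ∫ x, ‖F n x‖ ∂μ + ∫ x, ‖f x‖ ∂μ - ∫ x, (‖F n x‖ + ‖f x‖ - ‖F n x - f x‖) ∂μ := by
    have hdiff : Integrable (fun x ↦ ‖F n x - f x‖) μ := ((hF n).sub hf).norm
    have hsum : Integrable (fun x ↦ ‖F n x‖ + ‖f x‖) μ := (hF n).norm.add hf.norm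
    rw [integral_sub hsum hdiff, integral_add (hF n).norm hf.norm]
    ring
  simp only [hsplit]
  convert (hnorm.add_const _).sub hdefect using 2
  simp [integral_add hf.norm hf.norm]

theorem tendsto_integral_mul_of_tendsto_integral_abs_sub {α : Type*} [MeasurableSpace α]
    {μ : Measure α} {F Φ : ℕ → α → ℝ} {f φ : α → ℝ} {C : ℝ} (hF : ∀ n, Integrable (F n) μ)
    (hf : Integrable f μ) (hFf : Tendsto (fun n ↦ ∫ x, |F n x - f x| ∂μ) atTop (𝓝 0))
    (hΦ : ∀ n, AEStronglyMeasurable (Φ n) μ) (hC : ∀ n x, |Φ n x| ≤ C)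
    (hΦφ : ∀ᵐ x ∂μ, Tendsto (fun n ↦ Φ n x) atTop (𝓝 (φ x))) :
    Tendsto (fun n ↦ ∫ x, Φ n x * F n x ∂μ) atTop (𝓝 (∫ x, φ x * f x ∂μ)) := by
  have hint (n : ℕ) {a : α → ℝ} (ha : Integrable a μ) : Integrable (fun x ↦ Φ n x * a x) μ :=
    ha.bdd_mul (hΦ n) (Eventually.of_forall (hC n))
  have hmain : Tendsto (fun n ↦ ∫ x, Φ n x * f x ∂μ) atTop (𝓝 (∫ x, φ x * f x ∂μ)) := by
    refine tendsto_integral_of_dominated_convergence (fun x ↦ C * ‖f x‖)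
      (fun n ↦ (hint n hf).aestronglyMeasurable) (hf.norm.const_mul C)
      (fun n ↦ Eventually.of_forall fun x ↦ ?_) ?_
    · rw [norm_mul]
      gcongr
      exact hC n x
    · filter_upwards [hΦφ] with x hx
      exact hx.mul_const _
  have herror : Tendsto (fun n ↦ ∫ x, Φ n x * (F n x - f x) ∂μ) atTop (𝓝 0) := by
    refine squeeze_zero_norm (fun n ↦ ?_) (by simpa using hFf.const_mul C)
    rw [← integral_const_mul]
    refine norm_integral_le_of_norm_le (((hF n).sub hf).abs.const_mul C)
      (Eventually.of_forall fun x ↦ ?_)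
    rw [norm_mul, Real.norm_eq_abs, Real.norm_eq_abs]
    gcongr
    exact hC n x
  refine (add_zero (∫ x, φ x * f x ∂μ) ▸ hmain.add herror).congr fun n ↦ ?_
  refine (integral_add (hint n hf) (hint n ((hF n).sub hf))).symm.trans ?_
  congr 1 with x
  simp only [Pi.sub_apply]
  ring

section Mollifier

variable {E : Type*} [NormedAddCommGroup E]

variable (E) in
/-- A sequence of smooth bump functions whose supports shrink to the origin, with inner and outer
radii in a fixed ratio. -/
def shrinkingBump (n : ℕ) : ContDiffBump (0 : E) :=
  ⟨1 / (n + 1), 2 / (n + 1), by positivity, by gcongr; norm_num⟩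

theorem tendsto_rOut_shrinkingBump :
    Tendsto (fun n ↦ (shrinkingBump E n).rOut) atTop (𝓝 0) := by
  simpa [shrinkingBump, div_eq_mul_inv] using
    (tendsto_one_div_add_atTop_nhds_zero_nat (𝕜 := ℝ)).const_mul 2

variable [InnerProductSpace ℝ E] [FiniteDimensional ℝ E] [MeasurableSpace E] [BorelSpace E]
  {f : E → ℝ}

/-- The mollifications of `f`, by convolution with the normalised bump functions. -/
def mollify (f : E → ℝ) (n : ℕ) : E → ℝ :=
  (shrinkingBump E n).normed volume ⋆[ContinuousLinearMap.lsmul ℝ ℝ, volume] f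

theorem mollify_apply (n : ℕ) (x : E) :
    mollify f n x = ∫ z, f z * (shrinkingBump E n).normed volume (x - z) := by
  rw [mollify, convolution_eq_swap]
  simp [mul_comm]

theorem mollify_add {g : E → ℝ} (hf : Integrable f) (hg : Integrable g) (n : ℕ) :
    mollify (f + g) n = mollify f n + mollify g n := by
  have hexists {a : E → ℝ} (ha : Integrable a) :
      ConvolutionExists ((shrinkingBump E n).normed volume) a (ContinuousLinearMap.lsmul ℝ ℝ) :=
    (ContDiffBump.hasCompactSupport_normed _).convolutionExists_left _
      (ContDiffBump.continuous_normed _) ha.locallyIntegrable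
  exact (hexists hf).distrib_add (hexists hg)

theorem mollify_nonneg (hf : 0 ≤ f) (n : ℕ) : 0 ≤ mollify f n := fun x ↦ by
  rw [mollify_apply]
  exact integral_nonneg fun z ↦ mul_nonneg (hf z) (ContDiffBump.nonneg_normed _ _)

theorem integrable_mollify (hf : Integrable f) (n : ℕ) : Integrable (mollify f n) :=
  (ContDiffBump.integrable_normed _).integrable_convolution _ hf

theorem integral_mollify (hf : Integrable f) (n : ℕ) : ∫ x, mollify f n x = ∫ x, f x := by
  simp [mollify, integral_convolution _ (ContDiffBump.integrable_normed _) hf,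
    ContDiffBump.integral_normed]

theorem contDiff_mollify (hf : Integrable f) (n : ℕ) : ContDiff ℝ 1 (mollify f n) :=
  HasCompactSupport.contDiff_convolution_left (n := 1) _ (ContDiffBump.hasCompactSupport_normed _)
    (ContDiffBump.contDiff_normed _) hf.locallyIntegrable

theorem hasCompactSupport_mollify (hf : HasCompactSupport f) (n : ℕ) :
    HasCompactSupport (mollify f n) :=
  HasCompactSupport.convolution _ (ContDiffBump.hasCompactSupport_normed _) hf

theorem fderiv_mollify (hf : Integrable f) (n : ℕ) (x v : E) :
    fderiv ℝ (mollify f n) x v =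
      ∫ z, f z * fderiv ℝ ((shrinkingBump E n).normed volume) (x - z) v := by
  have hcs := ContDiffBump.hasCompactSupport_normed (shrinkingBump E n) (μ := volume)
  have hcd : ContDiff ℝ 1 ((shrinkingBump E n).normed volume) :=
    ContDiffBump.contDiff_normed (shrinkingBump E n) (n := 1)
  rw [mollify, ← convolution_flip,
    (hcs.hasFDerivAt_convolution_right _ hf.locallyIntegrable hcd x).fderiv,
    convolution_precompR_apply _ hf.locallyIntegrable (hcs.fderiv ℝ)
      (hcd.continuous_fderiv one_ne_zero), convolution_def]
  simp [mul_comm]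

theorem ae_tendsto_mollify (hf : Integrable f) :
    ∀ᵐ x, Tendsto (fun n ↦ mollify f n x) atTop (𝓝 (f x)) := by
  refine ContDiffBump.ae_convolution_tendsto_right_of_locallyIntegrable (K := 2)
    tendsto_rOut_shrinkingBump (Eventually.of_forall fun n ↦ ?_) hf.locallyIntegrable
  simp [shrinkingBump, div_eq_mul_inv]

theorem tendsto_integral_abs_mollify_sub_of_nonneg (hf : Integrable f) (hf₀ : 0 ≤ f) :
    Tendsto (fun n ↦ ∫ x, |mollify f n x - f x|) atTop (𝓝 0) := by
  refine tendsto_integral_norm_sub_of_tendsto_integral_norm (integrable_mollify hf) hf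
    (ae_tendsto_mollify hf) (Tendsto.congr (fun n ↦ ?_) tendsto_const_nhds)
  simp only [Real.norm_of_nonneg (mollify_nonneg hf₀ n _), Real.norm_of_nonneg (hf₀ _),
    integral_mollify hf]

theorem tendsto_integral_abs_mollify_sub (hf : Integrable f) :
    Tendsto (fun n ↦ ∫ x, |mollify f n x - f x|) atTop (𝓝 0) := by
  set pos : E → ℝ := fun x ↦ max (f x) 0
  set neg : E → ℝ := fun x ↦ max (-f x) 0
  have hpos : Integrable pos := hf.pos_part
  have hneg : Integrable neg := hf.neg_part
  have hsub (x : E) : f x = pos x - neg x := (max_zero_sub_eq_self (f x)).symm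
  have hmollify (n : ℕ) (x : E) : mollify f n x = mollify pos n x - mollify neg n x := by
    have : pos = f + neg := funext fun x ↦ by simp [hsub x]
    rw [this, mollify_add hf hneg, Pi.add_apply, add_sub_cancel_right]
  have hlim := (tendsto_integral_abs_mollify_sub_of_nonneg hpos fun _ ↦ le_max_right _ _).add
    (tendsto_integral_abs_mollify_sub_of_nonneg hneg fun _ ↦ le_max_right _ _)
  rw [add_zero] at hlim
  refine squeeze_zero (fun n ↦ integral_nonneg fun x ↦ abs_nonneg _) (fun n ↦ ?_) hlim
  have hpos' := ((integrable_mollify hpos n).sub hpos).abs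
  have hneg' := ((integrable_mollify hneg n).sub hneg).abs
  refine (integral_mono ((integrable_mollify hf n).sub hf).abs (hpos'.add hneg')
    fun x ↦ ?_).trans_eq (integral_add hpos' hneg')
  rw [Pi.sub_apply, hmollify, hsub x, sub_sub_sub_comm]
  exact abs_sub _ _

end Mollifier

theorem lipschitzWith_of_hasDerivAt {F F' : ℝ → ℝ} {C : ℝ≥0} (hF : ∀ t, HasDerivAt F (F' t) t)
    (hC : ∀ t, |F' t| ≤ C) : LipschitzWith C F := by
  refine lipschitzWith_of_nnnorm_deriv_le (fun t ↦ (hF t).differentiableAt) fun t ↦ ?_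
  rw [(hF t).deriv, ← NNReal.coe_le_coe]
  exact hC t

theorem comp_indicator_mul_of_support_subset {α : Type*} (F : ℝ → ℝ) {K : Set α} (a : α → ℝ)
    {b : α → ℝ} (hb : Function.support b ⊆ K) (x : α) :
    F (K.indicator a x) * b x = F (a x) * b x := by
  by_cases hx : x ∈ K
  · rw [indicator_of_mem hx]
  · rw [Function.notMem_support.1 (mt (@hb x) hx), mul_zero, mul_zero]

theorem integrable_mul_of_support_subset {α : Type*} [MeasurableSpace α] {μ : Measure α}
    {K : Set α} {a b : α → ℝ} {B : ℝ} (ha : Integrable (K.indicator a) μ)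
    (hb : AEStronglyMeasurable b μ) (hB : ∀ x, |b x| ≤ B) (hbK : Function.support b ⊆ K) :
    Integrable (fun x ↦ a x * b x) μ :=
  (ha.mul_bdd hb (Eventually.of_forall hB)).congr
    (Eventually.of_forall (comp_indicator_mul_of_support_subset id a hbK))

theorem integrable_comp_mul {α : Type*} [MeasurableSpace α] {μ : Measure α} {F : ℝ → ℝ}
    {C : ℝ≥0} (hF : LipschitzWith C F) {a b : α → ℝ} {B : ℝ} (ha : Integrable a μ)
    (hb : Integrable b μ) (hB : ∀ x, |b x| ≤ B) : Integrable (fun x ↦ F (a x) * b x) μ := by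
  have hFa : AEStronglyMeasurable (fun x ↦ F (a x)) μ :=
    hF.continuous.comp_aestronglyMeasurable ha.aestronglyMeasurable
  have hFa₀ : Integrable (fun x ↦ F (a x) - F 0) μ := by
    refine (ha.norm.const_mul C).mono' (hFa.sub aestronglyMeasurable_const)
      (Eventually.of_forall fun x ↦ ?_)
    simpa [Real.dist_eq] using hF.dist_le_mul (a x) 0
  refine ((hFa₀.mul_bdd hb.aestronglyMeasurable (Eventually.of_forall hB)).add
    (hb.const_mul (F 0))).congr (Eventually.of_forall fun x ↦ ?_)
  simp only [Pi.add_apply]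
  ring

theorem tendsto_integral_comp_mul {α : Type*} [MeasurableSpace α] {μ : Measure α} {F : ℝ → ℝ}
    {C : ℝ≥0} (hF : LipschitzWith C F) {a : ℕ → α → ℝ} {a₀ b : α → ℝ} {B : ℝ}
    (ha : ∀ n, Integrable (a n) μ) (ha₀ : Integrable a₀ μ)
    (hlim : Tendsto (fun n ↦ ∫ x, |a n x - a₀ x| ∂μ) atTop (𝓝 0))
    (hb : Integrable b μ) (hB : ∀ x, |b x| ≤ B) :
    Tendsto (fun n ↦ ∫ x, F (a n x) * b x ∂μ) atTop (𝓝 (∫ x, F (a₀ x) * b x ∂μ)) := by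
  rw [tendsto_iff_norm_sub_tendsto_zero]
  refine squeeze_zero (fun n ↦ norm_nonneg _) (fun n ↦ ?_)
    (by simpa using hlim.const_mul (C * B))
  rw [← integral_sub (integrable_comp_mul hF (ha n) hb hB) (integrable_comp_mul hF ha₀ hb hB),
    ← integral_const_mul]
  refine norm_integral_le_of_norm_le (((ha n).sub ha₀).abs.const_mul _)
    (Eventually.of_forall fun x ↦ ?_)
  calc ‖F (a n x) * b x - F (a₀ x) * b x‖ = dist (F (a n x)) (F (a₀ x)) * |b x| := by
        rw [← sub_mul, norm_mul, Real.dist_eq, Real.norm_eq_abs, Real.norm_eq_abs]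
    _ ≤ C * dist (a n x) (a₀ x) * B := by
        gcongr
        · exact hF.dist_le_mul _ _
        · exact hB x
    _ = C * B * |a n x - a₀ x| := by rw [Real.dist_eq]; ring

section LineDeriv

variable {E : Type*} [NormedAddCommGroup E] [NormedSpace ℝ E] {θ : E → ℝ}

theorem support_lineDeriv_subset (v : E) :
    Function.support (fun y ↦ lineDeriv ℝ θ y v) ⊆ tsupport θ := fun y hy ↦ by
  by_contra hyθ
  refine hy ((notMem_tsupport_iff_eventuallyEq.1 hyθ).lineDeriv_eq.trans ?_)
  simp [lineDeriv]

variable [MeasurableSpace E] [BorelSpace E] {μ : Measure E}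

theorem integrable_lineDeriv [IsFiniteMeasureOnCompacts μ] {D : ℝ≥0} (hθ : LipschitzWith D θ)
    (hθc : HasCompactSupport θ) (v : E) : Integrable (fun y ↦ lineDeriv ℝ θ y v) μ := by
  rw [← integrableOn_iff_integrable_of_support_subset (support_lineDeriv_subset v)]
  exact Measure.integrableOn_of_bounded hθc.isCompact.measure_lt_top.ne
    (measurable_lineDeriv hθ.continuous).aestronglyMeasurable
    (Eventually.of_forall fun y ↦ norm_lineDeriv_le_of_lipschitz ℝ hθ)

theorem integral_comp_mul_lineDeriv [FiniteDimensional ℝ E] [μ.IsAddHaarMeasure] {F F' : ℝ → ℝ}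
    {C D L : ℝ≥0} (hF : ∀ t, HasDerivAt F (F' t) t) (hC : ∀ t, |F' t| ≤ C) {a : E → ℝ}
    (ha : ContDiff ℝ 1 a) (haL : LipschitzWith L a) (hθ : LipschitzWith D θ)
    (hθc : HasCompactSupport θ) (v : E) :
    ∫ y, F (a y) * lineDeriv ℝ θ y v ∂μ = -∫ y, F' (a y) * θ y * fderiv ℝ a y v ∂μ := by
  have hlineDeriv (y : E) : lineDeriv ℝ (F ∘ a) y v = F' (a y) * fderiv ℝ a y v := by
    have hd : HasFDerivAt (F ∘ a) (F' (a y) • fderiv ℝ a y) y :=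
      (hF (a y)).comp_hasFDerivAt y (ha.differentiable one_ne_zero y).hasFDerivAt
    rw [hd.differentiableAt.lineDeriv_eq_fderiv, hd.fderiv]
    rfl
  have hparts := ((lipschitzWith_of_hasDerivAt hF hC).comp haL).integral_lineDeriv_mul_eq
    (μ := μ) hθ hθc v
  simp only [hlineDeriv, lineDeriv_neg, Function.comp_apply, neg_mul, integral_neg] at hparts
  simp only [mul_right_comm _ (θ _), hparts, neg_neg, mul_comm (F _)]

end LineDeriv

section

variable {m : ℕ} {p : ℝ} {U K : Set (EuclideanSpace ℝ (Fin m))}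
  {f : EuclideanSpace ℝ (Fin m) → ℝ} {g : Fin m → EuclideanSpace ℝ (Fin m) → ℝ}

theorem integrable_indicator_of_memLp (hp : 1 ≤ p) (hK : IsCompact K)
    (hf : MemLp f (ENNReal.ofReal p) (volume.restrict K)) : Integrable (K.indicator f) := by
  have : Fact (volume K < ⊤) := ⟨hK.measure_lt_top⟩
  exact IntegrableOn.integrable_indicator (hf.integrable (ENNReal.one_le_ofReal.2 hp))
    hK.measurableSet

theorem IsEuclideanSobolevLoc.integrable_indicator (hf : IsEuclideanSobolevLoc p U f g)
    (hp : 1 ≤ p) (hK : IsCompact K) (hKU : K ⊆ U) : Integrable (K.indicator f) :=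
  integrable_indicator_of_memLp hp hK (hf.memLp K hKU hK)

theorem IsEuclideanSobolevLoc.integrable_indicator_deriv (hf : IsEuclideanSobolevLoc p U f g)
    (hp : 1 ≤ p) (hK : IsCompact K) (hKU : K ⊆ U) (i : Fin m) : Integrable (K.indicator (g i)) :=
  integrable_indicator_of_memLp hp hK (hf.memLp_deriv i K hKU hK)

theorem IsEuclideanSobolevLoc.aestronglyMeasurable (hf : IsEuclideanSobolevLoc p U f g)
    (hp : 1 ≤ p) (hU : IsOpen U) : AEStronglyMeasurable f (volume.restrict U) := by
  refine LocallyIntegrableOn.aestronglyMeasurable ?_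
  rw [locallyIntegrableOn_iff hU.isLocallyClosed]
  exact fun K hKU hK ↦ (integrable_indicator_iff hK.measurableSet).1
    (hf.integrable_indicator hp hK hKU)

theorem IsEuclideanSobolevLoc.fderiv_mollify_indicator (hf : IsEuclideanSobolevLoc p U f g)
    (hp : 1 ≤ p) (hK : IsCompact K) (hKU : K ⊆ U) (i : Fin m) (n : ℕ)
    {y : EuclideanSpace ℝ (Fin m)}
    (hy : Metric.closedBall y (shrinkingBump (EuclideanSpace ℝ (Fin m)) n).rOut ⊆ K) :
    fderiv ℝ (mollify (K.indicator f) n) y (EuclideanSpace.single i 1) =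
      mollify (K.indicator (g i)) n y := by
  set ρ := (shrinkingBump (EuclideanSpace ℝ (Fin m)) n).normed volume
  set φ : EuclideanSpace ℝ (Fin m) → ℝ := fun z ↦ ρ (y - z)
  have hρ : ContDiff ℝ ∞ ρ := ContDiffBump.contDiff_normed _ (n := ⊤)
  have hφ : ContDiff ℝ ∞ φ := hρ.comp (contDiff_const.sub contDiff_id)
  have hφK : tsupport φ ⊆ K := by
    refine Subset.trans ?_ hy
    rw [show φ = ρ ∘ Homeomorph.subLeft y from rfl, tsupport_comp_eq_preimage,
      ContDiffBump.tsupport_normed_eq]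
    intro z hz
    simpa [dist_eq_norm, norm_sub_rev] using hz
  have hφc : HasCompactSupport φ := hK.of_isClosed_subset (isClosed_tsupport φ) hφK
  have hfderiv (z v : EuclideanSpace ℝ (Fin m)) : fderiv ℝ ρ (y - z) v = -fderiv ℝ φ z v := by
    have := (hρ.differentiable (by simp) (y - z)).hasFDerivAt.comp z
      ((hasFDerivAt_id z).const_sub y)
    rw [show φ = ρ ∘ HSub.hSub y from rfl, this.fderiv]
    simp
  rw [fderiv_mollify (hf.integrable_indicator hp hK hKU), mollify_apply]
  change ∫ z, K.indicator f z * fderiv ℝ ρ (y - z) _ = ∫ z, K.indicator (g i) z * φ z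
  simp only [hfderiv, mul_neg, integral_neg]
  have hsupp : Function.support (fun z ↦ fderiv ℝ φ z (EuclideanSpace.single i 1)) ⊆ K :=
    fun z hz ↦ hφK (support_fderiv_subset ℝ fun h ↦ hz (by simp [h]))
  have hleft := comp_indicator_mul_of_support_subset id f hsupp
  have hright := comp_indicator_mul_of_support_subset id (g i) ((subset_tsupport φ).trans hφK)
  simp only [id_eq] at hleft hright
  simp only [hleft, hright, hf.weakDeriv i φ hφ hφc (hφK.trans hKU), neg_neg]

end

section EuclideanSobolev

variable {m : ℕ} {p : ℝ} {U : Set (EuclideanSpace ℝ (Fin m))}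
  {f : EuclideanSpace ℝ (Fin m) → ℝ} {g : Fin m → EuclideanSpace ℝ (Fin m) → ℝ}

theorem IsEuclideanSobolevLoc.integral_comp_mollify_mul_lineDeriv
    (hf : IsEuclideanSobolevLoc p U f g) (hp : 1 ≤ p) {F F' : ℝ → ℝ} {C D : ℝ≥0}
    (hF : ∀ t, HasDerivAt F (F' t) t) (hC : ∀ t, |F' t| ≤ C)
    {θ : EuclideanSpace ℝ (Fin m) → ℝ} (hθ : LipschitzWith D θ) (hθc : HasCompactSupport θ)
    {δ : ℝ} (hδU : Metric.cthickening δ (tsupport θ) ⊆ U) {n : ℕ}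
    (hn : (shrinkingBump (EuclideanSpace ℝ (Fin m)) n).rOut ≤ δ) (i : Fin m) :
    ∫ y, F (mollify ((Metric.cthickening δ (tsupport θ)).indicator f) n y) *
        lineDeriv ℝ θ y (EuclideanSpace.single i 1) =
      -∫ y, F' (mollify ((Metric.cthickening δ (tsupport θ)).indicator f) n y) * θ y *
        mollify ((Metric.cthickening δ (tsupport θ)).indicator (g i)) n y := by
  set K := Metric.cthickening δ (tsupport θ)
  have hK : IsCompact K := hθc.isCompact.cthickening
  have hfK := hf.integrable_indicator hp hK hδU
  have hfKc : HasCompactSupport (K.indicator f) :=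
    HasCompactSupport.intro hK fun z hz ↦ indicator_of_notMem hz f
  obtain ⟨L, hL⟩ := (contDiff_mollify hfK n).lipschitzWith_of_hasCompactSupport
    (hasCompactSupport_mollify hfKc n) one_ne_zero
  rw [RiemannianGrowth.integral_comp_mul_lineDeriv hF hC (contDiff_mollify hfK n) hL hθ hθc]
  congr 2 with y
  by_cases hy : y ∈ tsupport θ
  · rw [hf.fderiv_mollify_indicator hp hK hδU i n
      ((Metric.closedBall_subset_cthickening hy _).trans (Metric.cthickening_mono hn _))]
  · simp [image_eq_zero_of_notMem_tsupport hy]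

theorem IsEuclideanSobolevLoc.integral_comp_mul_lineDeriv (hf : IsEuclideanSobolevLoc p U f g)
    (hp : 1 ≤ p) (hU : IsOpen U) {F F' : ℝ → ℝ} {C D : ℝ≥0} (hF : ∀ t, HasDerivAt F (F' t) t)
    (hF' : Continuous F') (hC : ∀ t, |F' t| ≤ C) {θ : EuclideanSpace ℝ (Fin m) → ℝ}
    (hθ : LipschitzWith D θ) (hθc : HasCompactSupport θ) (hθU : tsupport θ ⊆ U) (i : Fin m) :
    ∫ y, F (f y) * lineDeriv ℝ θ y (EuclideanSpace.single i 1) =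
      -∫ y, F' (f y) * θ y * g i y := by
  obtain ⟨δ, hδ, hδU⟩ := hθc.isCompact.exists_cthickening_subset_open hU hθU
  set K := Metric.cthickening δ (tsupport θ)
  have hK : IsCompact K := hθc.isCompact.cthickening
  have hfK := hf.integrable_indicator hp hK hδU
  have hgK := hf.integrable_indicator_deriv hp hK hδU i
  obtain ⟨B, hB⟩ := hθc.exists_bound_of_continuous hθ.continuous
  have hparts := ((tendsto_order.1 tendsto_rOut_shrinkingBump).2 δ hδ).mono fun n hn ↦
    hf.integral_comp_mollify_mul_lineDeriv hp hF hC hθ hθc hδU hn.le i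
  have hleft := tendsto_integral_comp_mul (lipschitzWith_of_hasDerivAt hF hC)
    (integrable_mollify hfK) hfK (tendsto_integral_abs_mollify_sub hfK)
    (integrable_lineDeriv hθ hθc (EuclideanSpace.single i 1))
    fun y ↦ norm_lineDeriv_le_of_lipschitz ℝ hθ
  have hright := tendsto_integral_mul_of_tendsto_integral_abs_sub (C := C * B)
    (Φ := fun n y ↦ F' (mollify (K.indicator f) n y) * θ y)
    (φ := fun y ↦ F' (K.indicator f y) * θ y) (integrable_mollify hgK) hgK
    (tendsto_integral_abs_mollify_sub hgK)
    (fun n ↦ ((hF'.comp (contDiff_mollify hfK n).continuous).mul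
      hθ.continuous).aestronglyMeasurable)
    (fun n y ↦ (abs_mul _ _).trans_le
      (mul_le_mul (hC _) (hB y) (abs_nonneg _) C.2))
    ((ae_tendsto_mollify hfK).mono fun y hy ↦ ((hF'.tendsto _).comp hy).mul_const _)
  have hlimit := tendsto_nhds_unique_of_eventuallyEq hleft hright.neg hparts
  have hθK : tsupport θ ⊆ K := Metric.self_subset_cthickening _
  have hθsupp : Function.support θ ⊆ K := (subset_tsupport θ).trans hθK
  have hright_eq (y) : F' (K.indicator f y) * θ y * K.indicator (g i) y =
      F' (f y) * θ y * g i y := by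
    have hg := comp_indicator_mul_of_support_subset id (g i) hθsupp y
    simp only [id_eq] at hg
    rw [comp_indicator_mul_of_support_subset F' f hθsupp, mul_assoc, mul_comm (θ y), hg,
      mul_comm (g i y), mul_assoc]
  simpa only [hright_eq, comp_indicator_mul_of_support_subset F f
    ((support_lineDeriv_subset _).trans hθK)] using hlimit

theorem IsEuclideanSobolevLoc.mono {V : Set (EuclideanSpace ℝ (Fin m))}
    (hf : IsEuclideanSobolevLoc p U f g) (hVU : V ⊆ U) : IsEuclideanSobolevLoc p V f g where
  memLp K hK := hf.memLp K (hK.trans hVU)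
  memLp_deriv i K hK := hf.memLp_deriv i K (hK.trans hVU)
  weakDeriv i φ hφ hφc hφV := hf.weakDeriv i φ hφ hφc (hφV.trans hVU)

theorem IsEuclideanSobolevLoc.congr {f' : EuclideanSpace ℝ (Fin m) → ℝ}
    {g' : Fin m → EuclideanSpace ℝ (Fin m) → ℝ} (hf : IsEuclideanSobolevLoc p U f g)
    (hff' : EqOn f f' U) (hgg' : ∀ i, EqOn (g i) (g' i) U) :
    IsEuclideanSobolevLoc p U f' g' where
  memLp K hKU hK := (hf.memLp K hKU hK).ae_eq
    ((ae_restrict_mem hK.measurableSet).mono fun _ hy ↦ hff' (hKU hy))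
  memLp_deriv i K hKU hK := (hf.memLp_deriv i K hKU hK).ae_eq
    ((ae_restrict_mem hK.measurableSet).mono fun _ hy ↦ hgg' i (hKU hy))
  weakDeriv i φ hφ hφc hφU := by
    refine Eq.trans ?_ ((hf.weakDeriv i φ hφ hφc hφU).trans ?_)
    · congr 1 with y
      by_cases hy : y ∈ tsupport φ
      · rw [hff' (hφU hy)]
      · simp [fderiv_of_notMem_tsupport ℝ hy]
    · congr 2 with y
      by_cases hy : y ∈ tsupport φ
      · rw [hgg' i (hφU hy)]
      · simp [image_eq_zero_of_notMem_tsupport hy]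

theorem isEuclideanSobolevLoc_of_forall_isCompact
    (h : ∀ K ⊆ U, IsCompact K → ∃ V, K ⊆ V ∧ IsEuclideanSobolevLoc p V f g) :
    IsEuclideanSobolevLoc p U f g where
  memLp K hKU hK := by
    obtain ⟨V, hKV, hV⟩ := h K hKU hK
    exact hV.memLp K hKV hK
  memLp_deriv i K hKU hK := by
    obtain ⟨V, hKV, hV⟩ := h K hKU hK
    exact hV.memLp_deriv i K hKV hK
  weakDeriv i φ hφ hφc hφU := by
    obtain ⟨V, hφV, hV⟩ := h _ hφU hφc.isCompact
    exact hV.weakDeriv i φ hφ hφc hφV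

theorem IsEuclideanSobolevLoc.comp (hf : IsEuclideanSobolevLoc p U f g) (hp : 1 ≤ p)
    (hU : IsOpen U) {F F' : ℝ → ℝ} {C : ℝ≥0} (hF : ∀ t, HasDerivAt F (F' t) t)
    (hF' : Continuous F') (hC : ∀ t, |F' t| ≤ C) :
    IsEuclideanSobolevLoc p U (fun y ↦ F (f y)) (fun i y ↦ F' (f y) * g i y) where
  memLp K hKU hK := by
    have : Fact (volume K < ⊤) := ⟨hK.measure_lt_top⟩
    have hFL := lipschitzWith_of_hasDerivAt hF hC
    have hF₀ : LipschitzWith C fun t ↦ F t - F 0 := by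
      simpa using hFL.sub (LipschitzWith.const (F 0))
    refine ((hF₀.comp_memLp (by simp) (hf.memLp K hKU hK)).add (memLp_const (F 0))).ae_eq
      (Eventually.of_forall fun y ↦ ?_)
    simp
  memLp_deriv i K hKU hK := (hf.memLp_deriv i K hKU hK).mul' (memLp_top_of_bound
    (hF'.comp_aestronglyMeasurable (hf.memLp K hKU hK).1) C (Eventually.of_forall fun _ ↦ hC _))
  weakDeriv i φ hφ hφc hφU := by
    obtain ⟨D, hD⟩ := hφ.lipschitzWith_of_hasCompactSupport hφc (by simp)
    have := hf.integral_comp_mul_lineDeriv hp hU hF hF' hC hD hφc hφU i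
    simpa only [(hφ.differentiable (by simp) _).lineDeriv_eq_fderiv, mul_right_comm] using this

end EuclideanSobolev

theorem lipschitzWith_mul_of_hasCompactSupport {E : Type*} [NormedAddCommGroup E]
    [NormedSpace ℝ E] {ζ φ : E → ℝ} {D L : ℝ≥0} (hζ : LipschitzWith D ζ) (hφ : LipschitzWith L φ)
    (hφc : HasCompactSupport φ) : ∃ C : ℝ≥0, LipschitzWith C fun y ↦ ζ y * φ y := by
  obtain ⟨a, ha⟩ := hφc.isCompact.exists_bound_of_continuousOn hζ.continuous.continuousOn
  obtain ⟨b, hb⟩ := hφc.exists_bound_of_continuous hφ.continuous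
  refine ⟨(a * L + b * D).toNNReal, lipschitzWith_of_forall_hasSlopeLE fun y ↦ ?_⟩
  by_cases hy : y ∈ tsupport φ
  · refine ((hasSlopeLE_of_lipschitzWith hζ y).mul (hasSlopeLE_of_lipschitzWith hφ y)).mono ?_
    refine le_trans ?_ (Real.le_coe_toNNReal _)
    gcongr
    exacts [ha y hy, hb y]
  · refine (hasSlopeLE_zero_of_eventuallyEq_const (c := 0) ?_).mono (NNReal.coe_nonneg _)
    filter_upwards [notMem_tsupport_iff_eventuallyEq.1 hy] with z hz
    simp [hz]

section Multiplication

variable {m : ℕ} {p : ℝ} {U : Set (EuclideanSpace ℝ (Fin m))}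
  {f ζ : EuclideanSpace ℝ (Fin m) → ℝ} {g : Fin m → EuclideanSpace ℝ (Fin m) → ℝ}

theorem memLp_mul_of_isCompact {K : Set (EuclideanSpace ℝ (Fin m))} {r : ℝ≥0∞}
    (hK : IsCompact K) (hf : MemLp f r (volume.restrict K)) (hζ : Continuous ζ) :
    MemLp (fun y ↦ f y * ζ y) r (volume.restrict K) := by
  obtain ⟨B, hB⟩ := hK.exists_bound_of_continuousOn hζ.continuousOn
  exact (memLp_top_of_bound hζ.aestronglyMeasurable B
    ((ae_restrict_mem hK.measurableSet).mono hB)).mul' hf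

theorem memLp_mul_fderiv_of_lipschitzWith {μ : Measure (EuclideanSpace ℝ (Fin m))} {r : ℝ≥0∞}
    {D : ℝ≥0} (hf : MemLp f r μ) (hζ : LipschitzWith D ζ) (v : EuclideanSpace ℝ (Fin m)) :
    MemLp (fun y ↦ f y * fderiv ℝ ζ y v) r μ := by
  refine (memLp_top_of_bound (measurable_fderiv_apply_const ℝ ζ v).aestronglyMeasurable (D * ‖v‖)
    (Eventually.of_forall fun y ↦ ?_)).mul' hf
  exact (fderiv ℝ ζ y).le_of_opNorm_le (norm_fderiv_le_of_lipschitz ℝ hζ) v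

theorem ae_lineDeriv_mul {D : ℝ≥0} (hζ : LipschitzWith D ζ) {φ : EuclideanSpace ℝ (Fin m) → ℝ}
    (hφ : Differentiable ℝ φ) (v : EuclideanSpace ℝ (Fin m)) :
    ∀ᵐ y, lineDeriv ℝ (fun z ↦ ζ z * φ z) y v = ζ y * fderiv ℝ φ y v + φ y * fderiv ℝ ζ y v := by
  filter_upwards [hζ.ae_differentiableAt] with y hy
  rw [(hy.fun_mul (hφ y)).lineDeriv_eq_fderiv, fderiv_fun_mul hy (hφ y)]
  simp

theorem IsEuclideanSobolevLoc.weakDeriv_mul (hf : IsEuclideanSobolevLoc p U f g) (hp : 1 ≤ p)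
    (hU : IsOpen U) {D : ℝ≥0} (hζ : LipschitzWith D ζ) (i : Fin m)
    {φ : EuclideanSpace ℝ (Fin m) → ℝ} (hφ : ContDiff ℝ 1 φ) (hφc : HasCompactSupport φ)
    (hφU : tsupport φ ⊆ U) :
    ∫ y, f y * ζ y * fderiv ℝ φ y (EuclideanSpace.single i 1) =
      -∫ y, (g i y * ζ y + f y * fderiv ℝ ζ y (EuclideanSpace.single i 1)) * φ y := by
  set e : EuclideanSpace ℝ (Fin m) := EuclideanSpace.single i 1
  obtain ⟨L, hL⟩ := hφ.lipschitzWith_of_hasCompactSupport hφc one_ne_zero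
  obtain ⟨C, hC⟩ := lipschitzWith_mul_of_hasCompactSupport hζ hL hφc
  set θ : EuclideanSpace ℝ (Fin m) → ℝ := fun y ↦ ζ y * φ y
  have hθφ : tsupport θ ⊆ tsupport φ := tsupport_mul_subset_right
  have hθc : HasCompactSupport θ := hφc.mul_left
  obtain ⟨B, hB⟩ := hθc.exists_bound_of_continuous hC.continuous
  obtain ⟨b, hb⟩ := hφc.exists_bound_of_continuous hφ.continuous
  have hfK := hf.integrable_indicator hp hφc.isCompact hφU
  have hgθ : Integrable fun y ↦ g i y * θ y :=
    integrable_mul_of_support_subset (hf.integrable_indicator_deriv hp hφc.isCompact hφU i)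
      hC.continuous.aestronglyMeasurable hB ((subset_tsupport θ).trans hθφ)
  have hfθ : Integrable fun y ↦ f y * lineDeriv ℝ θ y e :=
    integrable_mul_of_support_subset hfK (measurable_lineDeriv hC.continuous).aestronglyMeasurable
      (fun y ↦ norm_lineDeriv_le_of_lipschitz ℝ hC) ((support_lineDeriv_subset e).trans hθφ)
  have hfφ : Integrable fun y ↦ f y * fderiv ℝ ζ y e * φ y :=
    integrable_mul_of_support_subset (integrable_indicator_of_memLp hp hφc.isCompact
      (memLp_mul_fderiv_of_lipschitzWith (hf.memLp _ hφU hφc.isCompact) hζ e))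
      hφ.continuous.aestronglyMeasurable hb (subset_tsupport φ)
  have hparts : ∫ y, f y * lineDeriv ℝ θ y e = -∫ y, g i y * θ y := by
    simpa only [id_eq, one_mul, mul_comm (θ _)] using hf.integral_comp_mul_lineDeriv hp hU
      hasDerivAt_id continuous_const (C := 1) (by simp) hC hθc (hθφ.trans hφU) i
  calc ∫ y, f y * ζ y * fderiv ℝ φ y e
      = ∫ y, (f y * lineDeriv ℝ θ y e - f y * fderiv ℝ ζ y e * φ y) := by
        refine integral_congr_ae ?_
        filter_upwards [ae_lineDeriv_mul hζ (hφ.differentiable one_ne_zero) e] with y hy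
        rw [hy]
        ring
    _ = -∫ y, (g i y * θ y + f y * fderiv ℝ ζ y e * φ y) := by
        rw [integral_sub hfθ hfφ, integral_add hgθ hfφ, hparts, neg_add, sub_eq_add_neg]
    _ = _ := by
        congr 2 with y
        simp only [θ]
        ring

theorem IsEuclideanSobolevLoc.mul_lipschitz (hf : IsEuclideanSobolevLoc p U f g) (hp : 1 ≤ p)
    (hU : IsOpen U) {D : ℝ≥0} (hζ : LipschitzWith D ζ) :
    IsEuclideanSobolevLoc p U (fun y ↦ f y * ζ y)
      (fun i y ↦ g i y * ζ y + f y * fderiv ℝ ζ y (EuclideanSpace.single i 1)) where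
  memLp K hKU hK := memLp_mul_of_isCompact hK (hf.memLp K hKU hK) hζ.continuous
  memLp_deriv i K hKU hK :=
    (memLp_mul_of_isCompact hK (hf.memLp_deriv i K hKU hK) hζ.continuous).add
      (memLp_mul_fderiv_of_lipschitzWith (hf.memLp K hKU hK) hζ _)
  weakDeriv i _ hφ := hf.weakDeriv_mul hp hU hζ i (hφ.of_le (by simp))

theorem IsEuclideanSobolevLoc.mul (hf : IsEuclideanSobolevLoc p U f g) (hp : 1 ≤ p)
    (hU : IsOpen U) (hζ : LocallyLipschitzOn U ζ) :
    IsEuclideanSobolevLoc p U (fun y ↦ f y * ζ y)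
      (fun i y ↦ g i y * ζ y + f y * fderiv ℝ ζ y (EuclideanSpace.single i 1)) := by
  refine isEuclideanSobolevLoc_of_forall_isCompact fun K hKU hK ↦ ?_
  obtain ⟨δ, hδ, hδU⟩ := hK.exists_cthickening_subset_open hU hKU
  obtain ⟨D, hD⟩ := (hζ.mono hδU).exists_lipschitzOnWith_of_compact hK.cthickening
  obtain ⟨ζ', hζ', hζζ'⟩ := hD.extend_real
  have hsub := Metric.thickening_subset_cthickening δ K
  refine ⟨Metric.thickening δ K, Metric.self_subset_thickening hδ K,
    ((hf.mono (hsub.trans hδU)).mul_lipschitz hp Metric.isOpen_thickening hζ').congr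
      (fun y hy ↦ by rw [hζζ' (hsub hy)]) fun i y hy ↦ ?_⟩
  have hnhds : ζ' =ᶠ[𝓝 y] ζ :=
    Eventually.mono (Metric.isOpen_thickening.mem_nhds hy) fun z hz ↦ (hζζ' (hsub hz)).symm
  simp only [hnhds.fderiv_eq, hnhds.eq_of_nhds]

end Multiplication

section Chart

variable {m : ℕ} {M : Type*} [MetricSpace M] [ChartedSpace (EuclideanSpace ℝ (Fin m)) M]
  {ψ : OpenPartialHomeomorph M (EuclideanSpace ℝ (Fin m))}

theorem chartVector_smul (c : ℝ) (y v : EuclideanSpace ℝ (Fin m)) :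
    chartVector ψ y (c • v) = c • chartVector ψ y v :=
  map_smul (mfderiv (𝓡 m) (𝓡 m) ψ.symm y) c v

theorem mdifferentiableAt_chart (hψ : ψ ∈ smoothCharts m M) {x : M} (hx : x ∈ ψ.source) :
    MDifferentiableAt (𝓡 m) (𝓡 m) ψ x :=
  (contMDiffAt_of_mem_maximalAtlas hψ hx).mdifferentiableAt (by simp)

theorem mdifferentiableAt_chart_symm (hψ : ψ ∈ smoothCharts m M) {y : EuclideanSpace ℝ (Fin m)}
    (hy : y ∈ ψ.target) : MDifferentiableAt (𝓡 m) (𝓡 m) ψ.symm y :=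
  (contMDiffAt_symm_of_mem_maximalAtlas hψ hy).mdifferentiableAt (by simp)

theorem mfderiv_chart_symm_line (hψ : ψ ∈ smoothCharts m M) {y v : EuclideanSpace ℝ (Fin m)}
    {t : ℝ} (ht : y + t • v ∈ ψ.target) :
    mfderiv 𝓘(ℝ, ℝ) (𝓡 m) (ψ.symm ∘ fun s : ℝ ↦ y + s • v) t 1 = chartVector ψ (y + t • v) v := by
  have hline : HasDerivAt (fun s : ℝ ↦ y + s • v) v t := by
    simpa using ((hasDerivAt_id t).smul_const v).const_add y
  refine (DFunLike.congr_fun (mfderiv_comp t (mdifferentiableAt_chart_symm hψ ht)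
    hline.differentiableAt.mdifferentiableAt) 1).trans ?_
  have hvelocity : fderiv ℝ (fun s : ℝ ↦ y + s • v) t 1 = v := by
    rw [fderiv_apply_one_eq_deriv, hline.deriv]
  rw [mfderiv_eq_fderiv]
  exact congrArg (mfderiv (𝓡 m) (𝓡 m) ψ.symm (y + t • v)) hvelocity

instance finiteDimensional_tangentSpace (x : M) : FiniteDimensional ℝ (TangentSpace (𝓡 m) x) :=
  inferInstanceAs (FiniteDimensional ℝ (EuclideanSpace ℝ (Fin m)))

theorem surjective_chartVector (hψ : ψ ∈ smoothCharts m M) {y : EuclideanSpace ℝ (Fin m)}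
    (hy : y ∈ ψ.target) : Function.Surjective (chartVector ψ y) := by
  have hcomp := mfderiv_comp y (mdifferentiableAt_chart hψ (ψ.map_target hy))
    (mdifferentiableAt_chart_symm hψ hy)
  have hid : mfderiv (𝓡 m) (𝓡 m) (ψ ∘ ψ.symm) y = mfderiv (𝓡 m) (𝓡 m) id y :=
    Filter.EventuallyEq.mfderiv_eq (ψ.eventually_right_inverse hy)
  rw [mfderiv_id] at hid
  have hinj : Function.Injective (mfderiv (𝓡 m) (𝓡 m) ψ.symm y) :=
    Function.LeftInverse.injective (g := mfderiv (𝓡 m) (𝓡 m) ψ (ψ.symm y)) fun v ↦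
      DFunLike.congr_fun (hcomp.symm.trans hid) v
  exact (LinearMap.injective_iff_surjective_of_finrank_eq_finrank
    (f := (mfderiv (𝓡 m) (𝓡 m) ψ.symm y : EuclideanSpace ℝ (Fin m) →L[ℝ]
      TangentSpace (𝓡 m) (ψ.symm y)).toLinearMap) rfl).1 hinj

variable [RiemannianBundle (fun x : M ↦ TangentSpace (𝓡 m) x)]

theorem dist_chart_symm_le [IsRiemannianManifold (𝓡 m) M] (hψ : ψ ∈ smoothCharts m M)
    {y v : EuclideanSpace ℝ (Fin m)} {L : ℝ} (hL : 0 ≤ L)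
    (htarget : ∀ t ∈ Icc (0 : ℝ) 1, y + t • v ∈ ψ.target)
    (hnorm : ∀ t ∈ Icc (0 : ℝ) 1, ‖chartVector ψ (y + t • v) v‖ ≤ L) :
    dist (ψ.symm y) (ψ.symm (y + v)) ≤ L := by
  have hline : ContDiff ℝ 1 fun t : ℝ ↦ y + t • v := by fun_prop
  have hpath : ContMDiffOn 𝓘(ℝ, ℝ) (𝓡 m) 1 (ψ.symm ∘ fun t : ℝ ↦ y + t • v) (Icc 0 1) :=
    ((contMDiffOn_symm_of_mem_maximalAtlas hψ).of_le (by simp)).comp hline.contMDiff.contMDiffOn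
      htarget
  have hlength : pathELength (𝓡 m) (ψ.symm ∘ fun t : ℝ ↦ y + t • v) 0 1 ≤ ENNReal.ofReal L := by
    rw [pathELength_eq_lintegral_mfderiv_Icc]
    calc _ ≤ ∫⁻ _ in Icc (0 : ℝ) 1, ENNReal.ofReal L := by
          refine setLIntegral_mono' measurableSet_Icc fun _ ht ↦ ?_
          rw [mfderiv_chart_symm_line hψ (htarget _ ht), ← ofReal_norm]
          exact ENNReal.ofReal_le_ofReal (hnorm _ ht)
      _ = ENNReal.ofReal L := by simp
  rw [dist_edist, IsRiemannianManifold.out (I := 𝓡 m)]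
  exact ENNReal.toReal_le_of_le_ofReal hL
    ((riemannianEDist_le_pathELength hpath (by simp) (by simp) zero_le_one).trans hlength)

variable [IsManifold (𝓡 m) ∞ M]
  [IsContinuousRiemannianBundle (EuclideanSpace ℝ (Fin m)) (fun x : M ↦ TangentSpace (𝓡 m) x)]

theorem continuousOn_norm_chartVector (hψ : ψ ∈ smoothCharts m M) :
    ContinuousOn (fun z : EuclideanSpace ℝ (Fin m) × EuclideanSpace ℝ (Fin m) ↦
      ‖chartVector ψ z.1 z.2‖) (ψ.target ×ˢ univ) := by
  have htangent := (contMDiffOn_symm_of_mem_maximalAtlas hψ).continuousOn_tangentMapWithin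
    (by simp) ψ.open_target.uniqueMDiffOn
  have hmodel : Continuous (fun z : EuclideanSpace ℝ (Fin m) × EuclideanSpace ℝ (Fin m) ↦
      (⟨z.1, z.2⟩ : TangentBundle (𝓡 m) (EuclideanSpace ℝ (Fin m)))) :=
    (tangentBundleModelSpaceHomeomorph (𝓡 m)).symm.continuous
  have hvector : ContinuousOn (fun z : EuclideanSpace ℝ (Fin m) × EuclideanSpace ℝ (Fin m) ↦
      (⟨ψ.symm z.1, chartVector ψ z.1 z.2⟩ : TangentBundle (𝓡 m) M)) (ψ.target ×ˢ univ) := by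
    refine (htangent.comp hmodel.continuousOn fun z hz ↦ hz.1).congr fun z hz ↦ ?_
    simp only [Function.comp_apply, tangentMapWithin, chartVector]
    rw [mfderivWithin_of_mem_nhds (ψ.open_target.mem_nhds hz.1)]
  refine (hvector.inner_bundle hvector).sqrt.congr fun z _ ↦ ?_
  beta_reduce
  rw [real_inner_self_eq_norm_sq, Real.sqrt_sq (norm_nonneg _)]

theorem exists_forall_norm_chartVector_le (hψ : ψ ∈ smoothCharts m M)
    {y : EuclideanSpace ℝ (Fin m)} (hy : y ∈ ψ.target) :
    ∃ C : ℝ≥0, ∀ᶠ z in 𝓝 y, ∀ v, ‖chartVector ψ z v‖ ≤ C * ‖v‖ := by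
  have hcont := (continuousOn_norm_chartVector hψ).continuousAt (x := (y, 0))
    ((ψ.open_target.prod isOpen_univ).mem_nhds ⟨hy, mem_univ _⟩)
  have hzero : ‖chartVector ψ y 0‖ < 1 := by
    rw [← zero_smul ℝ (0 : EuclideanSpace ℝ (Fin m)), chartVector_smul, zero_smul, norm_zero]
    exact one_pos
  have hsmall := hcont.eventually (gt_mem_nhds hzero)
  rw [nhds_prod_eq] at hsmall
  obtain ⟨P, hP, Q, hQ, hPQ⟩ := eventually_prod_iff.1 hsmall
  obtain ⟨ε, hε, hεQ⟩ := Metric.eventually_nhds_iff_ball.1 hQ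
  refine ⟨(2 / ε).toNNReal, hP.mono fun z hz v ↦ ?_⟩
  rw [Real.coe_toNNReal _ (by positivity)]
  rcases eq_or_ne v 0 with rfl | hv
  · rw [← zero_smul ℝ (0 : EuclideanSpace ℝ (Fin m)), chartVector_smul]
    simp
  have : 0 < ‖v‖ := norm_pos_iff.2 hv
  have hball : (ε / (2 * ‖v‖)) • v ∈ Metric.ball 0 ε := by
    rw [mem_ball_zero_iff, norm_smul, Real.norm_of_nonneg (by positivity)]
    field_simp
    linarith
  have hscaled : ε / (2 * ‖v‖) * ‖chartVector ψ z v‖ < 1 := by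
    simpa only [chartVector_smul, norm_smul, Real.norm_of_nonneg (show 0 ≤ ε / (2 * ‖v‖) by
      positivity)] using hPQ hz (hεQ _ hball)
  rw [div_mul_eq_mul_div, div_lt_one (by positivity)] at hscaled
  rw [div_mul_eq_mul_div, le_div_iff₀ hε]
  linarith

variable [IsRiemannianManifold (𝓡 m) M]

theorem locallyLipschitzOn_chart_symm (hψ : ψ ∈ smoothCharts m M) :
    LocallyLipschitzOn ψ.target ψ.symm := by
  intro y hy
  obtain ⟨C, hC⟩ := exists_forall_norm_chartVector_le hψ hy
  obtain ⟨δ, hδ, hball⟩ := Metric.eventually_nhds_iff_ball.1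
    (hC.and (ψ.open_target.mem_nhds hy))
  refine ⟨C, Metric.ball y δ, mem_nhdsWithin_of_mem_nhds (Metric.ball_mem_nhds y hδ),
    LipschitzOnWith.of_dist_le_mul fun a ha b hb ↦ ?_⟩
  have hsegment : ∀ t ∈ Icc (0 : ℝ) 1, a + t • (b - a) ∈ Metric.ball y δ := fun t ht ↦
    (convex_ball y δ).add_smul_sub_mem ha hb ht
  have := dist_chart_symm_le hψ (L := C * ‖b - a‖) (by positivity)
    (fun t ht ↦ (hball _ (hsegment t ht)).2) (fun t ht ↦ (hball _ (hsegment t ht)).1 _)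
  rwa [add_sub_cancel, ← dist_eq_norm, dist_comm b] at this

theorem hasSlopeLE_chart_symm_line (hψ : ψ ∈ smoothCharts m M) {y : EuclideanSpace ℝ (Fin m)}
    (hy : y ∈ ψ.target) (v : EuclideanSpace ℝ (Fin m)) :
    HasSlopeLE (fun t : ℝ ↦ ψ.symm (y + t • v)) 0 ‖chartVector ψ y v‖ := by
  intro ε hε
  have hcont := (continuousOn_norm_chartVector hψ).continuousAt (x := (y, v))
    ((ψ.open_target.prod isOpen_univ).mem_nhds ⟨hy, mem_univ _⟩)
  have hline : Tendsto (fun t : ℝ ↦ (y + t • v, v)) (𝓝 0) (𝓝 (y, v)) := by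
    have : Continuous fun t : ℝ ↦ (y + t • v, v) := by fun_prop
    simpa using this.tendsto 0
  have hnorm : ∀ᶠ t in 𝓝 (0 : ℝ), ‖chartVector ψ (y + t • v) v‖ < ‖chartVector ψ y v‖ + ε :=
    hline.eventually (hcont.eventually (gt_mem_nhds (lt_add_of_pos_right _ hε)))
  have htarget : ∀ᶠ t in 𝓝 (0 : ℝ), y + t • v ∈ ψ.target :=
    ((continuous_fst.tendsto _).comp hline).eventually (ψ.open_target.mem_nhds hy)
  obtain ⟨δ, hδ, hball⟩ := Metric.eventually_nhds_iff_ball.1 (hnorm.and htarget)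
  filter_upwards [Metric.ball_mem_nhds 0 hδ] with t ht
  have hsegment : ∀ s ∈ Icc (0 : ℝ) 1, s * t ∈ Metric.ball (0 : ℝ) δ := fun s hs ↦ by
    rw [mem_ball_zero_iff] at ht ⊢
    rw [norm_mul, Real.norm_of_nonneg hs.1]
    exact (mul_le_of_le_one_left (norm_nonneg t) hs.2).trans_lt ht
  rw [zero_smul, add_zero, dist_comm, dist_zero_right, mul_comm]
  refine dist_chart_symm_le hψ (by positivity) (fun s hs ↦ ?_) fun s hs ↦ ?_
  · rw [smul_smul]
    exact (hball _ (hsegment s hs)).2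
  · rw [smul_smul, chartVector_smul, norm_smul]
    gcongr
    exact (hball _ (hsegment s hs)).1.le

end Chart

section HopfRinow

section LengthSpace

variable {X : Type*} [PseudoMetricSpace X] {x : X} {r : ℝ}

theorem totallyBounded_of_forall_subset_thickening {S : Set X}
    (h : ∀ ε > 0, ∃ K, TotallyBounded K ∧ S ⊆ Metric.thickening ε K) : TotallyBounded S := by
  rw [Metric.totallyBounded_iff]
  intro ε hε
  obtain ⟨K, hK, hSK⟩ := h (ε / 2) (half_pos hε)
  obtain ⟨t, ht, hKt⟩ := Metric.totallyBounded_iff.1 hK (ε / 2) (half_pos hε)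
  refine ⟨t, ht, fun y hy ↦ ?_⟩
  obtain ⟨z, hzK, hyz⟩ := Metric.mem_thickening_iff.1 (hSK hy)
  obtain ⟨w, hwt, hzw⟩ := mem_iUnion₂.1 (hKt hzK)
  refine mem_iUnion₂.2 ⟨w, hwt, ?_⟩
  rw [Metric.mem_ball] at hzw ⊢
  linarith [dist_triangle y z w]

theorem exists_gt_isCompact_closedBall [LocallyCompactSpace X]
    (hlength : ∀ s > 0, Metric.ball x (r + s) ⊆ Metric.thickening s (Metric.closedBall x r))
    (hr : IsCompact (Metric.closedBall x r)) : ∃ r' > r, IsCompact (Metric.closedBall x r') := by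
  obtain ⟨δ, hδ, hcompact⟩ := hr.exists_isCompact_cthickening
  refine ⟨r + δ / 2, by linarith, hcompact.of_isClosed_subset Metric.isClosed_closedBall ?_⟩
  exact (Metric.closedBall_subset_ball (by linarith)).trans
    ((hlength δ hδ).trans (Metric.thickening_subset_cthickening _ _))

theorem isCompact_closedBall_of_mem_closure [CompleteSpace X]
    (hlength : ∀ r s : ℝ, 0 ≤ r → 0 < s →
      Metric.ball x (r + s) ⊆ Metric.thickening s (Metric.closedBall x r))
    (hr : r ∈ closure {r | 0 ≤ r ∧ IsCompact (Metric.closedBall x r)}) :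
    IsCompact (Metric.closedBall x r) := by
  refine isCompact_iff_totallyBounded_isComplete.2 ⟨?_, Metric.isClosed_closedBall.isComplete⟩
  refine totallyBounded_of_forall_subset_thickening fun ε hε ↦ ?_
  obtain ⟨r', ⟨hr'0, hr'⟩, hdist⟩ := Metric.mem_closure_iff.1 hr ε hε
  have hlt : r < r' + ε := by linarith [(abs_lt.1 ((Real.dist_eq r r').symm ▸ hdist)).2]
  exact ⟨_, hr'.totallyBounded,
    (Metric.closedBall_subset_ball hlt).trans (hlength r' ε hr'0 hε)⟩

end LengthSpace

theorem properSpace_of_ball_subset_thickening {X : Type*} [MetricSpace X] [CompleteSpace X]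
    [LocallyCompactSpace X]
    (hlength : ∀ (x : X) (r s : ℝ), 0 ≤ r → 0 < s →
      Metric.ball x (r + s) ⊆ Metric.thickening s (Metric.closedBall x r)) : ProperSpace X := by
  refine ProperSpace.of_isCompact_closedBall_of_le 0 fun x R hR ↦ ?_
  set S : Set ℝ := {r | 0 ≤ r ∧ IsCompact (Metric.closedBall x r)}
  suffices Icc 0 R ⊆ S from (this ⟨hR, le_rfl⟩).2
  refine IsClosed.Icc_subset_of_forall_exists_gt ?_ ⟨le_rfl, by simp⟩ ?_
  · refine isClosed_of_closure_subset fun r hr ↦ ?_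
    have hrR : r ∈ Icc 0 R := closure_minimal inter_subset_right isClosed_Icc hr
    exact ⟨⟨hrR.1, isCompact_closedBall_of_mem_closure (hlength x)
      (closure_mono inter_subset_left hr)⟩, hrR⟩
  · rintro r ⟨⟨hr, hcompact⟩, -⟩ b hb
    obtain ⟨r', hr', hcompact'⟩ :=
      exists_gt_isCompact_closedBall (fun s ↦ hlength x r s hr) hcompact
    refine ⟨min r' b, ⟨hr.trans (le_min hr'.le (le_of_lt hb)), ?_⟩, lt_min hr' hb, min_le_right _ _⟩
    exact hcompact'.of_isClosed_subset Metric.isClosed_closedBall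
      (Metric.closedBall_subset_closedBall (min_le_left _ _))

section Riemannian

variable {m : ℕ} {M : Type*} [MetricSpace M] [ChartedSpace (EuclideanSpace ℝ (Fin m)) M]
  [RiemannianBundle (fun x : M ↦ TangentSpace (𝓡 m) x)]

variable (m)

theorem exists_dist_add_dist_lt [IsRiemannianManifold (𝓡 m) M] {x y : M} {r L : ℝ} (hr : 0 ≤ r)
    (hry : r ≤ dist x y) (hL : dist x y < L) : ∃ z, dist x z = r ∧ dist x z + dist z y < L := by
  have hedist : riemannianEDist (𝓡 m) x y < ENNReal.ofReal L := by
    rw [← IsRiemannianManifold.out (I := 𝓡 m), edist_dist]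
    exact (ENNReal.ofReal_lt_ofReal_iff_of_nonneg dist_nonneg).2 hL
  obtain ⟨γ, hγ0, hγ1, hγ, hlength⟩ := exists_lt_of_riemannianEDist_lt hedist
  have hcont : ContinuousOn (fun t ↦ dist x (γ t)) (Icc 0 1) :=
    (continuous_const.dist continuous_id).comp_continuousOn hγ.continuousOn
  obtain ⟨t, ht, htr⟩ : r ∈ (fun t ↦ dist x (γ t)) '' Icc 0 1 :=
    intermediate_value_Icc zero_le_one hcont ⟨by simpa [hγ0] using hr, by simpa [hγ1] using hry⟩
  refine ⟨γ t, htr, ?_⟩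
  have hleft : edist x (γ t) ≤ pathELength (𝓡 m) γ 0 t := by
    rw [IsRiemannianManifold.out (I := 𝓡 m)]
    exact riemannianEDist_le_pathELength (hγ.mono (Icc_subset_Icc_right ht.2)) hγ0 rfl ht.1
  have hright : edist (γ t) y ≤ pathELength (𝓡 m) γ t 1 := by
    rw [IsRiemannianManifold.out (I := 𝓡 m)]
    exact riemannianEDist_le_pathELength (hγ.mono (Icc_subset_Icc_left ht.1)) rfl hγ1 ht.2
  rw [← pathELength_add ht.1 ht.2] at hlength
  have hsum := (add_le_add hleft hright).trans_lt hlength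
  rwa [edist_dist, edist_dist, ← ENNReal.ofReal_add dist_nonneg dist_nonneg,
    ENNReal.ofReal_lt_ofReal_iff_of_nonneg (by positivity)] at hsum

theorem ball_subset_thickening_closedBall [IsRiemannianManifold (𝓡 m) M] (x : M) {r s : ℝ}
    (hr : 0 ≤ r) (hs : 0 < s) :
    Metric.ball x (r + s) ⊆ Metric.thickening s (Metric.closedBall x r) := by
  intro y hy
  rw [Metric.mem_thickening_iff]
  rcases le_total (dist x y) r with hle | hge
  · exact ⟨y, Metric.mem_closedBall'.2 hle, by rwa [dist_self]⟩
  obtain ⟨z, hxz, hxzy⟩ := exists_dist_add_dist_lt m hr hge (Metric.mem_ball'.1 hy)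
  exact ⟨z, Metric.mem_closedBall'.2 hxz.le, by rw [dist_comm]; linarith⟩

/-- The Hopf–Rinow theorem. -/
theorem properSpace_of_isRiemannianManifold [IsRiemannianManifold (𝓡 m) M] [CompleteSpace M] :
    ProperSpace M := by
  have := ChartedSpace.locallyCompactSpace (EuclideanSpace ℝ (Fin m)) M
  exact properSpace_of_ball_subset_thickening fun x r s hr hs ↦
    ball_subset_thickening_closedBall m x hr hs

end Riemannian

end HopfRinow

section Gradient

variable {m : ℕ} {M : Type*} [MetricSpace M] [ChartedSpace (EuclideanSpace ℝ (Fin m)) M]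
  {ψ : OpenPartialHomeomorph M (EuclideanSpace ℝ (Fin m))} {ζ : M → ℝ}
  {y : EuclideanSpace ℝ (Fin m)}

theorem mdifferentiableAt_iff_differentiableAt_comp_chart_symm (hψ : ψ ∈ smoothCharts m M)
    (hy : y ∈ ψ.target) :
    MDifferentiableAt (𝓡 m) 𝓘(ℝ, ℝ) ζ (ψ.symm y) ↔ DifferentiableAt ℝ (ζ ∘ ψ.symm) y := by
  refine ⟨fun hζ ↦ (hζ.comp y (mdifferentiableAt_chart_symm hψ hy)).differentiableAt,
    fun hζ ↦ ?_⟩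
  have hsource := ψ.map_target hy
  have hread : MDifferentiableAt (𝓡 m) 𝓘(ℝ, ℝ) (ζ ∘ ψ.symm) (ψ (ψ.symm y)) := by
    rw [ψ.right_inv hy]
    exact hζ.mdifferentiableAt
  refine (hread.comp _ (mdifferentiableAt_chart hψ hsource)).congr_of_eventuallyEq ?_
  filter_upwards [ψ.eventually_left_inverse hsource] with z hz
  exact (congrArg ζ hz).symm

variable [RiemannianBundle (fun x : M ↦ TangentSpace (𝓡 m) x)]

/-- The Riemannian gradient of `ζ` at `x`, the vector representing the differential of `ζ`. It is
zero where `ζ` is not differentiable. -/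
def gradient (m : ℕ) {M : Type*} [MetricSpace M] [ChartedSpace (EuclideanSpace ℝ (Fin m)) M]
    [RiemannianBundle (fun x : M ↦ TangentSpace (𝓡 m) x)] (ζ : M → ℝ) (x : M) :
    TangentSpace (𝓡 m) x :=
  have : CompleteSpace (TangentSpace (𝓡 m) x) := FiniteDimensional.complete ℝ _
  (InnerProductSpace.toDual ℝ (TangentSpace (𝓡 m) x)).symm
    (mfderiv (𝓡 m) 𝓘(ℝ, ℝ) ζ x : TangentSpace (𝓡 m) x →L[ℝ] ℝ)

theorem inner_gradient (ζ : M → ℝ) (x : M) (v : TangentSpace (𝓡 m) x) :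
    ⟪gradient m ζ x, v⟫ = (mfderiv (𝓡 m) 𝓘(ℝ, ℝ) ζ x : TangentSpace (𝓡 m) x →L[ℝ] ℝ) v := by
  have : CompleteSpace (TangentSpace (𝓡 m) x) := FiniteDimensional.complete ℝ _
  exact InnerProductSpace.toDual_symm_apply

theorem gradient_eq_zero_of_not_mdifferentiableAt {x : M}
    (hζ : ¬ MDifferentiableAt (𝓡 m) 𝓘(ℝ, ℝ) ζ x) : gradient m ζ x = 0 := by
  refine inner_self_eq_zero (𝕜 := ℝ).1 ?_
  rw [inner_gradient, mfderiv_zero_of_not_mdifferentiableAt hζ]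
  rfl

theorem inner_gradient_chartVector (hψ : ψ ∈ smoothCharts m M) (ζ : M → ℝ) (hy : y ∈ ψ.target)
    (v : EuclideanSpace ℝ (Fin m)) :
    ⟪gradient m ζ (ψ.symm y), chartVector ψ y v⟫ = fderiv ℝ (ζ ∘ ψ.symm) y v := by
  by_cases hζ : MDifferentiableAt (𝓡 m) 𝓘(ℝ, ℝ) ζ (ψ.symm y)
  · rw [inner_gradient, ← mfderiv_eq_fderiv]
    exact (DFunLike.congr_fun (mfderiv_comp y hζ (mdifferentiableAt_chart_symm hψ hy)) v).symm
  · rw [gradient_eq_zero_of_not_mdifferentiableAt hζ, inner_zero_left,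
      fderiv_zero_of_not_differentiableAt
        (mt (mdifferentiableAt_iff_differentiableAt_comp_chart_symm hψ hy).2 hζ)]
    rfl

variable [IsManifold (𝓡 m) ∞ M]
  [IsContinuousRiemannianBundle (EuclideanSpace ℝ (Fin m)) (fun x : M ↦ TangentSpace (𝓡 m) x)]
  [IsRiemannianManifold (𝓡 m) M]

theorem HasSlopeLE.abs_fderiv_comp_chart_symm_le {L : ℝ} (hψ : ψ ∈ smoothCharts m M)
    (hy : y ∈ ψ.target) (hζ : HasSlopeLE ζ (ψ.symm y) L) (hL : 0 ≤ L)
    (hd : DifferentiableAt ℝ (ζ ∘ ψ.symm) y) (v : EuclideanSpace ℝ (Fin m)) :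
    |fderiv ℝ (ζ ∘ ψ.symm) y v| ≤ L * ‖chartVector ψ y v‖ := by
  have hslope : HasSlopeLE (fun t : ℝ ↦ ζ (ψ.symm (y + t • v))) 0 (L * ‖chartVector ψ y v‖) := by
    refine HasSlopeLE.comp (f := fun t : ℝ ↦ ψ.symm (y + t • v)) ?_ hL
      (hasSlopeLE_chart_symm_line hψ hy v)
    rwa [zero_smul, add_zero]
  exact hslope.abs_hasDerivAt_le (hd.hasFDerivAt.hasLineDerivAt v) (by positivity)

theorem HasSlopeLE.norm_gradient_le {x : M} {L : ℝ} (hζ : HasSlopeLE ζ x L) (hL : 0 ≤ L) :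
    ‖gradient m ζ x‖ ≤ L := by
  obtain ⟨ψ, hψ, y, hy, rfl⟩ : ∃ ψ ∈ smoothCharts m M, ∃ y ∈ ψ.target, ψ.symm y = x :=
    ⟨chartAt _ x, IsManifold.chart_mem_maximalAtlas x, chartAt _ x x,
      mem_chart_target _ x, (chartAt _ x).left_inv (mem_chart_source _ x)⟩
  by_cases hd : MDifferentiableAt (𝓡 m) 𝓘(ℝ, ℝ) ζ (ψ.symm y)
  swap
  · rwa [gradient_eq_zero_of_not_mdifferentiableAt hd, norm_zero]
  obtain ⟨v, hv⟩ := surjective_chartVector hψ hy (gradient m ζ (ψ.symm y))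
  have hsq : ‖gradient m ζ (ψ.symm y)‖ * ‖gradient m ζ (ψ.symm y)‖
      ≤ L * ‖gradient m ζ (ψ.symm y)‖ := by
    have := (le_abs_self _).trans (hζ.abs_fderiv_comp_chart_symm_le hψ hy hL
      ((mdifferentiableAt_iff_differentiableAt_comp_chart_symm hψ hy).1 hd) v)
    rwa [← inner_gradient_chartVector hψ ζ hy, hv, real_inner_self_eq_norm_mul_norm] at this
  rcases (norm_nonneg (gradient m ζ (ψ.symm y))).eq_or_lt with hzero | hpos
  · rwa [← hzero]
  · exact le_of_mul_le_mul_right hsq hpos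

end Gradient

section Volume

variable {m : ℕ} {M : Type*} [MetricSpace M] [ChartedSpace (EuclideanSpace ℝ (Fin m)) M]
  {φ ψ : OpenPartialHomeomorph M (EuclideanSpace ℝ (Fin m))} {Z : Set (EuclideanSpace ℝ (Fin m))}

theorem volume_transition_preimage_eq_zero (hφ : φ ∈ smoothCharts m M) (hψ : ψ ∈ smoothCharts m M)
    (hZ : volume Z = 0) : volume (ψ.target ∩ ψ.symm ⁻¹' (φ.source ∩ φ ⁻¹' Z)) = 0 := by
  have hsmooth : ContDiffOn ℝ ∞ (ψ ∘ φ.symm) (φ.target ∩ φ.symm ⁻¹' ψ.source) :=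
    contMDiffOn_iff_contDiffOn.1 ((contMDiffOn_of_mem_maximalAtlas hψ).comp'
      (contMDiffOn_symm_of_mem_maximalAtlas hφ))
  refine measure_mono_null ?_ (addHaar_image_eq_zero_of_differentiableOn_of_addHaar_eq_zero volume
    ((hsmooth.differentiableOn (by simp)).mono inter_subset_right)
    (measure_mono_null inter_subset_left hZ))
  rintro y ⟨hy, hyφ, hyZ⟩
  refine ⟨φ (ψ.symm y), ⟨hyZ, φ.map_source hyφ, ?_⟩, ?_⟩
  · rw [mem_preimage, φ.left_inv hyφ]
    exact ψ.map_target hy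
  · rw [Function.comp_apply, φ.left_inv hyφ, ψ.right_inv hy]

variable [RiemannianBundle (fun x : M ↦ TangentSpace (𝓡 m) x)] [MeasurableSpace M]

theorem vol_eq_zero_of_forall_chartVolume_eq_zero {N : Set M} (hN : MeasurableSet N)
    (h : ∀ ψ ∈ smoothCharts m M, chartVolume ψ N = 0) : vol m M N = 0 := by
  -- `vol` is a supremum of measures, so a common upper bound vanishing on `N` is enough.
  have hle : vol m M ≤ (⊤ : ℝ≥0∞) • Measure.count.restrict Nᶜ := by
    refine iSup₂_le fun ψ hψ ↦ Measure.le_iff.2 fun s hs ↦ ?_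
    rw [Measure.smul_apply, Measure.restrict_apply hs, smul_eq_mul]
    rcases (s ∩ Nᶜ).eq_empty_or_nonempty with hempty | hnonempty
    · rw [measure_mono_null (sdiff_eq_empty.1 hempty) (h ψ hψ)]
      exact zero_le
    · rw [ENNReal.top_mul (Measure.count_ne_zero hnonempty)]
      exact le_top
  refine le_antisymm ((hle N).trans ?_) zero_le
  simp [Measure.restrict_apply hN]

variable [BorelSpace M]

theorem chartVolume_eq_zero {N : Set M} (hN : MeasurableSet N)
    (h : volume (ψ.target ∩ ψ.symm ⁻¹' N) = 0) : chartVolume ψ N = 0 := by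
  have hmeas : AEMeasurable ψ.symm (volume.restrict ψ.target) :=
    ψ.continuousOn_symm.aemeasurable ψ.open_target.measurableSet
  have hac : (volume.restrict ψ.target).withDensity
      (fun y ↦ ENNReal.ofReal (chartDensity ψ y)) ≪ volume.restrict ψ.target :=
    withDensity_absolutelyContinuous _ _
  rw [chartVolume, Measure.map_apply_of_aemeasurable (hmeas.mono_ac hac) hN]
  refine hac ?_
  rwa [Measure.restrict_apply' ψ.open_target.measurableSet, inter_comm]

theorem vol_chart_preimage_eq_zero (hφ : φ ∈ smoothCharts m M) (hZ : volume Z = 0) :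
    vol m M (φ.source ∩ φ ⁻¹' Z) = 0 := by
  have hN : MeasurableSet (φ.source ∩ φ ⁻¹' toMeasurable volume Z) := by
    rw [← Subtype.image_preimage_coe]
    exact φ.open_source.measurableSet.subtype_image
      (φ.continuousOn.domRestrict.measurable (measurableSet_toMeasurable _ _))
  refine measure_mono_null (inter_subset_inter_right _ (preimage_mono (subset_toMeasurable _ _)))
    (vol_eq_zero_of_forall_chartVolume_eq_zero hN fun ψ hψ ↦ chartVolume_eq_zero hN ?_)
  exact volume_transition_preimage_eq_zero hφ hψ ((measure_toMeasurable Z).trans hZ)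

theorem map_chart_vol_absolutelyContinuous (hφ : φ ∈ smoothCharts m M) :
    ((vol m M).restrict φ.source).map φ ≪ volume.restrict φ.target := by
  refine Measure.AbsolutelyContinuous.mk fun Z hZ hZ0 ↦ ?_
  rw [Measure.restrict_apply hZ] at hZ0
  rw [Measure.map_apply_of_aemeasurable
    (φ.continuousOn.aemeasurable φ.open_source.measurableSet) hZ,
    Measure.restrict_apply' φ.open_source.measurableSet]
  refine measure_mono_null ?_ (vol_chart_preimage_eq_zero hφ hZ0)
  exact fun x hx ↦ ⟨hx.2, hx.1, φ.map_source hx.2⟩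

theorem aemeasurable_of_aemeasurable_comp_chart_symm (hφ : φ ∈ smoothCharts m M) {u : M → ℝ}
    (hu : AEMeasurable (fun y ↦ u (φ.symm y)) (volume.restrict φ.target)) :
    AEMeasurable u ((vol m M).restrict φ.source) := by
  have hφm : AEMeasurable φ ((vol m M).restrict φ.source) :=
    φ.continuousOn.aemeasurable φ.open_source.measurableSet
  refine ((hu.mono_ac (map_chart_vol_absolutelyContinuous hφ)).comp_aemeasurable hφm).congr ?_
  filter_upwards [self_mem_ae_restrict φ.open_source.measurableSet] with x hx
  rw [Function.comp_apply, φ.left_inv hx]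

theorem IsSobolevLoc.aemeasurable [IsManifold (𝓡 m) ∞ M] [SecondCountableTopology M] {p : ℝ}
    (hp : 1 ≤ p) {u : M → ℝ} {X : (x : M) → TangentSpace (𝓡 m) x} (hu : IsSobolevLoc p u X) :
    AEMeasurable u (vol m M) := by
  obtain ⟨s, hs, hcover⟩ := TopologicalSpace.countable_cover_nhds
    (fun x : M ↦ chart_source_mem_nhds (EuclideanSpace ℝ (Fin m)) x)
  have : Countable s := hs.to_subtype
  rw [← Measure.restrict_univ (μ := vol m M), ← hcover, biUnion_eq_iUnion]
  refine aemeasurable_iUnion_iff.2 fun x ↦ ?_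
  have hchart : chartAt _ (x : M) ∈ smoothCharts m M := IsManifold.chart_mem_maximalAtlas _
  exact aemeasurable_of_aemeasurable_comp_chart_symm hchart
    ((hu _ hchart).aestronglyMeasurable hp (chartAt _ (x : M)).open_target).aemeasurable

end Volume

section TestFunction

variable {m : ℕ} {M : Type*} [MetricSpace M] [ChartedSpace (EuclideanSpace ℝ (Fin m)) M]
  [IsManifold (𝓡 m) ∞ M] [RiemannianBundle (fun x : M ↦ TangentSpace (𝓡 m) x)]
  [IsContinuousRiemannianBundle (EuclideanSpace ℝ (Fin m)) (fun x : M ↦ TangentSpace (𝓡 m) x)]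
  [IsRiemannianManifold (𝓡 m) M]
  {p : ℝ} {u : M → ℝ} {X : (x : M) → TangentSpace (𝓡 m) x} {h g : ℝ → ℝ} {R : ℝ}

theorem IsSobolevLoc.comp_mul (hu : IsSobolevLoc p u X) (hp : 1 ≤ p) {F F' : ℝ → ℝ} {C : ℝ≥0}
    (hF : ∀ t, HasDerivAt F (F' t) t) (hF' : Continuous F') (hC : ∀ t, |F' t| ≤ C) {ζ : M → ℝ}
    (hζ : LocallyLipschitz ζ) :
    IsSobolevLoc p (fun x ↦ F (u x) * ζ x)
      (fun x ↦ (F' (u x) * ζ x) • X x + F (u x) • gradient m ζ x) := by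
  intro ψ hψ
  have hζψ : LocallyLipschitzOn ψ.target (ζ ∘ ψ.symm) := by
    intro y hy
    obtain ⟨K, s, hs, hK⟩ := locallyLipschitzOn_chart_symm hψ hy
    obtain ⟨L, t, ht, hL⟩ := hζ (ψ.symm y)
    refine ⟨L * K, s ∩ ψ.symm ⁻¹' t, inter_mem hs ?_,
      hL.comp (hK.mono inter_subset_left) fun z hz ↦ hz.2⟩
    exact mem_nhdsWithin_of_mem_nhds ((ψ.continuousAt_symm hy).preimage_mem_nhds ht)
  refine (((hu ψ hψ).comp hp ψ.open_target hF hF' hC).mul hp ψ.open_target hζψ).congr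
    (fun y _ ↦ rfl) fun i y hy ↦ ?_
  simp only [inner_add_left, real_inner_smul_left, coordField, Function.comp_apply,
    inner_gradient_chartVector hψ ζ hy]
  ring

theorem locallyLipschitz_rpow_const (hp : 1 ≤ p) : LocallyLipschitz fun t : ℝ ↦ t ^ p :=
  (Real.contDiff_rpow_const_of_le (n := 1) (by simpa using hp)).locallyLipschitz

theorem IsRadialWeight.locallyLipschitz_rpow (hhg : IsRadialWeight h g R) (hp : 1 ≤ p) (x₀ : M) :
    LocallyLipschitz fun x ↦ h (dist x x₀) ^ p := by
  obtain ⟨K, hK⟩ := hhg.exists_lipschitzWith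
  exact (locallyLipschitz_rpow_const hp).comp
    (hK.comp (LipschitzWith.dist_left x₀)).locallyLipschitz

theorem IsRadialWeight.norm_gradient_rpow_le (hhg : IsRadialWeight h g R) (hp : 1 ≤ p)
    (x x₀ : M) :
    ‖gradient m (fun z ↦ h (dist z x₀) ^ p) x‖ ≤
      p * h (dist x x₀) ^ (p - 1) * g (dist x x₀) := by
  have hd₀ : 0 ≤ p * h (dist x x₀) ^ (p - 1) :=
    mul_nonneg (by linarith) (Real.rpow_nonneg (hhg.nonneg _) _)
  have hpow : HasSlopeLE (fun t : ℝ ↦ t ^ p) (h (dist x x₀)) (p * h (dist x x₀) ^ (p - 1)) := by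
    simpa only [abs_of_nonneg hd₀] using
      hasSlopeLE_of_hasDerivAt (Real.hasDerivAt_rpow_const (x := h (dist x x₀)) (Or.inr hp))
  have hdist : HasSlopeLE (fun z : M ↦ dist z x₀) x 1 := by
    simpa using hasSlopeLE_of_lipschitzWith (LipschitzWith.dist_left x₀) x
  have hh : HasSlopeLE (fun z ↦ h (dist z x₀)) x (g (dist x x₀)) := by
    simpa only [mul_one] using HasSlopeLE.comp (f := fun z ↦ dist z x₀)
      (hhg.hasSlopeLE _) (hhg.slope_nonneg _) hdist
  exact (HasSlopeLE.comp (f := fun z ↦ h (dist z x₀)) hpow hd₀ hh).norm_gradient_le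
    (mul_nonneg hd₀ (hhg.slope_nonneg _))

variable [MeasurableSpace M]

theorem isTestFunction_truncPow_mul_rpow [ProperSpace M] (hu : IsSobolevLoc p u X) (hp : 1 ≤ p)
    {β N : ℝ} (hβ : 0 < β) (hN : 0 < N) (s₀ : ℝ) (hhg : IsRadialWeight h g R) (x₀ : M) :
    IsTestFunction p {x | s₀ < u x} (fun x ↦ truncPow β N (u x - s₀) * h (dist x x₀) ^ p)
      (fun x ↦ (truncPowDeriv β N (u x - s₀) * h (dist x x₀) ^ p) • X x +
        truncPow β N (u x - s₀) • gradient m (fun z ↦ h (dist z x₀) ^ p) x) where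
  sobolev := by
    refine hu.comp_mul hp (F := fun t ↦ truncPow β N (t - s₀))
      (F' := fun t ↦ truncPowDeriv β N (t - s₀)) (C := (β * N).toNNReal)
      (fun t ↦ (hasDerivAt_truncPow hN (t - s₀)).comp_sub_const t s₀)
      ((continuous_truncPowDeriv hN).comp (continuous_sub_right s₀)) (fun t ↦ ?_)
      (hhg.locallyLipschitz_rpow hp x₀)
    rw [abs_of_nonneg (truncPowDeriv_nonneg hβ hN _), Real.coe_toNNReal _ (by positivity)]
    exact truncPowDeriv_le hβ hN _
  compactSupport := by
    refine HasCompactSupport.intro (isCompact_closedBall x₀ R) fun x hx ↦ ?_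
    rw [Metric.mem_closedBall, not_le] at hx
    rw [hhg.eq_zero _ hx, Real.zero_rpow (by linarith), mul_zero]
  nonneg _ := mul_nonneg (truncPow_nonneg hβ hN _) (Real.rpow_nonneg (hhg.nonneg _) _)
  eq_zero := by
    refine Eventually.of_forall fun x hx ↦ ?_
    have hux : u x - s₀ ≤ 0 := sub_nonpos.2 (not_lt.1 hx)
    simp [truncPow_eq_zero hN hux, truncPowDeriv_eq_zero hN hux]

end TestFunction

section Caccioppoli

theorem neg_inner_smul_add_smul_le {E : Type*} [NormedAddCommGroup E] [InnerProductSpace ℝ E]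
    {p k ψ ψ' η g H : ℝ} {a ξ Z : E} (hp : 1 < p) (hk : 0 ≤ k) (hnonneg : 0 ≤ ⟪a, ξ⟫)
    (hnorm : ‖a‖ ≤ k * ⟪a, ξ⟫ ^ ((p - 1) / p)) (hψ : 0 ≤ ψ) (hψ' : 0 ≤ ψ') (hη : 0 ≤ η)
    (hg : 0 ≤ g) (hZ : ‖Z‖ ≤ p * η ^ (p - 1) * g) (hH : 0 ≤ H)
    (hψH : ψ ^ p ≤ H * ψ' ^ (p - 1)) :
    -⟪a, (ψ' * η ^ p) • ξ + ψ • Z⟫ ≤ (p - 1) ^ (p - 1) * k ^ p * (H * g ^ p) := by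
  have hyoung := mul_mul_rpow_le_of_rpow_le hp hk hnonneg hψ hψ' hη hg hH hψH
  have hcross : -⟪a, Z⟫ ≤ k * ⟪a, ξ⟫ ^ ((p - 1) / p) * (p * η ^ (p - 1) * g) :=
    calc -⟪a, Z⟫ ≤ ‖a‖ * ‖Z‖ := (neg_le_abs _).trans (abs_real_inner_le_norm a Z)
      _ ≤ _ := mul_le_mul hnorm hZ (norm_nonneg _) ((norm_nonneg a).trans hnorm)
  rw [inner_add_right, real_inner_smul_right, real_inner_smul_right]
  linarith [mul_le_mul_of_nonneg_left hcross hψ]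

theorem neg_integral_le_lintegral_of_le {α : Type*} [MeasurableSpace α] {ν : Measure α}
    {f G : α → ℝ} (hfG : ∀ x, -f x ≤ G x) :
    ((-∫ x, f x ∂ν : ℝ) : EReal) ≤ ((∫⁻ x, ENNReal.ofReal (G x) ∂ν : ℝ≥0∞) : EReal) := by
  by_cases hf : Integrable f ν
  · have hle : -∫ x, f x ∂ν ≤ (∫⁻ x, ENNReal.ofReal (-f x) ∂ν).toReal := by
      rw [← integral_neg, integral_eq_lintegral_pos_part_sub_lintegral_neg_part hf.fun_neg]
      exact sub_le_self _ ENNReal.toReal_nonneg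
    calc ((-∫ x, f x ∂ν : ℝ) : EReal)
        ≤ (((∫⁻ x, ENNReal.ofReal (-f x) ∂ν).toReal : ℝ) : EReal) := EReal.coe_le_coe_iff.2 hle
      _ = ((∫⁻ x, ENNReal.ofReal (-f x) ∂ν : ℝ≥0∞) : EReal) :=
        EReal.coe_ennreal_toReal hf.neg.lintegral_lt_top.ne
      _ ≤ _ := EReal.coe_ennreal_le_coe_ennreal_iff.2
        (lintegral_mono fun x ↦ ENNReal.ofReal_le_ofReal (hfG x))
  · rw [integral_undef hf, neg_zero]
    exact EReal.coe_ennreal_nonneg _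

variable {m : ℕ} {M : Type*} [MetricSpace M] [ChartedSpace (EuclideanSpace ℝ (Fin m)) M]
  [IsManifold (𝓡 m) ∞ M] [RiemannianBundle (fun x : M ↦ TangentSpace (𝓡 m) x)]
  [IsContinuousRiemannianBundle (EuclideanSpace ℝ (Fin m)) (fun x : M ↦ TangentSpace (𝓡 m) x)]
  [IsRiemannianManifold (𝓡 m) M] [MeasurableSpace M] [ProperSpace M]
  {p k s₀ : ℝ} {A : (x : M) → ℝ → TangentSpace (𝓡 m) x → TangentSpace (𝓡 m) x}
  {u V : M → ℝ} {X : (x : M) → TangentSpace (𝓡 m) x} {h g : ℝ → ℝ} {R : ℝ}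

/- The Caccioppoli inequality, from the test function `truncPow β N (u - s₀) * h ^ p`. The term
with `∇u` produced by the cutoff is absorbed by the coercivity of `A`. -/
theorem WeakIneq.lintegral_truncPow_le_lintegral_truncBound
    (hLu : WeakIneq p A u X (fun x ↦ ENNReal.ofReal (V x * u x ^ (p - 1))) s₀) (hp : 1 < p)
    (hk : 0 ≤ k) (hA : IsWeaklyCoercive p k A) (hu : IsSobolevLoc p u X) (hV : ∀ x, 0 ≤ V x)
    (hs₀ : 0 ≤ s₀) {β N : ℝ} (hβ : 0 < β) (hN : 0 < N) (hhg : IsRadialWeight h g R) (x₀ : M) :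
    ∫⁻ x, ENNReal.ofReal (V x * h (dist x x₀) ^ p * max (u x - s₀) 0 ^ (p - 1) *
        truncPow β N (max (u x - s₀) 0)) ∂(vol m M) ≤
      ∫⁻ x, ENNReal.ofReal ((p - 1) ^ (p - 1) * k ^ p * g (dist x x₀) ^ p *
        truncBound p β N (max (u x - s₀) 0)) ∂(vol m M) := by
  rw [← EReal.coe_ennreal_le_coe_ennreal_iff]
  refine le_trans ?_ ((hLu _ _ (isTestFunction_truncPow_mul_rpow hu hp.le hβ hN s₀ hhg x₀)).trans
    (neg_integral_le_lintegral_of_le fun x ↦ ?_))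
  · refine EReal.coe_ennreal_le_coe_ennreal_iff.2 (lintegral_mono fun x ↦ ?_)
    have hhp : 0 ≤ h (dist x x₀) ^ p := Real.rpow_nonneg (hhg.nonneg _) _
    have hψ := truncPow_nonneg hβ hN (u x - s₀)
    rw [← ENNReal.ofReal_mul' (mul_nonneg hψ hhp)]
    refine ENNReal.ofReal_le_ofReal ?_
    rw [truncPow_max_zero hN]
    rcases le_total (u x - s₀) 0 with hux | hux
    · simp [truncPow_eq_zero hN hux]
    · have hpow : (u x - s₀) ^ (p - 1) ≤ u x ^ (p - 1) :=
        Real.rpow_le_rpow hux (sub_le_self _ hs₀) (by linarith)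
      rw [max_eq_left hux]
      calc V x * h (dist x x₀) ^ p * (u x - s₀) ^ (p - 1) * truncPow β N (u x - s₀)
          = V x * (u x - s₀) ^ (p - 1) * (truncPow β N (u x - s₀) * h (dist x x₀) ^ p) := by ring
        _ ≤ _ := by gcongr; exact hV x
  · refine (neg_inner_smul_add_smul_le hp hk (hA.nonneg x _ _) (hA.norm_le x _ _)
      (truncPow_nonneg hβ hN _) (truncPowDeriv_nonneg hβ hN _) (hhg.nonneg _)
      (hhg.slope_nonneg _) (hhg.norm_gradient_rpow_le hp.le x x₀)
      (truncBound_nonneg hβ (le_max_right (u x - s₀) 0)) ?_).trans_eq (by ring)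
    simpa only [truncPow_max_zero hN, truncPowDeriv_max_zero hN] using
      truncPow_rpow_le hp hβ hN (le_max_right (u x - s₀) 0)

end Caccioppoli

section TruncationLimit

variable {α : Type*} [MeasurableSpace α] {ν : Measure α} {a b w : α → ℝ} {β p : ℝ}

theorem lintegral_mul_rpow_le_liminf (hβ : 0 < β) (ha : AEMeasurable a ν) (hw : AEMeasurable w ν)
    (hw₀ : ∀ x, 0 ≤ w x) :
    ∫⁻ x, ENNReal.ofReal (a x * w x ^ β) ∂ν ≤
      liminf (fun n : ℕ ↦ ∫⁻ x, ENNReal.ofReal (a x * truncPow β (n + 1) (w x)) ∂ν) atTop := by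
  have hlim : ∀ x, Tendsto (fun n : ℕ ↦ ENNReal.ofReal (a x * truncPow β (n + 1) (w x))) atTop
      (𝓝 (ENNReal.ofReal (a x * w x ^ β))) := fun x ↦
    ENNReal.tendsto_ofReal ((tendsto_truncPow hβ (hw₀ x)).const_mul (a x))
  simp only [← fun x ↦ (hlim x).liminf_eq]
  refine lintegral_liminf_le' fun n ↦ (ha.mul ?_).ennreal_ofReal
  have hcont : Continuous (truncPow β (n + 1)) :=
    continuous_iff_continuousAt.2 fun t ↦ (hasDerivAt_truncPow (by positivity) t).continuousAt
  exact hcont.measurable.comp_aemeasurable hw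

theorem tendsto_lintegral_mul_truncBound (hβ : 0 < β) (hb : AEMeasurable b ν)
    (hb₀ : ∀ x, 0 ≤ b x) (hw : AEMeasurable w ν) (hw₀ : ∀ x, 0 ≤ w x)
    (hfin : ∫⁻ x, ENNReal.ofReal (b x * w x ^ (β + p - 1)) ∂ν ≠ ⊤) :
    Tendsto (fun n : ℕ ↦ ∫⁻ x, ENNReal.ofReal (b x * truncBound p β (n + 1) (w x)) ∂ν) atTop
      (𝓝 (∫⁻ x, ENNReal.ofReal (b x * (β ^ (1 - p) * w x ^ (β + p - 1))) ∂ν)) := by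
  have hc : 0 ≤ β ^ (1 - p) + β := by positivity
  refine tendsto_lintegral_of_dominated_convergence'
    (fun x ↦ ENNReal.ofReal (β ^ (1 - p) + β) * ENNReal.ofReal (b x * w x ^ (β + p - 1)))
    (fun n ↦ (hb.mul ((measurable_truncBound p β _).comp_aemeasurable hw)).ennreal_ofReal)
    (fun n ↦ Eventually.of_forall fun x ↦ ?_) ?_ (Eventually.of_forall fun x ↦
      ENNReal.tendsto_ofReal ((tendsto_truncBound p β (w x)).const_mul (b x)))
  · beta_reduce
    rw [← ENNReal.ofReal_mul hc, mul_left_comm]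
    exact ENNReal.ofReal_le_ofReal
      (mul_le_mul_of_nonneg_left (truncBound_le hβ (hw₀ x)) (hb₀ x))
  · rw [lintegral_const_mul' _ _ ENNReal.ofReal_ne_top]
    exact ENNReal.mul_ne_top ENNReal.ofReal_ne_top hfin

theorem lintegral_mul_rpow_le_of_lintegral_truncPow_le (hβ : 0 < β) (ha : AEMeasurable a ν)
    (hb : AEMeasurable b ν) (hb₀ : ∀ x, 0 ≤ b x) (hw : AEMeasurable w ν) (hw₀ : ∀ x, 0 ≤ w x)
    (hfin : ∫⁻ x, ENNReal.ofReal (b x * w x ^ (β + p - 1)) ∂ν ≠ ⊤)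
    (hle : ∀ N > 0, ∫⁻ x, ENNReal.ofReal (a x * truncPow β N (w x)) ∂ν ≤
      ∫⁻ x, ENNReal.ofReal (b x * truncBound p β N (w x)) ∂ν) :
    ∫⁻ x, ENNReal.ofReal (a x * w x ^ β) ∂ν ≤
      ∫⁻ x, ENNReal.ofReal (b x * (β ^ (1 - p) * w x ^ (β + p - 1))) ∂ν :=
  calc _ ≤ liminf (fun n : ℕ ↦ ∫⁻ x, ENNReal.ofReal (a x * truncPow β (n + 1) (w x)) ∂ν) atTop :=
        lintegral_mul_rpow_le_liminf hβ ha hw hw₀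
    _ ≤ liminf (fun n : ℕ ↦ ∫⁻ x, ENNReal.ofReal (b x * truncBound p β (n + 1) (w x)) ∂ν)
          atTop := liminf_le_liminf (Eventually.of_forall fun n ↦ hle (n + 1) (by positivity))
    _ = _ := (tendsto_lintegral_mul_truncBound hβ hb hb₀ hw hw₀ hfin).liminf_eq

end TruncationLimit

section PowerMeasure

variable {α : Type*} [MeasurableSpace α] {ν : Measure α} {u : α → ℝ} {s₀ q : ℝ}

/-- The measure `(u - s₀)₊ ^ q ν`, whose mass on balls is the quantity to be estimated. -/
def powerMeasure (ν : Measure α) (u : α → ℝ) (s₀ q : ℝ) : Measure α :=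
  ν.withDensity fun x ↦ ENNReal.ofReal (max (u x - s₀) 0 ^ q)

theorem aemeasurable_max_sub_rpow (hu : AEMeasurable u ν) :
    AEMeasurable (fun x ↦ max (u x - s₀) 0 ^ q) ν :=
  ((hu.sub_const s₀).max aemeasurable_const).pow_const q

theorem lintegral_powerMeasure (hu : AEMeasurable u ν) (f : α → ℝ) :
    ∫⁻ x, ENNReal.ofReal (f x) ∂(powerMeasure ν u s₀ q) =
      ∫⁻ x, ENNReal.ofReal (f x * max (u x - s₀) 0 ^ q) ∂ν := by
  rw [powerMeasure, lintegral_withDensity_eq_lintegral_mul_non_measurable₀ _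
    (aemeasurable_max_sub_rpow hu).ennreal_ofReal
    (Eventually.of_forall fun _ ↦ ENNReal.ofReal_lt_top)]
  refine lintegral_congr fun x ↦ ?_
  rw [Pi.mul_apply, mul_comm, ENNReal.ofReal_mul' (by positivity)]

theorem powerMeasure_ne_zero (hu : AEMeasurable u ν)
    (hs₀u : (s₀ : EReal) < essSup (fun x ↦ (u x : EReal)) ν) : powerMeasure ν u s₀ q ≠ 0 := by
  intro hzero
  have hae := (withDensity_eq_zero_iff (aemeasurable_max_sub_rpow hu).ennreal_ofReal).1 hzero
  refine hs₀u.not_ge (essSup_le_of_ae_le _ ?_)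
  filter_upwards [hae] with x hx
  refine EReal.coe_le_coe_iff.2 (not_lt.1 fun hux ↦ ?_)
  have : 0 < max (u x - s₀) 0 := lt_max_of_lt_left (sub_pos.2 hux)
  exact (ENNReal.ofReal_pos.2 (by positivity : 0 < max (u x - s₀) 0 ^ q)).ne' hx

end PowerMeasure

section Hardy

variable {m : ℕ} {M : Type*} [MetricSpace M] [ChartedSpace (EuclideanSpace ℝ (Fin m)) M]
  [RiemannianBundle (fun x : M ↦ TangentSpace (𝓡 m) x)] [MeasurableSpace M]
  {p k s₀ q : ℝ} {A : (x : M) → ℝ → TangentSpace (𝓡 m) x → TangentSpace (𝓡 m) x}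
  {u V : M → ℝ} {X : (x : M) → TangentSpace (𝓡 m) x}

theorem logBallIntegral_eq_log_powerMeasure_ball [OpensMeasurableSpace M] (x₀ : M) (R : ℝ) :
    logBallIntegral m u s₀ q x₀ R =
      ENNReal.log (powerMeasure (vol m M) u s₀ q (Metric.ball x₀ R)) := by
  rw [powerMeasure, withDensity_apply _ measurableSet_ball, logBallIntegral]

/- Letting the truncation of the power `q - p + 1` of `(u - s₀)₊` disappear in the Caccioppoli
inequality leaves the same power `q` of `(u - s₀)₊` on both sides. -/
theorem WeakIneq.radialHardy [BorelSpace M] [IsManifold (𝓡 m) ∞ M]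
    [IsContinuousRiemannianBundle (EuclideanSpace ℝ (Fin m)) (fun x : M ↦ TangentSpace (𝓡 m) x)]
    [IsRiemannianManifold (𝓡 m) M] [ProperSpace M]
    (hLu : WeakIneq p A u X (fun x ↦ ENNReal.ofReal (V x * u x ^ (p - 1))) s₀) (hp : 1 < p)
    (hk : 0 ≤ k) (hA : IsWeaklyCoercive p k A) (hu : IsSobolevLoc p u X) (hV : Measurable V)
    (hV₀ : ∀ x, 0 ≤ V x) (hs₀ : 0 ≤ s₀) (hq : p - 1 < q) (x₀ : M) :
    RadialHardy p ((p - 1) ^ (p - 1) * k ^ p * (q - p + 1) ^ (1 - p)) V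
      (powerMeasure (vol m M) u s₀ q) x₀ := by
  intro h g R hhg hfin
  have hp₁ : 0 ≤ p - 1 := by linarith
  have hβ : 0 < q - p + 1 := by linarith
  have hqβ : q - p + 1 + p - 1 = q := by ring
  have hum : AEMeasurable u (vol m M) := hu.aemeasurable hp.le
  have hdist : Measurable fun x : M ↦ dist x x₀ := by fun_prop
  have hw₀ : ∀ x, 0 ≤ max (u x - s₀) 0 := fun x ↦ le_max_right _ _
  have hweight : AEMeasurable (fun x ↦ V x * h (dist x x₀) ^ p * max (u x - s₀) 0 ^ (p - 1))
      (vol m M) := by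
    obtain ⟨L, hL⟩ := hhg.exists_lipschitzWith
    exact (hV.mul ((hL.continuous.measurable.comp hdist).pow_const p)).aemeasurable.mul
      (aemeasurable_max_sub_rpow hum)
  have hslope : AEMeasurable (fun x ↦ (p - 1) ^ (p - 1) * k ^ p * g (dist x x₀) ^ p)
      (vol m M) :=
    (((hhg.measurable_slope.comp hdist).pow_const p).const_mul _).aemeasurable
  have hc : 0 ≤ (p - 1) ^ (p - 1) * k ^ p := by positivity
  have hslope_fin := hhg.lintegral_slope_ne_top (one_pos.trans hp) hc hfin
  rw [lintegral_powerMeasure hum] at hslope_fin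
  have hlimit := lintegral_mul_rpow_le_of_lintegral_truncPow_le hβ hweight hslope
    (fun x ↦ mul_nonneg hc (Real.rpow_nonneg (hhg.slope_nonneg _) p))
    ((hum.sub_const s₀).max aemeasurable_const) hw₀ (by rwa [hqβ])
    fun N hN ↦ hLu.lintegral_truncPow_le_lintegral_truncBound hp hk hA hu hV₀ hs₀ hβ hN hhg x₀
  rw [lintegral_powerMeasure hum, lintegral_powerMeasure hum]
  calc _ = _ := lintegral_congr fun x ↦ ?_
    _ ≤ _ := hlimit
    _ = _ := lintegral_congr fun x ↦ ?_
  · rw [mul_assoc (V x * h (dist x x₀) ^ p), ← Real.rpow_add_of_nonneg (hw₀ x) hp₁ hβ.le,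
      show p - 1 + (q - p + 1) = q by ring]
  · rw [hqβ]
    congr 1
    ring

end Hardy

section ContinuousMetric

variable {EB HB B F : Type*} [NormedAddCommGroup EB] [NormedSpace ℝ EB] [TopologicalSpace HB]
  [TopologicalSpace B] [ChartedSpace HB B]
  [NormedAddCommGroup F] [NormedSpace ℝ F] {E : B → Type*} [TopologicalSpace (TotalSpace F E)]
  [∀ x, NormedAddCommGroup (E x)] [∀ x, InnerProductSpace ℝ (E x)] [FiberBundle F E]
  [VectorBundle ℝ F E]

theorem isContinuousRiemannianBundle_of_isContMDiffRiemannianBundle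
    (IB : ModelWithCorners ℝ EB HB) (n : ℕ∞ω)
    [IsContMDiffRiemannianBundle IB n F E] : IsContinuousRiemannianBundle F E := by
  obtain ⟨g, hg, hinner⟩ :=
    IsContMDiffRiemannianBundle.exists_contMDiff (IB := IB) (n := n) (F := F) (E := E)
  exact ⟨g, hg.continuous, hinner⟩

end ContinuousMetric

end RiemannianGrowth

end

theorem theorem3_general {m : ℕ} {M : Type*} [MetricSpace M] [CompleteSpace M]
    [MeasurableSpace M] [BorelSpace M]
    [ChartedSpace (EuclideanSpace ℝ (Fin m)) M] [IsManifold (𝓡 m) ∞ M]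
    [RiemannianBundle (fun x : M ↦ TangentSpace (𝓡 m) x)]
    [IsContinuousRiemannianBundle (EuclideanSpace ℝ (Fin m)) (fun x : M ↦ TangentSpace (𝓡 m) x)]
    [IsRiemannianManifold (𝓡 m) M]
    {p k lam μ : ℝ} (hp : 1 < p) (hk : 0 < k) (hlam : 0 < lam) (hμ₀ : 0 ≤ μ)
    {A : (x : M) → ℝ → TangentSpace (𝓡 m) x → TangentSpace (𝓡 m) x}
    (hA : IsWeaklyCoercive p k A)
    {V : M → ℝ} (hVmeas : Measurable V) (hVpos : ∀ x, 0 < V x) (hV : PotentialBound V lam μ)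
    {u : M → ℝ} {gradu : (x : M) → TangentSpace (𝓡 m) x} (hu : IsSobolevLoc p u gradu)
    {s₀ : ℝ} (hs₀ : 0 ≤ s₀) (hs₀u : (s₀ : EReal) < essSup (fun x ↦ (u x : EReal)) (vol m M))
    (hLu : WeakIneq p A u gradu (fun x ↦ ENNReal.ofReal (V x * u x ^ (p - 1))) s₀)
    (x₀ : M) {q : ℝ} (hq : p - 1 < q) :
    (μ < p →
      (growthConst p q lam k : EReal) ≤
        liminf (fun R : ℝ ↦ (((1 - μ / p) / R ^ (1 - μ / p) : ℝ) : EReal) *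
          logBallIntegral m u s₀ q x₀ R) atTop) ∧
    (μ = p →
      ((growthConst p q lam k + p : ℝ) : EReal) ≤
        liminf (fun R : ℝ ↦ ((1 / Real.log R : ℝ) : EReal) *
          logBallIntegral m u s₀ q x₀ R) atTop) := by
  have : ProperSpace M := properSpace_of_isRiemannianManifold m
  have hp₀ : 0 < p := one_pos.trans hp
  have hHardy := hLu.radialHardy hp hk.le hA hu hVmeas (fun x ↦ (hVpos x).le) hs₀ hq x₀
  have hK := hardyConst_pos hp hk hq
  have hC : 0 < growthConst p q lam k / p := div_pos (growthConst_pos hp hk hlam hq) hp₀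
  have hKC := mul_growthConst_div_rpow hp hk hlam hq
  have hν := powerMeasure_ne_zero (q := q) (hu.aemeasurable hp.le) hs₀u
  have hVlam := fun a (ha : a < lam) ↦ hV.eventually_lt hμ₀ ha x₀
  simp only [logBallIntegral_eq_log_powerMeasure_ball]
  rw [← mul_div_cancel₀ (growthConst p q lam k) hp₀.ne']
  refine ⟨fun hμ ↦ ?_, ?_⟩
  · exact hHardy.le_liminf_log_measure_ball_of_lt hp₀ hK hVmeas hVpos hν hC hKC hμ₀ hμ hVlam
  · rintro rfl
    exact hHardy.add_le_liminf_log_measure_ball hp₀ hK hVmeas hVpos hν hC hKC hVlam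

theorem theorem3 {m : ℕ} {M : Type*} [MetricSpace M] [ConnectedSpace M] [CompleteSpace M]
    [SecondCountableTopology M] [MeasurableSpace M] [BorelSpace M]
    [ChartedSpace (EuclideanSpace ℝ (Fin m)) M] [IsManifold (𝓡 m) ∞ M]
    [RiemannianBundle (fun x : M ↦ TangentSpace (𝓡 m) x)]
    [IsContMDiffRiemannianBundle (𝓡 m) ∞ (EuclideanSpace ℝ (Fin m))
      (fun x : M ↦ TangentSpace (𝓡 m) x)]
    [IsRiemannianManifold (𝓡 m) M]
    (p k lam μ : ℝ) (hp : 1 < p) (hk : 0 < k) (hlam : 0 < lam) (hμ₀ : 0 ≤ μ) (hμp : μ ≤ p)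
    (A : (x : M) → ℝ → TangentSpace (𝓡 m) x → TangentSpace (𝓡 m) x)
    (hA : IsWeaklyCoercive p k A)
    (V : M → ℝ) (hVcont : Continuous V) (hVpos : ∀ x, 0 < V x) (hV : PotentialBound V lam μ)
    (u : M → ℝ) (gradu : (x : M) → TangentSpace (𝓡 m) x) (hu : IsSobolevLoc p u gradu)
    (s₀ : ℝ) (hs₀ : 0 ≤ s₀) (hs₀u : (s₀ : EReal) < essSup (fun x ↦ (u x : EReal)) (vol m M))
    (hLu : WeakIneq p A u gradu (fun x ↦ ENNReal.ofReal (V x * u x ^ (p - 1))) s₀)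
    (x₀ : M) (q : ℝ) (hq : p - 1 < q) :
    0 < growthConst p q lam k ∧
    (μ < p →
      (growthConst p q lam k : EReal) ≤
        liminf (fun R : ℝ ↦ (((1 - μ / p) / R ^ (1 - μ / p) : ℝ) : EReal) *
          logBallIntegral m u s₀ q x₀ R) atTop) ∧
    (μ = p →
      (∃! C₁ : ℝ, p < C₁ ∧
        C₁ ^ (1 / p) * (C₁ - p) ^ (1 / p.conjExponent) = growthConst p q lam k) ∧
      (∀ C₁ : ℝ, p < C₁ →
        C₁ ^ (1 / p) * (C₁ - p) ^ (1 / p.conjExponent) = growthConst p q lam k →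
        (C₁ : EReal) ≤ liminf (fun R : ℝ ↦ ((1 / Real.log R : ℝ) : EReal) *
          logBallIntegral m u s₀ q x₀ R) atTop) ∧
      (∀ ℓ : EReal,
        Tendsto (fun R : ℝ ↦ ((1 / Real.log R : ℝ) : EReal) *
          logBallIntegral m u s₀ q x₀ R) atTop (𝓝 ℓ) →
        ((growthConst p q lam k + p : ℝ) : EReal) ≤ ℓ)) := by
  have := isContinuousRiemannianBundle_of_isContMDiffRiemannianBundle (𝓡 m) ∞
    (F := EuclideanSpace ℝ (Fin m)) (E := fun x : M ↦ TangentSpace (𝓡 m) x)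
  have hC := growthConst_pos hp hk hlam hq
  obtain ⟨hlt, heq⟩ := theorem3_general hp hk hlam hμ₀ hA hVcont.measurable hVpos hV hu hs₀ hs₀u
    hLu x₀ hq
  refine ⟨hC, hlt, fun hμ ↦ ⟨existsUnique_rpow_mul_rpow_eq hp hC, fun C₁ hC₁ hC₁C ↦ ?_,
    fun ℓ hℓ ↦ (heq hμ).trans_eq hℓ.liminf_eq⟩⟩
  exact (EReal.coe_le_coe_iff.2 (le_add_of_rpow_mul_rpow_eq hp hC hC₁ hC₁C)).trans (heq hμ)
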